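/- Let $G$ be a finite group and $H\subseteq G$ a subgroup; everything is finite-dimensional over $\mathbb C$. Write $x\triangleright g=xgx^{-1}$, and for a representation $V$ of a subgroup $K\subseteq G$ let $x\triangleright V$ be the representation of $x\triangleright K=xKx^{-1}$ on the same space in which $y$ acts as $x^{-1}yx$. Let ${}^G_H\mathcal M_H$ be the monoidal category (under $\otimes_{\mathbb CH}$) of $G$-graded vector spaces $M$ with a two-sided $H$-action satisfying $|hmk|=h|m|k$, and let $\mathcal{YD}_G$ be the category of Yetter–Drinfeld modules, that is, of $G$-graded vector spaces with a left $G$-action satisfying $|xv|=x|v|x^{-1}$. For $d\in G$ put $\mathrm{Stab}_H(dH)=H\cap(d\triangleright H)$, and let $\mathrm{Ind}_d:\mathrm{Rep}(\mathrm{Stab}_H(dH))\to{}^G_H\mathcal M_H$ be given by $\mathrm{Ind}_d(W)=\mathbb CH\otimes_{\mathbb C\mathrm{Stab}_H(dH)}(W\otimes\mathbb C[dH])$, with $|h\otimes w\otimes dk|=hdk$. For $g\in G$ and $V\in\mathrm{Rep}(C_G(g))$ let $\mathrm{Ind}_g(V)=\mathbb CG\otimes_{\mathbb CC_G(g)}V\in\mathcal{YD}_G$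 with $|x\otimes v|=xgx^{-1}$ (which of the two constructions is meant is clear from the context). The right center of a monoidal category $\mathcal C$ consists of pairs $(V,c)$ of an object $V$ and a half-braiding $c_X:X\otimes V\cong V\otimes X$, $X\in\mathcal C$. Then the following hold. (0) For every $d\in G$, $\mathrm{Ind}_d$ is an equivalence onto the full subcategory of those $M\in{}^G_H\mathcal M_H$ whose homogeneous elements have degrees in $HdH$, inverse to $M\mapsto M_{dH}/H$, where $M_{dH}=\bigoplus_{g\in dH}M_g$. (1) There is an equivalence of categories $E$ from $\mathcal{YD}_G$ to the right center of ${}^G_H\mathcal M_H$, whose composite with the underlying functor to ${}^G_H\mathcal M_H$ is isomorphic to the functor $\mathcal U(N)=N\otimes\mathbb CH$, where $a(n\otimes b)=an\otimes ab$, $(n\otimes b)b'=n\otimes bb'$, $|n\otimes b|=|n|b$; under this isomorphism the half-braiding of $E(N)$ is $m\otimes(n\otimes k)\mapsto(|m|n\otimes1)\otimes mk$ for $m$ homogeneous in $M\in{}^G_H\mathcal M_H$, $n\in N$, $k\in H$. (2) Let $g\in G$, $C=C_G(g)$, $V\in\mathrm{Rep}(C)$, and let $\mathfrak X_g$ be a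 set of representatives of the double cosets in $H\backslash G/C$. Then $$\mathcal U(\mathrm{Ind}_g(V))\cong\bigoplus_{x\in\mathfrak X_g}\mathrm{Ind}_{x\triangleright g}\Big(\mathrm{Ind}_{H\cap(x\triangleright C)}^{\mathrm{Stab}_H((x\triangleright g)H)}\mathrm{Res}^{x\triangleright C}_{H\cap(x\triangleright C)}(x\triangleright V)\Big).$$ (3) The underlying functor from the right center to ${}^G_H\mathcal M_H$ has a two-sided adjoint $\mathcal K$. Let $d\in G$, $S=\mathrm{Stab}_H(dH)$, $W\in\mathrm{Rep}(S)$, let $\mathfrak C$ be a set of representatives of the conjugacy classes of $G$, for each $g\in\mathfrak C$ let $\mathfrak X_g$ be a set of representatives of $H\backslash G/C_G(g)$, and let $\mathfrak H_d\subseteq H$ be a set of representatives of $H/S$. Then, identifying the right center with $\mathcal{YD}_G$ through $E$, $$\mathcal K(\mathrm{Ind}_d(W))\cong\bigoplus_{\substack{g\in\mathfrak C,\ x\in\mathfrak X_g,\ h\in\mathfrak H_d\\ x\triangleright g\in hdH}}\mathrm{Ind}_{x\triangleright g}\Big(\mathrm{Ind}_{(h\triangleright S)\cap(x\triangleright C_G(g))}^{x\triangleright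 C_G(g)}\mathrm{Res}^{h\triangleright S}_{(h\triangleright S)\cap(x\triangleright C_G(g))}(h\triangleright W)\Big),$$ where $x\triangleright C_G(g)=C_G(x\triangleright g)$. -/

import Mathlib

open CategoryTheory MonoidalCategory TensorProduct

namespace GrpBimod

noncomputable section

/-! ### Graded vector spaces -/

/-- A finite-dimensional complex vector space graded by the finite set `G`, i.e. with a
decomposition as a direct sum indexed by `G`.  The grading is recorded by the projections
`comp g` onto the homogeneous components (equivalently, it is a `ℂG`-comodule, with coaction
`v ↦ ∑ g, comp g v ⊗ g`); a vector `v` is homogeneous of degree `g` when `comp g v = v`. -/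
structure GrVect (G : Type) [Fintype G] where
  carrier : Type
  [addCommGroup : AddCommGroup carrier]
  [module : Module ℂ carrier]
  [finiteDimensional : FiniteDimensional ℂ carrier]
  comp : G → carrier →ₗ[ℂ] carrier
  comp_self : ∀ g v, comp g (comp g v) = comp g v
  comp_ne : ∀ g k, g ≠ k → ∀ v, comp g (comp k v) = 0
  sum_comp : ∀ v, ∑ g, comp g v = v

attribute [instance] GrVect.addCommGroup GrVect.module GrVect.finiteDimensional

instance (G : Type) [Fintype G] : CoeSort (GrVect G) Type := ⟨GrVect.carrier⟩

/-- The homogeneous component of degree `g`. -/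
def GrVect.piece {G : Type} [Fintype G] (M : GrVect G) (g : G) : Submodule ℂ M :=
  LinearMap.range (M.comp g)

theorem GrVect.mem_piece {G : Type} [Fintype G] (M : GrVect G) (g : G) (v : M) :
    v ∈ M.piece g ↔ M.comp g v = v :=
  ⟨by rintro ⟨w, rfl⟩; exact M.comp_self g w, fun h => ⟨v, h⟩⟩

open Classical in
/-- The homogeneous components form a direct sum decomposition. -/
theorem GrVect.isInternal {G : Type} [Fintype G] (M : GrVect G) :
    DirectSum.IsInternal M.piece := by
  rw [DirectSum.isInternal_submodule_iff_iSupIndep_and_iSup_eq_top]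
  constructor
  · rw [iSupIndep_def]
    intro i
    rw [Submodule.disjoint_def]
    intro v hv hv'
    rw [GrVect.mem_piece] at hv
    have hle : (⨆ j, ⨆ (_ : j ≠ i), M.piece j) ≤ LinearMap.ker (M.comp i) := by
      refine iSup_le fun j => iSup_le fun hj => ?_
      rintro _ ⟨w, rfl⟩
      exact M.comp_ne i j hj.symm w
    have := hle hv'
    rw [LinearMap.mem_ker, hv] at this
    exact this
  · rw [eq_top_iff]
    intro v _
    rw [← M.sum_comp v]
    exact Submodule.sum_mem _ fun g _ => Submodule.mem_iSup_of_mem g ⟨v, rfl⟩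

variable {G : Type} [Group G] [Fintype G]

/-! ### Graded bimodules -/

/-- The objects of `{}^G_H M_H`: `G`-graded vector spaces with a two-sided `H`-action such that
`|h m k| = h |m| k`. -/
structure Bim (H : Subgroup G) extends GrVect G where
  left : Representation ℂ H carrier
  right : Representation ℂ (H)ᵐᵒᵖ carrier
  left_right : ∀ h k v, left h (right k v) = right k (left h v)
  comp_act : ∀ (h k : H) (g : G) (v : carrier),
    comp (h * g * k) (left h (right (MulOpposite.op k) v)) =
      left h (right (MulOpposite.op k) (comp g v))

namespace Bim

variable {H : Subgroup G}

instance : CoeSort (Bim H) Type := ⟨fun M => M.carrier⟩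

theorem comp_left (M : Bim H) (h : H) (g : G) (v : M) :
    M.comp g (M.left h v) = M.left h (M.comp ((h : G)⁻¹ * g) v) := by
  have := M.comp_act h 1 ((h : G)⁻¹ * g) v
  simpa using this

theorem comp_right (M : Bim H) (k : H) (g : G) (v : M) :
    M.comp g (M.right (MulOpposite.op k) v) =
      M.right (MulOpposite.op k) (M.comp (g * (k : G)⁻¹) v) := by
  have := M.comp_act 1 k (g * (k : G)⁻¹) v
  simpa using this

/-- Morphisms: linear maps preserving the grading and both actions. -/
@[ext]
structure Hom (M N : Bim H) where
  lin : M →ₗ[ℂ] N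
  comp_lin : ∀ g v, lin (M.comp g v) = N.comp g (lin v)
  left_lin : ∀ h v, lin (M.left h v) = N.left h (lin v)
  right_lin : ∀ k v, lin (M.right k v) = N.right k (lin v)

instance : Category (Bim H) where
  Hom := Hom
  id M := ⟨LinearMap.id, fun _ _ => rfl, fun _ _ => rfl, fun _ _ => rfl⟩
  comp f g := ⟨g.lin ∘ₗ f.lin,
    fun a v => by simp [f.comp_lin, g.comp_lin],
    fun a v => by simp [f.left_lin, g.left_lin],
    fun a v => by simp [f.right_lin, g.right_lin]⟩

@[ext]
theorem hom_ext {M N : Bim H} {f g : M ⟶ N} (h : ∀ v, f.lin v = g.lin v) : f = g :=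
  Hom.ext (LinearMap.ext h)

@[simp] theorem id_lin (M : Bim H) : Hom.lin (𝟙 M) = LinearMap.id := rfl

@[simp] theorem comp_lin' {M N P : Bim H} (f : M ⟶ N) (g : N ⟶ P) :
    (f ≫ g).lin = g.lin ∘ₗ f.lin := rfl

/-- A bijective morphism, presented by mutually inverse linear maps, is an isomorphism. -/
def isoOf {M N : Bim H} (f : M ⟶ N) (g : N →ₗ[ℂ] M) (hfg : ∀ v, g (f.lin v) = v)
    (hgf : ∀ v, f.lin (g v) = v) : M ≅ N where
  hom := f
  inv := ⟨g,
    fun a v => by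
      conv_lhs => rw [← hgf v]
      rw [← f.comp_lin, hfg],
    fun a v => by
      conv_lhs => rw [← hgf v]
      rw [← f.left_lin, hfg],
    fun a v => by
      conv_lhs => rw [← hgf v]
      rw [← f.right_lin, hfg]⟩
  hom_inv_id := hom_ext hfg
  inv_hom_id := hom_ext hgf

/-! #### The tensor product over `ℂH` -/

/-- The relations `m k ⊗ n = m ⊗ k n`. -/
def bal (M N : Bim H) : Submodule ℂ (M ⊗[ℂ] N) :=
  Submodule.span ℂ (Set.range fun p : M × H × N =>
    (M.right (MulOpposite.op p.2.1) p.1) ⊗ₜ[ℂ] p.2.2 - p.1 ⊗ₜ[ℂ] (N.left p.2.1 p.2.2))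

/-- The underlying space of `M ⊗_{ℂH} N`. -/
def Ten (M N : Bim H) : Type := (M ⊗[ℂ] N) ⧸ bal M N

instance (M N : Bim H) : AddCommGroup (Ten M N) :=
  inferInstanceAs (AddCommGroup ((M ⊗[ℂ] N) ⧸ bal M N))
instance (M N : Bim H) : Module ℂ (Ten M N) :=
  inferInstanceAs (Module ℂ ((M ⊗[ℂ] N) ⧸ bal M N))
instance (M N : Bim H) : FiniteDimensional ℂ (Ten M N) :=
  inferInstanceAs (FiniteDimensional ℂ ((M ⊗[ℂ] N) ⧸ bal M N))

/-- The class of `m ⊗ n` in `M ⊗_{ℂH} N`. -/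
def tmk (M N : Bim H) : M →ₗ[ℂ] N →ₗ[ℂ] Ten M N :=
  (TensorProduct.mk ℂ M N).compr₂ (bal M N).mkQ

theorem tmk_bal {M N : Bim H} (k : H) (m : M) (n : N) :
    tmk M N (M.right (MulOpposite.op k) m) n = tmk M N m (N.left k n) :=
  (Submodule.Quotient.eq _).2 (Submodule.subset_span ⟨(m, k, n), rfl⟩)

/-- Balanced bilinear maps factor through `M ⊗_{ℂH} N`. -/
def tlift {M N : Bim H} {P : Type} [AddCommGroup P] [Module ℂ P] (f : M →ₗ[ℂ] N →ₗ[ℂ] P)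
    (hf : ∀ (k : H) m n, f (M.right (MulOpposite.op k) m) n = f m (N.left k n)) :
    Ten M N →ₗ[ℂ] P :=
  (bal M N).liftQ (TensorProduct.lift f) (by
    rw [bal, Submodule.span_le]
    rintro _ ⟨⟨m, k, n⟩, rfl⟩
    simp [hf])

@[simp] theorem tlift_tmk {M N : Bim H} {P : Type} [AddCommGroup P] [Module ℂ P]
    (f : M →ₗ[ℂ] N →ₗ[ℂ] P)
    (hf : ∀ (k : H) m n, f (M.right (MulOpposite.op k) m) n = f m (N.left k n)) (m : M) (n : N) :
    tlift f hf (tmk M N m n) = f m n := rfl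

theorem ten_ext {M N : Bim H} {P : Type} [AddCommGroup P] [Module ℂ P]
    {f g : Ten M N →ₗ[ℂ] P} (h : ∀ m n, f (tmk M N m n) = g (tmk M N m n)) : f = g :=
  Submodule.linearMap_qext _ (TensorProduct.ext' h)

theorem ten_ext' {M N : Bim H} {P : Type} [AddCommGroup P] [Module ℂ P]
    {f g : Ten M N →ₗ[ℂ] P} (h : ∀ m n, f (tmk M N m n) = g (tmk M N m n)) (v : Ten M N) :
    f v = g v := by rw [ten_ext h]

/-- The map `m ⊗ n ↦ f m ⊗ g n` on tensor products over `ℂH`. -/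
def tmap {M N M' N' : Bim H} (f : M →ₗ[ℂ] M') (g : N →ₗ[ℂ] N')
    (h : ∀ (k : H) m n, tmk M' N' (f (M.right (MulOpposite.op k) m)) (g n) =
      tmk M' N' (f m) (g (N.left k n))) : Ten M N →ₗ[ℂ] Ten M' N' :=
  tlift ((tmk M' N').compl₁₂ f g) (by simpa using h)

@[simp] theorem tmap_tmk {M N M' N' : Bim H} (f : M →ₗ[ℂ] M') (g : N →ₗ[ℂ] N')
    (h : ∀ (k : H) m n, tmk M' N' (f (M.right (MulOpposite.op k) m)) (g n) =
      tmk M' N' (f m) (g (N.left k n))) (m : M) (n : N) :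
    tmap f g h (tmk M N m n) = tmk M' N' (f m) (g n) := rfl

/-- The projection onto the component of degree `g`: `m ⊗ n ↦ ∑ₐ mₐ ⊗ n_{a⁻¹g}`. -/
def tcomp (M N : Bim H) (g : G) : Ten M N →ₗ[ℂ] Ten M N :=
  tlift (∑ a : G, (tmk M N).compl₁₂ (M.comp a) (N.comp (a⁻¹ * g))) (by
    intro k m n
    simp only [LinearMap.sum_apply, LinearMap.compl₁₂_apply]
    refine Fintype.sum_equiv (Equiv.mulRight (k : G)⁻¹) _ _ fun a => ?_
    simp only [Equiv.coe_mulRight]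
    rw [comp_right, comp_left, tmk_bal]
    congr 3
    group)

@[simp] theorem tcomp_tmk (M N : Bim H) (g : G) (m : M) (n : N) :
    tcomp M N g (tmk M N m n) = ∑ a : G, tmk M N (M.comp a m) (N.comp (a⁻¹ * g) n) := by
  simp [tcomp]

theorem comp_comp (M : Bim H) (g k : G) (v : M) [Decidable (g = k)] :
    M.comp g (M.comp k v) = if g = k then M.comp k v else 0 := by
  split_ifs with h
  · subst h; exact M.comp_self _ _
  · exact M.comp_ne _ _ h _

theorem tcomp_tcomp (M N : Bim H) (g k : G) (v : Ten M N) [Decidable (g = k)] :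
    tcomp M N g (tcomp M N k v) = if g = k then tcomp M N k v else 0 := by
  classical
  have : ∀ m n, tcomp M N g (tcomp M N k (tmk M N m n)) =
      if g = k then tcomp M N k (tmk M N m n) else 0 := by
    intro m n
    simp only [tcomp_tmk, map_sum, comp_comp]
    split_ifs with h
    · subst h
      refine Finset.sum_congr rfl fun a _ => ?_
      rw [Finset.sum_eq_single a]
      · simp
      · intro b _ hb; simp [hb]
      · simp
    · refine Finset.sum_eq_zero fun a _ => Finset.sum_eq_zero fun b _ => ?_
      by_cases hb : b = a
      · subst hb; simp [h]
      · simp [hb]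
  split_ifs with h
  · exact ten_ext' (f := tcomp M N g ∘ₗ tcomp M N k) (g := tcomp M N k)
      (fun m n => by simpa [h] using this m n) v
  · exact ten_ext' (f := tcomp M N g ∘ₗ tcomp M N k) (g := 0)
      (fun m n => by simpa [h] using this m n) v

/-- The left action `h (m ⊗ n) = h m ⊗ n`. -/
def tleft (M N : Bim H) : Representation ℂ H (Ten M N) where
  toFun := fun h => tmap (M.left h) LinearMap.id (fun k m n => by
    rw [M.left_right]; exact tmk_bal _ _ _)
  map_one' := ten_ext fun m n => by simp
  map_mul' := fun h k => ten_ext fun m n => by simp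

/-- The right action `(m ⊗ n) k = m ⊗ n k`. -/
def tright (M N : Bim H) : Representation ℂ (H)ᵐᵒᵖ (Ten M N) where
  toFun := fun k => tmap LinearMap.id (N.right k) (fun h m n => by
    rw [← N.left_right]; exact tmk_bal _ _ _)
  map_one' := ten_ext fun m n => by simp
  map_mul' := fun h k => ten_ext fun m n => by simp

@[simp] theorem tleft_tmk (M N : Bim H) (h : H) (m : M) (n : N) :
    tleft M N h (tmk M N m n) = tmk M N (M.left h m) n := rfl

@[simp] theorem tright_tmk (M N : Bim H) (k : (H)ᵐᵒᵖ) (m : M) (n : N) :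
    tright M N k (tmk M N m n) = tmk M N m (N.right k n) := rfl

/-- The bimodule `M ⊗_{ℂH} N`. -/
def tensor (M N : Bim H) : Bim H where
  carrier := Ten M N
  comp := tcomp M N
  comp_self g v := by classical simp [tcomp_tcomp]
  comp_ne g k h v := by classical simp [tcomp_tcomp, h]
  sum_comp v := by
    have := ten_ext' (f := ∑ g, tcomp M N g) (g := LinearMap.id) (fun m n => by
      simp only [LinearMap.sum_apply, tcomp_tmk, LinearMap.id_apply]
      rw [Finset.sum_comm]
      conv_rhs => rw [← M.sum_comp m]
      simp only [map_sum, LinearMap.sum_apply]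
      refine Finset.sum_congr rfl fun a _ => ?_
      rw [← map_sum]
      congr 1
      conv_rhs => rw [← N.sum_comp n]
      exact Fintype.sum_equiv (Equiv.mulLeft a⁻¹) _ _ fun _ => rfl) v
    simpa using this
  left := tleft M N
  right := tright M N
  left_right h k v := ten_ext' (f := tleft M N h ∘ₗ tright M N k)
    (g := tright M N k ∘ₗ tleft M N h) (fun m n => rfl) v
  comp_act h k g v := ten_ext'
    (f := tcomp M N (h * g * k) ∘ₗ tleft M N h ∘ₗ tright M N (MulOpposite.op k))
    (g := tleft M N h ∘ₗ tright M N (MulOpposite.op k) ∘ₗ tcomp M N g) (fun m n => by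
      simp only [LinearMap.comp_apply, tleft_tmk, tright_tmk, tcomp_tmk, map_sum]
      refine Fintype.sum_equiv (Equiv.mulLeft (h : G)⁻¹) _ _ fun a => ?_
      simp only [Equiv.coe_mulLeft]
      rw [comp_left, comp_right]
      congr 3
      group) v

/-- The class of `m ⊗ n`, as an element of the bimodule `M ⊗_{ℂH} N`. -/
def tm (M N : Bim H) : M →ₗ[ℂ] N →ₗ[ℂ] tensor M N := tmk M N

theorem tm_bal {M N : Bim H} (k : H) (m : M) (n : N) :
    tm M N (M.right (MulOpposite.op k) m) n = tm M N m (N.left k n) := tmk_bal k m n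

@[simp] theorem tensor_left_tm (M N : Bim H) (h : H) (m : M) (n : N) :
    (tensor M N).left h (tm M N m n) = tm M N (M.left h m) n := rfl

@[simp] theorem tensor_right_tm (M N : Bim H) (k : (H)ᵐᵒᵖ) (m : M) (n : N) :
    (tensor M N).right k (tm M N m n) = tm M N m (N.right k n) := rfl

@[simp] theorem tensor_comp_tm (M N : Bim H) (g : G) (m : M) (n : N) :
    (tensor M N).comp g (tm M N m n) = ∑ a : G, tm M N (M.comp a m) (N.comp (a⁻¹ * g) n) :=
  tcomp_tmk M N g m n

theorem tensor_ext {M N : Bim H} {P : Type} [AddCommGroup P] [Module ℂ P]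
    {f g : tensor M N →ₗ[ℂ] P} (h : ∀ m n, f (tm M N m n) = g (tm M N m n)) : f = g :=
  ten_ext h

/-- To check that morphisms out of `M ⊗_{ℂH} N` agree it suffices to look at `m ⊗ n`. -/
theorem tensor_hom_ext {M N P : Bim H} {f g : tensor M N ⟶ P}
    (h : ∀ m n, f.lin (tm M N m n) = g.lin (tm M N m n)) : f = g :=
  Hom.ext (tensor_ext h)

/-- Balanced bilinear maps factor through the bimodule `M ⊗_{ℂH} N`. -/
def tl {M N : Bim H} {P : Type} [AddCommGroup P] [Module ℂ P] (f : M →ₗ[ℂ] N →ₗ[ℂ] P)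
    (hf : ∀ (k : H) m n, f (M.right (MulOpposite.op k) m) n = f m (N.left k n)) :
    tensor M N →ₗ[ℂ] P := tlift f hf

@[simp] theorem tl_tm {M N : Bim H} {P : Type} [AddCommGroup P] [Module ℂ P]
    (f : M →ₗ[ℂ] N →ₗ[ℂ] P)
    (hf : ∀ (k : H) m n, f (M.right (MulOpposite.op k) m) n = f m (N.left k n)) (m : M) (n : N) :
    tl f hf (tm M N m n) = f m n := rfl

/-- A balanced bilinear map compatible with gradings and outer actions gives a morphism. -/
def homOf {M N P : Bim H} (f : M →ₗ[ℂ] N →ₗ[ℂ] P)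
    (hf : ∀ (k : H) m n, f (M.right (MulOpposite.op k) m) n = f m (N.left k n))
    (hc : ∀ g m n, ∑ a : G, f (M.comp a m) (N.comp (a⁻¹ * g) n) = P.comp g (f m n))
    (hl : ∀ h m n, f (M.left h m) n = P.left h (f m n))
    (hr : ∀ k m n, f m (N.right k n) = P.right k (f m n)) : tensor M N ⟶ P where
  lin := tl f hf
  comp_lin a v := LinearMap.congr_fun (tensor_ext
    (f := (tl f hf).comp ((tensor M N).comp a))
    (g := (P.comp a).comp (tl f hf)) (fun m n => by simpa using hc a m n)) v
  left_lin h v := LinearMap.congr_fun (tensor_ext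
    (f := (tl f hf).comp ((tensor M N).left h))
    (g := (P.left h).comp (tl f hf)) (hl h)) v
  right_lin h v := LinearMap.congr_fun (tensor_ext
    (f := (tl f hf).comp ((tensor M N).right h))
    (g := (P.right h).comp (tl f hf)) (hr h)) v

@[simp] theorem homOf_tm {M N P : Bim H} (f : M →ₗ[ℂ] N →ₗ[ℂ] P)
    (hf : ∀ (k : H) m n, f (M.right (MulOpposite.op k) m) n = f m (N.left k n))
    (hc : ∀ g m n, ∑ a : G, f (M.comp a m) (N.comp (a⁻¹ * g) n) = P.comp g (f m n))
    (hl : ∀ h m n, f (M.left h m) n = P.left h (f m n))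
    (hr : ∀ k m n, f m (N.right k n) = P.right k (f m n)) (m : M) (n : N) :
    (homOf f hf hc hl hr).lin (tm M N m n) = f m n := rfl

/-- The morphism `f ⊗ g`. -/
def tensorMap {M N M' N' : Bim H} (f : M ⟶ M') (g : N ⟶ N') : tensor M N ⟶ tensor M' N' :=
  homOf ((tm M' N').compl₁₂ f.lin g.lin)
    (fun k m n => by simp [f.right_lin, g.left_lin, tm_bal])
    (fun a m n => by simp [f.comp_lin, g.comp_lin])
    (fun h m n => by simp [f.left_lin])
    (fun h m n => by simp [g.right_lin])

@[simp] theorem tensorMap_tm {M N M' N' : Bim H} (f : M ⟶ M') (g : N ⟶ N') (m : M) (n : N) :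
    (tensorMap f g).lin (tm M N m n) = tm M' N' (f.lin m) (g.lin n) := rfl

open Classical in
/-- The unit object `ℂH`, realised as functions on `H`; the basis element `k ∈ H` is `δ_k`, and
it has degree `k`. -/
def unit (H : Subgroup G) : Bim H where
  carrier := H → ℂ
  comp g := LinearMap.pi fun k => if (k : G) = g then LinearMap.proj k else 0
  comp_self g v := by ext k; by_cases h : (k : G) = g <;> simp [h]
  comp_ne g g' hg v := by
    ext k
    by_cases h : (k : G) = g
    · simp [h, hg]
    · simp [h]
  sum_comp v := by
    ext k
    simp only [Finset.sum_apply, LinearMap.pi_apply]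
    rw [Finset.sum_eq_single (k : G)]
    · simp
    · intro b _ hb; simp [Ne.symm hb]
    · simp
  left :=
    { toFun := fun a => LinearMap.pi fun k => LinearMap.proj (a⁻¹ * k)
      map_one' := by ext; simp
      map_mul' := fun a b => by ext; simp [mul_assoc] }
  right :=
    { toFun := fun b => LinearMap.pi fun k => LinearMap.proj (k * b.unop⁻¹)
      map_one' := by ext; simp
      map_mul' := fun a b => by ext; simp [mul_assoc] }
  left_right h k v := by ext; simp [mul_assoc]
  comp_act h k g v := by
    ext a
    have : ((a : G) = h * g * k) ↔ ((h⁻¹ * (a * k⁻¹) : H) : G) = g := by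
      push_cast
      constructor
      · intro e; rw [e]; group
      · intro e; rw [← e]; group
    by_cases hh : (a : G) = h * g * k
    · simp [hh, ← mul_assoc]
    · have h2 := mt this.2 hh
      simp only [Subgroup.coe_mul, InvMemClass.coe_inv, ← mul_assoc] at h2
      simp [hh, ← mul_assoc, h2]

/-- The basis element `δ_k` of the unit object. -/
def unitBasis (k : H) : unit H := fun j => by classical exact if j = k then (1 : ℂ) else 0

/-- Two linear maps out of a triple tensor product agree if they agree on `(m ⊗ n) ⊗ p`. -/
theorem tensor_ext₃ {M N P : Bim H} {Q : Type} [AddCommGroup Q] [Module ℂ Q]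
    {f g : tensor (tensor M N) P →ₗ[ℂ] Q}
    (h : ∀ m n p, f (tm _ P (tm M N m n) p) = g (tm _ P (tm M N m n) p)) : f = g :=
  tensor_ext fun v p => LinearMap.congr_fun (tensor_ext
    (f := f.comp ((tm (tensor M N) P).flip p)) (g := g.comp ((tm (tensor M N) P).flip p))
    (fun m n => h m n p)) v

/-- Two linear maps out of a triple tensor product agree if they agree on `m ⊗ (n ⊗ p)`. -/
theorem tensor_ext₃' {M N P : Bim H} {Q : Type} [AddCommGroup Q] [Module ℂ Q]
    {f g : tensor M (tensor N P) →ₗ[ℂ] Q}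
    (h : ∀ m n p, f (tm M _ m (tm N P n p)) = g (tm M _ m (tm N P n p))) : f = g :=
  tensor_ext fun m v => LinearMap.congr_fun (tensor_ext
    (f := f.comp (tm M (tensor N P) m)) (g := g.comp (tm M (tensor N P) m))
    (fun n p => h m n p)) v

theorem tensor_hom_ext₃ {M N P Q : Bim H} {f g : tensor (tensor M N) P ⟶ Q}
    (h : ∀ m n p, f.lin (tm _ P (tm M N m n) p) = g.lin (tm _ P (tm M N m n) p)) : f = g :=
  Hom.ext (tensor_ext₃ h)

theorem tensor_hom_ext₄ {M N P Q R : Bim H} {f g : tensor (tensor (tensor M N) P) Q ⟶ R}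
    (h : ∀ m n p q, f.lin (tm _ Q (tm _ P (tm M N m n) p) q) =
      g.lin (tm _ Q (tm _ P (tm M N m n) p) q)) : f = g :=
  Hom.ext (tensor_ext fun v q => LinearMap.congr_fun (tensor_ext₃
    (f := f.lin.comp ((tm (tensor (tensor M N) P) Q).flip q))
    (g := g.lin.comp ((tm (tensor (tensor M N) P) Q).flip q))
    (fun m n p => h m n p q)) v)

/-- The bilinear map underlying `(m ⊗ n) ⊗ p ↦ m ⊗ (n ⊗ p)`. -/
def assocLin (M N P : Bim H) : tensor M N →ₗ[ℂ] P →ₗ[ℂ] tensor M (tensor N P) :=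
  tl { toFun := fun m => (tm N P).compr₂ (tm M (tensor N P) m)
       map_add' := fun _ _ => by ext; simp
       map_smul' := fun _ _ => by ext; simp }
    (fun k m n => by ext p; simp [tm_bal])

@[simp] theorem assocLin_tm (M N P : Bim H) (m : M) (n : N) (p : P) :
    assocLin M N P (tm M N m n) p = tm M _ m (tm N P n p) := rfl

/-- The bilinear map underlying `m ⊗ (n ⊗ p) ↦ (m ⊗ n) ⊗ p`. -/
def assocInvLin (M N P : Bim H) : M →ₗ[ℂ] tensor N P →ₗ[ℂ] tensor (tensor M N) P where
  toFun m := tl ((tm (tensor M N) P).comp (tm M N m)) (fun k n p => by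
    simp [← tm_bal])
  map_add' _ _ := tensor_ext fun _ _ => by simp
  map_smul' _ _ := tensor_ext fun _ _ => by simp

@[simp] theorem assocInvLin_tm (M N P : Bim H) (m : M) (n : N) (p : P) :
    assocInvLin M N P m (tm N P n p) = tm _ P (tm M N m n) p := rfl

/-- The associativity morphism `(m ⊗ n) ⊗ p ↦ m ⊗ (n ⊗ p)`. -/
def assocHom (M N P : Bim H) : tensor (tensor M N) P ⟶ tensor M (tensor N P) :=
  homOf (assocLin M N P)
    (fun k v p => LinearMap.congr_fun (tensor_ext
      (f := ((assocLin M N P).flip p).comp ((tensor M N).right (MulOpposite.op k)))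
      (g := ((assocLin M N P).flip (P.left k p))) (fun m n => by simp [tm_bal])) v)
    (fun g v p => by
      have := LinearMap.congr_fun (tensor_ext
        (f := ∑ a : G, ((assocLin M N P).flip (P.comp (a⁻¹ * g) p)).comp ((tensor M N).comp a))
        (g := ((tensor M (tensor N P)).comp g).comp ((assocLin M N P).flip p))
        (fun m n => by
          simp only [LinearMap.sum_apply, LinearMap.comp_apply, LinearMap.flip_apply,
            tensor_comp_tm, map_sum, assocLin_tm]
          rw [Finset.sum_comm]
          refine Finset.sum_congr rfl fun a _ => ?_
          refine Fintype.sum_equiv (Equiv.mulLeft a⁻¹) _ _ fun b => ?_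
          simp only [Equiv.coe_mulLeft]
          congr 4
          group)) v
      simpa using this)
    (fun h v p => LinearMap.congr_fun (tensor_ext
      (f := ((assocLin M N P).flip p).comp ((tensor M N).left h))
      (g := ((tensor M (tensor N P)).left h).comp ((assocLin M N P).flip p))
      (fun m n => by simp)) v)
    (fun h v p => LinearMap.congr_fun (tensor_ext
      (f := (assocLin M N P).flip (P.right h p))
      (g := ((tensor M (tensor N P)).right h).comp ((assocLin M N P).flip p))
      (fun m n => by simp)) v)

@[simp] theorem assocHom_tm (M N P : Bim H) (m : M) (n : N) (p : P) :
    (assocHom M N P).lin (tm _ P (tm M N m n) p) = tm M _ m (tm N P n p) := rfl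

/-- The inverse associativity map. -/
def assocInv (M N P : Bim H) : tensor M (tensor N P) →ₗ[ℂ] tensor (tensor M N) P :=
  tl (assocInvLin M N P) (fun k m v => LinearMap.congr_fun (tensor_ext
    (f := assocInvLin M N P (M.right (MulOpposite.op k) m))
    (g := (assocInvLin M N P m).comp ((tensor N P).left k)) (fun n p => by simp [tm_bal])) v)

@[simp] theorem assocInv_tm (M N P : Bim H) (m : M) (n : N) (p : P) :
    assocInv M N P (tm M _ m (tm N P n p)) = tm _ P (tm M N m n) p := rfl

/-- The associativity isomorphism. -/
def assocIso (M N P : Bim H) : tensor (tensor M N) P ≅ tensor M (tensor N P) :=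
  isoOf (assocHom M N P) (assocInv M N P)
    (LinearMap.congr_fun (tensor_ext₃ (f := (assocInv M N P).comp (assocHom M N P).lin)
      (g := LinearMap.id) fun _ _ _ => rfl))
    (LinearMap.congr_fun (tensor_ext₃' (f := (assocHom M N P).lin.comp (assocInv M N P))
      (g := LinearMap.id) fun _ _ _ => rfl))

@[simp] theorem assocIso_hom_tm (M N P : Bim H) (m : M) (n : N) (p : P) :
    (assocIso M N P).hom.lin (tm _ P (tm M N m n) p) = tm M _ m (tm N P n p) := rfl

@[simp] theorem assocIso_inv_tm (M N P : Bim H) (m : M) (n : N) (p : P) :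
    (assocIso M N P).inv.lin (tm M _ m (tm N P n p)) = tm _ P (tm M N m n) p := rfl

/-- The bilinear map `f ⊗ m ↦ ∑ₖ f(k) T(k)(m)`. -/
def evalLin {V : Type} [AddCommGroup V] [Module ℂ V] (T : H → V →ₗ[ℂ] V) :
    unit H →ₗ[ℂ] V →ₗ[ℂ] V :=
  letI : Fintype H := Fintype.ofFinite H
  LinearMap.mk₂ ℂ (fun (f : H → ℂ) m => ∑ k : H, f k • T k m)
    (fun f f' m => by
      rw [← Finset.sum_add_distrib]
      exact Finset.sum_congr rfl fun k _ => add_smul (f k) (f' k) (T k m))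
    (fun c f m => by
      rw [Finset.smul_sum]
      exact Finset.sum_congr rfl fun k _ => mul_smul c (f k) (T k m))
    (fun f m m' => by simp [Finset.sum_add_distrib])
    (fun c f m => by simp [Finset.smul_sum, smul_comm c])

@[simp] theorem evalLin_basis {V : Type} [AddCommGroup V] [Module ℂ V] (T : H → V →ₗ[ℂ] V)
    (k : H) (m : V) : evalLin T (unitBasis k) m = T k m := by
  classical
  let _ : Fintype H := Fintype.ofFinite H
  change ∑ d : H, unitBasis k d • T d m = _
  rw [Finset.sum_eq_single k]
  · simp [unitBasis]
  · intro d _ hd; simp [unitBasis, hd]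
  · simp

/-- The left action `f ⊗ m ↦ ∑ₖ f(k) (k m)` of `ℂH` on a bimodule. -/
def leftUnitLin (M : Bim H) : unit H →ₗ[ℂ] M →ₗ[ℂ] M := evalLin M.left

/-- The right action `m ⊗ f ↦ ∑ₖ f(k) (m k)` of `ℂH` on a bimodule. -/
def rightUnitLin (M : Bim H) : M →ₗ[ℂ] unit H →ₗ[ℂ] M :=
  (evalLin fun k => M.right (MulOpposite.op k)).flip

theorem unit_ext {P : Type} [AddCommGroup P] [Module ℂ P] {f g : unit H →ₗ[ℂ] P}
    (h : ∀ k, f (unitBasis k) = g (unitBasis k)) : f = g := by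
  classical
  refine LinearMap.pi_ext' (R := ℂ) (φ := fun _ : H => ℂ) fun k => LinearMap.ext_ring ?_
  have e : (unitBasis k : unit H) = Pi.single k (1 : ℂ) := by
    funext j; simp [unitBasis, Pi.single_apply]
  have := h k
  rw [e] at this
  exact this

@[simp] theorem unit_left_basis (a k : H) :
    (unit H).left a (unitBasis k) = unitBasis (a * k) := by
  funext j
  change unitBasis k (a⁻¹ * j) = unitBasis (a * k) j
  classical
  exact if_congr inv_mul_eq_iff_eq_mul rfl rfl

@[simp] theorem unit_right_basis (a : (H)ᵐᵒᵖ) (k : H) :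
    (unit H).right a (unitBasis k) = unitBasis (k * a.unop) := by
  funext j
  change unitBasis k (j * a.unop⁻¹) = unitBasis (k * a.unop) j
  classical
  exact if_congr mul_inv_eq_iff_eq_mul rfl rfl

theorem unit_comp_basis (g : G) (k : H) [Decidable ((k : G) = g)] :
    (unit H).comp g (unitBasis k) = if (k : G) = g then unitBasis k else 0 := by
  funext j
  change (@ite _ ((j : G) = g) (Classical.propDecidable _) (LinearMap.proj j) 0 :
    (H → ℂ) →ₗ[ℂ] ℂ) (fun i => unitBasis k i) = _
  by_cases h : j = k
  · subst h
    by_cases h' : (j : G) = g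
    · rw [if_pos h', if_pos h']; rfl
    · rw [if_neg h', if_neg h']; rfl
  · have h0 : ((if (k : G) = g then unitBasis k else 0 : unit H) : H → ℂ) j = 0 := by
      split_ifs
      · simp [unitBasis, h]
      · rfl
    refine Eq.trans ?_ h0.symm
    split_ifs
    · simp [unitBasis, h]
    · rfl

@[simp] theorem leftUnitLin_basis (M : Bim H) (k : H) (m : M) :
    leftUnitLin M (unitBasis k) m = M.left k m := evalLin_basis _ k m

@[simp] theorem rightUnitLin_basis (M : Bim H) (k : H) (m : M) :
    rightUnitLin M m (unitBasis k) = M.right (MulOpposite.op k) m := evalLin_basis _ k m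

/-- The left unit morphism `a ⊗ m ↦ a m`. -/
def leftUnitHom (M : Bim H) : tensor (unit H) M ⟶ M :=
  homOf (leftUnitLin M)
    (fun k f m => LinearMap.congr_fun (unit_ext
      (f := ((leftUnitLin M).flip m).comp ((unit H).right (MulOpposite.op k)))
      (g := (leftUnitLin M).flip (M.left k m)) fun j => by simp) f)
    (fun g f m => by
      classical
      have := LinearMap.congr_fun (unit_ext
        (f := ∑ a : G, ((leftUnitLin M).flip (M.comp (a⁻¹ * g) m)).comp ((unit H).comp a))
        (g := (M.comp g).comp ((leftUnitLin M).flip m)) fun j => by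
          simp only [LinearMap.sum_apply, LinearMap.comp_apply, LinearMap.flip_apply,
            unit_comp_basis, leftUnitLin_basis]
          rw [Finset.sum_eq_single (j : G)]
          · simp [comp_left]
          · intro b _ hb; simp [Ne.symm hb]
          · simp) f
      simpa using this)
    (fun h f m => LinearMap.congr_fun (unit_ext
      (f := ((leftUnitLin M).flip m).comp ((unit H).left h))
      (g := (M.left h).comp ((leftUnitLin M).flip m)) fun j => by simp) f)
    (fun h f m => LinearMap.congr_fun (unit_ext
      (f := ((leftUnitLin M).flip (M.right h m)))
      (g := (M.right h).comp ((leftUnitLin M).flip m)) fun j => by simp [M.left_right]) f)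

/-- The right unit morphism `m ⊗ a ↦ m a`. -/
def rightUnitHom (M : Bim H) : tensor M (unit H) ⟶ M :=
  homOf (rightUnitLin M)
    (fun k m f => LinearMap.congr_fun (unit_ext
      (f := rightUnitLin M (M.right (MulOpposite.op k) m))
      (g := (rightUnitLin M m).comp ((unit H).left k)) fun j => by simp) f)
    (fun g m f => by
      classical
      have := LinearMap.congr_fun (unit_ext
        (f := ∑ a : G, (rightUnitLin M (M.comp a m)).comp ((unit H).comp (a⁻¹ * g)))
        (g := (M.comp g).comp (rightUnitLin M m)) fun j => by
          simp only [LinearMap.sum_apply, LinearMap.comp_apply, unit_comp_basis]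
          rw [Finset.sum_eq_single (g * (j : G)⁻¹)]
          · simp [comp_right]
          · intro b _ hb
            rw [if_neg]
            · simp
            · rintro h
              exact hb (by rw [h]; group)
          · simp) f
      simpa using this)
    (fun h m f => LinearMap.congr_fun (unit_ext
      (f := rightUnitLin M (M.left h m))
      (g := (M.left h).comp (rightUnitLin M m)) fun j => by simp [M.left_right]) f)
    (fun h m f => LinearMap.congr_fun (unit_ext
      (f := (rightUnitLin M m).comp ((unit H).right h))
      (g := (M.right h).comp (rightUnitLin M m)) fun j => by simp) f)

@[simp] theorem leftUnitHom_tm (M : Bim H) (k : H) (m : M) :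
    (leftUnitHom M).lin (tm _ M (unitBasis k) m) = M.left k m := leftUnitLin_basis M k m

@[simp] theorem rightUnitHom_tm (M : Bim H) (k : H) (m : M) :
    (rightUnitHom M).lin (tm M _ m (unitBasis k)) = M.right (MulOpposite.op k) m :=
  rightUnitLin_basis M k m

theorem tensor_unit_ext {M : Bim H} {P : Type} [AddCommGroup P] [Module ℂ P]
    {f g : tensor (unit H) M →ₗ[ℂ] P}
    (h : ∀ k m, f (tm _ M (unitBasis k) m) = g (tm _ M (unitBasis k) m)) : f = g :=
  tensor_ext fun v m => LinearMap.congr_fun (unit_ext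
    (f := f.comp ((tm (unit H) M).flip m)) (g := g.comp ((tm (unit H) M).flip m))
    (fun k => h k m)) v

theorem tensor_unit_ext' {M : Bim H} {P : Type} [AddCommGroup P] [Module ℂ P]
    {f g : tensor M (unit H) →ₗ[ℂ] P}
    (h : ∀ k m, f (tm M _ m (unitBasis k)) = g (tm M _ m (unitBasis k))) : f = g :=
  tensor_ext fun m v => LinearMap.congr_fun (unit_ext
    (f := f.comp (tm M (unit H) m)) (g := g.comp (tm M (unit H) m))
    (fun k => h k m)) v

/-- The left unit isomorphism `ℂH ⊗ M ≅ M`. -/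
def leftUnitIso (M : Bim H) : tensor (unit H) M ≅ M :=
  isoOf (leftUnitHom M) (tm (unit H) M (unitBasis 1))
    (LinearMap.congr_fun (tensor_unit_ext
      (f := (tm (unit H) M (unitBasis 1)).comp (leftUnitHom M).lin) (g := LinearMap.id)
      fun k m => by simp [← tm_bal]))
    (fun v => by simp)

/-- The right unit isomorphism `M ⊗ ℂH ≅ M`. -/
def rightUnitIso (M : Bim H) : tensor M (unit H) ≅ M :=
  isoOf (rightUnitHom M) ((tm M (unit H)).flip (unitBasis 1))
    (LinearMap.congr_fun (tensor_unit_ext'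
      (f := ((tm M (unit H)).flip (unitBasis 1)).comp (rightUnitHom M).lin) (g := LinearMap.id)
      fun k m => by simp [tm_bal]))
    (fun v => by simp)

@[simp] theorem leftUnitIso_hom_tm (M : Bim H) (k : H) (m : M) :
    (leftUnitIso M).hom.lin (tm _ M (unitBasis k) m) = M.left k m := leftUnitLin_basis M k m

@[simp] theorem rightUnitIso_hom_tm (M : Bim H) (k : H) (m : M) :
    (rightUnitIso M).hom.lin (tm M _ m (unitBasis k)) = M.right (MulOpposite.op k) m :=
  rightUnitLin_basis M k m

/-- The monoidal category of graded `ℂH`-bimodules, with tensor product `⊗_{ℂH}`. -/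
instance : MonoidalCategory (Bim H) where
  tensorObj := tensor
  whiskerLeft M _ _ f := tensorMap (𝟙 M) f
  whiskerRight f N := tensorMap f (𝟙 N)
  tensorHom := tensorMap
  tensorUnit := unit H
  associator := assocIso
  leftUnitor := leftUnitIso
  rightUnitor := rightUnitIso
  tensorHom_def _ _ := tensor_hom_ext fun _ _ => rfl
  id_tensorHom_id _ _ := tensor_hom_ext fun _ _ => rfl
  tensorHom_comp_tensorHom _ _ _ _ := tensor_hom_ext fun _ _ => rfl
  whiskerLeft_id _ _ := tensor_hom_ext fun _ _ => rfl
  id_whiskerRight _ _ := tensor_hom_ext fun _ _ => rfl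
  associator_naturality _ _ _ := tensor_hom_ext₃ fun _ _ _ => rfl
  leftUnitor_naturality f := Hom.ext (tensor_unit_ext fun k m => by
    simp [f.left_lin])
  rightUnitor_naturality f := Hom.ext (tensor_unit_ext' fun k m => by
    simp [f.right_lin])
  pentagon _ _ _ _ := tensor_hom_ext₄ fun _ _ _ _ => rfl
  triangle M N := tensor_hom_ext fun v n => LinearMap.congr_fun (tensor_unit_ext'
    (f := ((assocHom M (unit H) N ≫ tensorMap (𝟙 M) (leftUnitIso N).hom).lin).comp
      ((tm (tensor M (unit H)) N).flip n))
    (g := ((tensorMap (rightUnitIso M).hom (𝟙 N)).lin).comp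
      ((tm (tensor M (unit H)) N).flip n)) fun k m => by simp [tm_bal]) v

end Bim

/-! ### The right center -/

section RightCenter

universe v u

variable {C : Type u} [Category.{v} C] [MonoidalCategory C]

/-- A half-braiding `c_X : X ⊗ V ≅ V ⊗ X`, natural in `X` and compatible with tensor products
of the argument `X`. -/
structure RightHalfBraiding (V : C) where
  c : ∀ X, X ⊗ V ≅ V ⊗ X
  naturality : ∀ {X Y} (f : X ⟶ Y), f ▷ V ≫ (c Y).hom = (c X).hom ≫ V ◁ f
  monoidal : ∀ X Y, (c (X ⊗ Y)).hom = (α_ X Y V).hom ≫ X ◁ (c Y).hom ≫ (α_ X V Y).inv ≫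
    (c X).hom ▷ Y ≫ (α_ V X Y).hom

variable (C) in
/-- The right center of a monoidal category. -/
structure RightCenter where
  obj : C
  half : RightHalfBraiding obj

/-- Morphisms in the right center: morphisms of `C` commuting with the half-braidings. -/
@[ext]
structure RightCenter.Hom (V W : RightCenter C) where
  f : V.obj ⟶ W.obj
  comm : ∀ X, X ◁ f ≫ (W.half.c X).hom = (V.half.c X).hom ≫ f ▷ X

instance : Category (RightCenter C) where
  Hom := RightCenter.Hom
  id V := ⟨𝟙 V.obj, fun X => by simp⟩
  comp a b := ⟨a.f ≫ b.f, fun X => by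
    rw [MonoidalCategory.whiskerLeft_comp, Category.assoc, b.comm, ← Category.assoc, a.comm,
      Category.assoc, comp_whiskerRight]⟩

variable (C) in
/-- The underlying functor from the right center to `C`. -/
def RightCenter.forget : RightCenter C ⥤ C where
  obj V := V.obj
  map a := a.f

end RightCenter

/-! ### Yetter-Drinfeld modules -/

variable (G) in
/-- Yetter-Drinfeld modules: `G`-graded vector spaces with a left `G`-action such that
`|x v| = x |v| x⁻¹`. -/
structure YD extends GrVect G where
  act : Representation ℂ G carrier
  comp_act : ∀ x g v, comp (x * g * x⁻¹) (act x v) = act x (comp g v)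

namespace YD

instance : CoeSort (YD G) Type := ⟨fun N => N.carrier⟩

theorem comp_act' (N : YD G) (x g : G) (v : N) :
    N.comp g (N.act x v) = N.act x (N.comp (x⁻¹ * g * x) v) := by
  rw [← N.comp_act]
  congr 2
  group

/-- Morphisms: linear maps preserving the grading and the action. -/
@[ext]
structure Hom (M N : YD G) where
  lin : M →ₗ[ℂ] N
  comp_lin : ∀ g v, lin (M.comp g v) = N.comp g (lin v)
  act_lin : ∀ x v, lin (M.act x v) = N.act x (lin v)

instance : Category (YD G) where
  Hom := Hom
  id M := ⟨LinearMap.id, fun _ _ => rfl, fun _ _ => rfl⟩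
  comp f g := ⟨g.lin ∘ₗ f.lin,
    fun a v => by simp [f.comp_lin, g.comp_lin],
    fun a v => by simp [f.act_lin, g.act_lin]⟩

@[ext]
theorem hom_ext {M N : YD G} {f g : M ⟶ N} (h : ∀ v, f.lin v = g.lin v) : f = g :=
  Hom.ext (LinearMap.ext h)

/-- The direct sum of a finite family of Yetter-Drinfeld modules. -/
def directSum {ι : Type} [Finite ι] (N : ι → YD G) : YD G where
  carrier := ∀ i, N i
  comp g := LinearMap.pi fun i => (N i).comp g ∘ₗ LinearMap.proj i
  comp_self g v := by ext i; simp [(N i).comp_self]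
  comp_ne g k h v := by ext i; simp [(N i).comp_ne g k h]
  sum_comp v := by ext i; simp [(N i).sum_comp]
  act :=
    { toFun := fun x => LinearMap.pi fun i => (N i).act x ∘ₗ LinearMap.proj i
      map_one' := by ext v i; simp
      map_mul' := fun x y => by ext v i; simp }
  comp_act x g v := by ext i; simp [(N i).comp_act]

end YD

/-- The direct sum of a finite family of graded bimodules. -/
def Bim.directSum {H : Subgroup G} {ι : Type} [Finite ι] (M : ι → Bim H) : Bim H where
  carrier := ∀ i, M i
  comp g := LinearMap.pi fun i => (M i).comp g ∘ₗ LinearMap.proj i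
  comp_self g v := by ext i; simp [(M i).comp_self]
  comp_ne g k h v := by ext i; simp [(M i).comp_ne g k h]
  sum_comp v := by ext i; simp [(M i).sum_comp]
  left :=
    { toFun := fun x => LinearMap.pi fun i => (M i).left x ∘ₗ LinearMap.proj i
      map_one' := by ext v i; simp
      map_mul' := fun x y => by ext v i; simp }
  right :=
    { toFun := fun x => LinearMap.pi fun i => (M i).right x ∘ₗ LinearMap.proj i
      map_one' := by ext v i; simp
      map_mul' := fun x y => by ext v i; simp }
  left_right h k v := by ext i; simp [(M i).left_right]
  comp_act h k g v := by ext i; simp [(M i).comp_act]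

/-! ### The functor `N ↦ N ⊗ ℂH` -/

/-- The space `N ⊗ ℂH`, realised as the space of functions `H → N`: the tensor `n ⊗ b` is the
function supported at `b` with value `n` there.  The structure is `a (n ⊗ b) = a n ⊗ a b`,
`(n ⊗ b) b' = n ⊗ b b'`, `|n ⊗ b| = |n| b`. -/
def underlieObj (H : Subgroup G) (N : YD G) : Bim H where
  carrier := H → N
  comp g := LinearMap.pi fun k => N.comp (g * (k : G)⁻¹) ∘ₗ LinearMap.proj k
  comp_self g v := by ext i; simp [N.comp_self]
  comp_ne g k h v := by ext i; simp [N.comp_ne (g * (i : G)⁻¹) (k * (i : G)⁻¹) (by simpa using h)]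
  sum_comp v := by
    ext i
    simp only [Finset.sum_apply, LinearMap.pi_apply, LinearMap.comp_apply, LinearMap.proj_apply]
    conv_rhs => rw [← N.sum_comp (v i)]
    exact Fintype.sum_equiv (Equiv.mulRight (i : G)⁻¹) _ _ fun _ => rfl
  left :=
    { toFun := fun a => LinearMap.pi fun k => N.act (a : G) ∘ₗ LinearMap.proj (a⁻¹ * k)
      map_one' := by ext; simp
      map_mul' := fun a b => by ext; simp [mul_assoc] }
  right :=
    { toFun := fun b => LinearMap.pi fun k => LinearMap.proj (k * b.unop⁻¹)
      map_one' := by ext; simp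
      map_mul' := fun a b => by ext; simp [mul_assoc] }
  left_right h k v := by ext; simp [mul_assoc]
  comp_act h k g v := by
    ext i
    simp only [LinearMap.pi_apply, LinearMap.comp_apply, LinearMap.proj_apply,
      MonoidHom.coe_mk, OneHom.coe_mk, N.comp_act']
    congr 2
    push_cast
    simp [mul_assoc]

/-- The element `n ⊗ b` of `N ⊗ ℂH`. -/
def underlieMk (H : Subgroup G) (N : YD G) (n : N) (b : H) : underlieObj H N :=
  fun k => by classical exact if k = b then n else 0

/-- The functor `N ↦ N ⊗ ℂH` from Yetter-Drinfeld modules to graded bimodules. -/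
def underlie (H : Subgroup G) : YD G ⥤ Bim H where
  obj N := underlieObj H N
  map {M _} f :=
    { lin := LinearMap.pi fun k => f.lin ∘ₗ (LinearMap.proj k : (H → M) →ₗ[ℂ] M)
      comp_lin := fun _ _ => funext fun _ => f.comp_lin _ _
      left_lin := fun _ _ => funext fun _ => f.act_lin _ _
      right_lin := fun _ _ => rfl }
  map_id _ := rfl
  map_comp _ _ := rfl

/-! ### Subgroups and their representations -/

/-- The conjugate subgroup `x ▷ K = x K x⁻¹`. -/
def conjSub (x : G) (K : Subgroup G) : Subgroup G := K.map (MulAut.conj x).toMonoidHom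

theorem mem_conjSub {x : G} {K : Subgroup G} {y : G} : y ∈ conjSub x K ↔ x⁻¹ * y * x ∈ K := by
  constructor
  · rintro ⟨k, hk, rfl⟩
    simpa [mul_assoc] using hk
  · intro h
    exact ⟨_, h, by simp [mul_assoc]⟩

/-- The stabilizer `Stab_H(dH) = H ∩ (d ▷ H)` of the coset `dH` under left multiplication. -/
def stab (H : Subgroup G) (d : G) : Subgroup G := H ⊓ conjSub d H

/-- The centralizer `C_G(g)`. -/
def cent (g : G) : Subgroup G := Subgroup.centralizer {g}

theorem mem_cent {g y : G} : y ∈ cent g ↔ y * g = g * y := Subgroup.mem_centralizer_singleton_iff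

/-- `x⁻¹ ▷ ·` as a homomorphism `x ▷ K → K`. -/
def conjHom (x : G) (K : Subgroup G) : conjSub x K →* K where
  toFun y := ⟨x⁻¹ * y * x, mem_conjSub.1 y.2⟩
  map_one' := by ext; simp
  map_mul' a b := by ext; simp [mul_assoc]

/-- The twisted representation `x ▷ V` of `x ▷ K`: the same space, with `y` acting as
`x⁻¹ ▷ y`. -/
def twist (x : G) {K : Subgroup G} (V : FDRep ℂ K) : FDRep ℂ (conjSub x K) :=
  FDRep.of (V.ρ.comp (conjHom x K))

/-- Restriction to a smaller subgroup. -/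
def resRep {K L : Subgroup G} (h : K ≤ L) (V : FDRep ℂ L) : FDRep ℂ K :=
  FDRep.of (V.ρ.comp (Subgroup.inclusion h))

instance finite_indV {K L : Type} [Group K] [Group L] [Finite L] (φ : K →* L) {A : Type}
    [AddCommGroup A] [Module ℂ A] [FiniteDimensional ℂ A] (ρ : Representation ℂ K A) :
    FiniteDimensional ℂ (Representation.IndV φ ρ) := by
  have : Module.Finite ℂ (MonoidAlgebra ℂ L) :=
    Module.Finite.equiv (MonoidAlgebra.coeffLinearEquiv ℂ).symm
  exact Module.Finite.of_surjective _ (Representation.Coinvariants.mk_surjective _)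

/-- Induction to a larger subgroup. -/
def indRep {K L : Subgroup G} (h : K ≤ L) (V : FDRep ℂ K) : FDRep ℂ L :=
  FDRep.of (Representation.ind (Subgroup.inclusion h) V.ρ)

theorem inf_conj_cent_le_stab (H : Subgroup G) (x g : G) :
    H ⊓ conjSub x (cent g) ≤ stab H (x * g * x⁻¹) := by
  rintro y ⟨hy, hy'⟩
  refine ⟨hy, mem_conjSub.2 ?_⟩
  have hy' : x⁻¹ * y * x * g = g * (x⁻¹ * y * x) := mem_cent.1 (mem_conjSub.1 hy')
  have : (x * g * x⁻¹)⁻¹ * y * (x * g * x⁻¹) = y := by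
    calc (x * g * x⁻¹)⁻¹ * y * (x * g * x⁻¹) = x * g⁻¹ * (x⁻¹ * y * x * g) * x⁻¹ := by group
      _ = y := by rw [hy']; group
  rw [this]
  exact hy

theorem conj_cent (x g : G) : conjSub x (cent g) = cent (x * g * x⁻¹) := by
  ext y
  rw [mem_conjSub, mem_cent, mem_cent]
  constructor
  · intro h
    calc y * (x * g * x⁻¹) = x * (x⁻¹ * y * x * g) * x⁻¹ := by group
      _ = _ := by rw [h]; group
  · intro h
    calc x⁻¹ * y * x * g = x⁻¹ * (y * (x * g * x⁻¹)) * x := by group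
      _ = _ := by rw [h]; group

theorem inf_conj_cent_le_cent (K : Subgroup G) (x g : G) :
    K ⊓ conjSub x (cent g) ≤ cent (x * g * x⁻¹) := by
  rw [← conj_cent]; exact inf_le_right

/-! ### The Yetter-Drinfeld module `Ind_g(V)` -/

/-- Linear maps out of an induced representation. -/
def indLift {K L : Type} [Group K] [Group L] (φ : K →* L) {A B : Type}
    [AddCommGroup A] [Module ℂ A] [AddCommGroup B] [Module ℂ B] (ρ : Representation ℂ K A)
    (F : L → A →ₗ[ℂ] B) (hF : ∀ k l a, F (φ k * l) (ρ k a) = F l a) :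
    Representation.IndV φ ρ →ₗ[ℂ] B :=
  Representation.Coinvariants.lift _
    (TensorProduct.lift ((Finsupp.lift _ _ _ F) ∘ₗ
      (MonoidAlgebra.coeffLinearEquiv ℂ).toLinearMap))
    (fun k => by
      ext l a
      simp [hF])

@[simp] theorem indLift_mk {K L : Type} [Group K] [Group L] (φ : K →* L) {A B : Type}
    [AddCommGroup A] [Module ℂ A] [AddCommGroup B] [Module ℂ B] (ρ : Representation ℂ K A)
    (F : L → A →ₗ[ℂ] B) (hF : ∀ k l a, F (φ k * l) (ρ k a) = F l a) (l : L) (a : A) :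
    indLift φ ρ F hF (Representation.IndV.mk φ ρ l a) = F l a := by
  simp [indLift]

theorem indV_mk_mul {K L : Type} [Group K] [Group L] (φ : K →* L) {A : Type}
    [AddCommGroup A] [Module ℂ A] (ρ : Representation ℂ K A) (k : K) (l : L) (a : A) :
    Representation.IndV.mk φ ρ (φ k * l) (ρ k a) = Representation.IndV.mk φ ρ l a := by
  have := Representation.Coinvariants.mk_self_apply
    (Representation.tprod ((Representation.leftRegular ℂ L).comp φ) ρ) k
    (MonoidAlgebra.single l 1 ⊗ₜ a)
  simpa using this

open Classical in
/-- The projection of `ℂG ⊗_{ℂC} V` onto the component of degree `k`.  With Mathlib's conventions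
`IndV.mk y v` is the class of the element written `y⁻¹ ⊗ v`, so it has degree `y⁻¹ g y`. -/
def indYDComp (g : G) (V : FDRep ℂ (cent g)) (k : G) :
    Representation.IndV (cent g).subtype V.ρ →ₗ[ℂ] Representation.IndV (cent g).subtype V.ρ :=
  indLift _ _ (fun y => if y⁻¹ * g * y = k then Representation.IndV.mk (cent g).subtype V.ρ y else 0)
    (fun c y a => by
      have h : ((cent g).subtype c * y)⁻¹ * g * ((cent g).subtype c * y) = y⁻¹ * g * y := by
        have := mem_cent.1 c.2
        calc _ = y⁻¹ * (c : G)⁻¹ * (g * c) * y := by simp [mul_assoc]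
          _ = _ := by rw [← this]; group
      rw [h]
      split_ifs
      · exact indV_mk_mul _ _ _ _ _
      · rfl)

theorem indYDComp_mk (g : G) (V : FDRep ℂ (cent g)) (k y : G) (v : V)
    [Decidable (y⁻¹ * g * y = k)] :
    indYDComp g V k (Representation.IndV.mk (cent g).subtype V.ρ y v) =
      if y⁻¹ * g * y = k then Representation.IndV.mk (cent g).subtype V.ρ y v else 0 := by
  unfold indYDComp
  rw [indLift_mk]
  split_ifs <;> rfl

theorem indV_ext {K L : Type} [Group K] [Group L] {φ : K →* L} {A B : Type}
    [AddCommGroup A] [Module ℂ A] [AddCommGroup B] [Module ℂ B] {ρ : Representation ℂ K A}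
    {f g : Representation.IndV φ ρ →ₗ[ℂ] B}
    (h : ∀ l a, f (Representation.IndV.mk φ ρ l a) = g (Representation.IndV.mk φ ρ l a))
    (v : Representation.IndV φ ρ) : f v = g v :=
  LinearMap.congr_fun (Representation.IndV.hom_ext _ _ fun l => LinearMap.ext (h l)) v

/-- The Yetter-Drinfeld module `Ind_g(V)`: the induced representation `ℂG ⊗_{ℂ C_G(g)} V`, with
grading `|x ⊗ v| = x g x⁻¹`. -/
def indYD (g : G) (V : FDRep ℂ (cent g)) : YD G where
  carrier := Representation.IndV (cent g).subtype V.ρ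
  comp := indYDComp g V
  comp_self k v := by
    classical
    refine indV_ext (f := (indYDComp g V k).comp (indYDComp g V k)) (fun y a => ?_) v
    rw [LinearMap.comp_apply, indYDComp_mk]
    split_ifs with h
    · rw [indYDComp_mk, if_pos h]
    · exact map_zero _
  comp_ne k l hkl v := by
    classical
    refine indV_ext (f := (indYDComp g V k).comp (indYDComp g V l)) (g := 0) (fun y a => ?_) v
    rw [LinearMap.comp_apply, indYDComp_mk]
    split_ifs with h
    · rw [indYDComp_mk, if_neg (by rw [h]; exact hkl.symm)]; rfl
    · exact map_zero _
  sum_comp v := by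
    classical
    have := indV_ext (f := ∑ k, indYDComp g V k) (g := LinearMap.id) (fun y a => by
      rw [LinearMap.sum_apply, Finset.sum_eq_single (y⁻¹ * g * y)]
      · rw [indYDComp_mk, if_pos rfl]; rfl
      · intro k _ hk; rw [indYDComp_mk, if_neg hk.symm]
      · intro h; exact absurd (Finset.mem_univ _) h) v
    rwa [LinearMap.sum_apply] at this
  act := Representation.ind (cent g).subtype V.ρ
  comp_act x k v := by
    classical
    refine indV_ext
      (f := (indYDComp g V (x * k * x⁻¹)).comp (Representation.ind (cent g).subtype V.ρ x))
      (g := (Representation.ind (cent g).subtype V.ρ x).comp (indYDComp g V k))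
      (fun y a => ?_) v
    refine (congrArg (indYDComp g V (x * k * x⁻¹))
      (Representation.ind_mk (cent g).subtype V.ρ x y a)).trans ?_
    refine (indYDComp_mk g V _ (y * x⁻¹) a).trans ?_
    refine Eq.trans ?_
      (congrArg (Representation.ind (cent g).subtype V.ρ x) (indYDComp_mk g V k y a)).symm
    have h : ((y * x⁻¹)⁻¹ * g * (y * x⁻¹) = x * k * x⁻¹) ↔ y⁻¹ * g * y = k := by
      constructor
      · intro h
        calc y⁻¹ * g * y = x⁻¹ * ((y * x⁻¹)⁻¹ * g * (y * x⁻¹)) * x := by group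
          _ = k := by rw [h]; group
      · rintro rfl; group
    by_cases hk : y⁻¹ * g * y = k
    · rw [if_pos hk, if_pos (h.2 hk)]
      exact (Representation.ind_mk (cent g).subtype V.ρ x y a).symm
    · rw [if_neg hk, if_neg (mt h.1 hk), map_zero]

/-! ### The bimodule `Ind_d(W)` -/

section IndBim

variable (H : Subgroup G) (d : G)

/-- The inclusion of the stabilizer in `H`. -/
def stabIncl : stab H d →* H := Subgroup.inclusion inf_le_left

/-- The space underlying `Ind_d(W)`: functions `f` of `h ∈ H` and `g ∈ G` with values in `W` such
that `f(h, g) = 0` unless `g ∈ hdH` and `f(hs, g) = s⁻¹ f(h, g)` for `s ∈ Stab_H(dH)`. -/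
def indBimSub (W : FDRep ℂ (stab H d)) : Submodule ℂ (H → G → W) where
  carrier := {f | (∀ (h : H) g, d⁻¹ * (h : G)⁻¹ * g ∉ H → f h g = 0) ∧
    ∀ h (s : stab H d) g, f (h * stabIncl H d s) g = W.ρ s⁻¹ (f h g)}
  zero_mem' := ⟨fun _ _ _ => rfl, fun _ _ _ => (map_zero _).symm⟩
  add_mem' {a b} ha hb := ⟨fun h g hg => by
      rw [Pi.add_apply, Pi.add_apply, ha.1 h g hg, hb.1 h g hg, add_zero],
    fun h s g => by
      rw [Pi.add_apply, Pi.add_apply, ha.2, hb.2, Pi.add_apply, Pi.add_apply, map_add]⟩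
  smul_mem' c a ha := ⟨fun h g hg => by
      rw [Pi.smul_apply, Pi.smul_apply, ha.1 h g hg, smul_zero],
    fun h s g => by
      rw [Pi.smul_apply, Pi.smul_apply, ha.2, Pi.smul_apply, Pi.smul_apply, map_smul]⟩

variable {H d}

open Classical in
/-- Restriction of functions to `g = k`. -/
def indBimComp (W : FDRep ℂ (stab H d)) (k : G) : indBimSub H d W →ₗ[ℂ] indBimSub H d W where
  toFun f := ⟨fun h g => if g = k then f.1 h g else 0,
    fun h g hg => by beta_reduce; rw [f.2.1 h g hg, ite_self],
    fun h s g => by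
      beta_reduce
      by_cases e : g = k
      · rw [if_pos e, if_pos e, f.2.2]
      · rw [if_neg e, if_neg e, map_zero]⟩
  map_add' a b := by
    refine Subtype.ext (funext fun h => funext fun g => ?_)
    by_cases e : g = k <;> simp [e]
  map_smul' c a := by
    refine Subtype.ext (funext fun h => funext fun g => ?_)
    by_cases e : g = k <;> simp [e]

theorem indBimComp_apply (W : FDRep ℂ (stab H d)) (k : G) (f : indBimSub H d W) (h : H) (g : G)
    [Decidable (g = k)] : (indBimComp W k f).1 h g = if g = k then f.1 h g else 0 := by
  unfold indBimComp
  split_ifs with e <;> simp [e]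

/-- The left action `(a f)(h, g) = f(a⁻¹ h, a⁻¹ g)`. -/
def indBimLeft (W : FDRep ℂ (stab H d)) : Representation ℂ H (indBimSub H d W) where
  toFun a :=
    { toFun := fun f => ⟨fun h g => f.1 (a⁻¹ * h) ((a : G)⁻¹ * g),
        fun h g hg => f.2.1 _ _ (fun hm => hg (by
          have e : d⁻¹ * ((a⁻¹ * h : H) : G)⁻¹ * ((a : G)⁻¹ * g) = d⁻¹ * (h : G)⁻¹ * g := by
            push_cast; group
          rwa [e] at hm)),
        fun h s g => by beta_reduce; rw [← mul_assoc, f.2.2]⟩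
      map_add' := fun _ _ => rfl
      map_smul' := fun _ _ => rfl }
  map_one' := by
    refine LinearMap.ext fun f => Subtype.ext (funext fun h => funext fun g => ?_)
    simp
  map_mul' a b := by
    refine LinearMap.ext fun f => Subtype.ext (funext fun h => funext fun g => ?_)
    simp [mul_assoc]

/-- The right action `(f b)(h, g) = f(h, g b⁻¹)`. -/
def indBimRight (W : FDRep ℂ (stab H d)) : Representation ℂ (H)ᵐᵒᵖ (indBimSub H d W) where
  toFun b :=
    { toFun := fun f => ⟨fun h g => f.1 h (g * (b.unop : G)⁻¹),
        fun h g hg => f.2.1 _ _ (fun hm => hg (by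
          have := H.mul_mem hm b.unop.2
          simpa [mul_assoc] using this)),
        fun h s g => f.2.2 h s _⟩
      map_add' := fun _ _ => rfl
      map_smul' := fun _ _ => rfl }
  map_one' := by
    refine LinearMap.ext fun f => Subtype.ext (funext fun h => funext fun g => ?_)
    simp
  map_mul' a b := by
    refine LinearMap.ext fun f => Subtype.ext (funext fun h => funext fun g => ?_)
    simp [mul_assoc]

theorem indBimLeft_apply (W : FDRep ℂ (stab H d)) (a : H) (f : indBimSub H d W) (h : H) (g : G) :
    (indBimLeft W a f).1 h g = f.1 (a⁻¹ * h) ((a : G)⁻¹ * g) := rfl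

theorem indBimRight_apply (W : FDRep ℂ (stab H d)) (b : (H)ᵐᵒᵖ) (f : indBimSub H d W) (h : H)
    (g : G) : (indBimRight W b f).1 h g = f.1 h (g * (b.unop : G)⁻¹) := rfl

/-- The graded bimodule `Ind_d(W)`, a model of `ℂH ⊗_{ℂS} (W ⊗ ℂ[dH])` with `S = Stab_H(dH)`:
functions concentrated at `g` have degree `g`, and `(a f b)(h, g) = f(a⁻¹ h, a⁻¹ g b⁻¹)`.
(An element `h ⊗ w ⊗ dk` corresponds to the function concentrated at `hdk` with value `s⁻¹ w` at
`hs`, `s ∈ S`, and `0` outside `hS`.) -/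
def indBimObj (W : FDRep ℂ (stab H d)) : Bim H where
  carrier := indBimSub H d W
  comp := indBimComp W
  comp_self k f := by
    classical
    refine Subtype.ext (funext fun h => funext fun g => ?_)
    rw [indBimComp_apply, indBimComp_apply]
    split_ifs <;> rfl
  comp_ne k l hkl f := by
    classical
    refine Subtype.ext (funext fun h => funext fun g => ?_)
    rw [indBimComp_apply, indBimComp_apply]
    split_ifs with h1 h2
    · exact absurd (h1.symm.trans h2) hkl
    · rfl
    · rfl
  sum_comp f := by
    classical
    refine Subtype.ext (funext fun h => funext fun g => ?_)
    rw [AddSubmonoidClass.coe_finsetSum, Finset.sum_apply, Finset.sum_apply]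
    simp [indBimComp_apply]
  left := indBimLeft W
  right := indBimRight W
  left_right a b f := by
    refine Subtype.ext (funext fun h => funext fun g => ?_)
    simp only [indBimLeft_apply, indBimRight_apply, mul_assoc]
  comp_act a b k f := by
    classical
    refine Subtype.ext (funext fun h => funext fun g => ?_)
    simp only [indBimLeft_apply, indBimRight_apply, indBimComp_apply, mul_assoc,
      MulOpposite.unop_op]
    refine if_congr ?_ rfl rfl
    constructor
    · rintro rfl; group
    · rintro rfl; group

/-- The linear map underlying a morphism of representations. -/
def repLin {K : Type} [Monoid K] {V W : FDRep ℂ K} (f : V ⟶ W) : V →ₗ[ℂ] W := f.hom.hom.hom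

theorem repLin_comm {K : Type} [Monoid K] {V W : FDRep ℂ K} (f : V ⟶ W) (k : K) (v : V) :
    repLin f (V.ρ k v) = W.ρ k (repLin f v) :=
  ConcreteCategory.congr_hom (f.comm k) v

/-- An intertwining map as a morphism of representations. -/
def repHom {K : Type} [Monoid K] {V W : Type} [AddCommGroup V] [Module ℂ V]
    [FiniteDimensional ℂ V] [AddCommGroup W] [Module ℂ W] [FiniteDimensional ℂ W]
    {ρ : Representation ℂ K V} {σ : Representation ℂ K W} (f : V →ₗ[ℂ] W)
    (hf : ∀ k v, f (ρ k v) = σ k (f v)) : FDRep.of ρ ⟶ FDRep.of σ where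
  hom := FGModuleCat.ofHom f
  comm k := by
    ext v
    exact hf k v

/-- The map induced by a morphism on function spaces, `f ↦ φ ∘ f`. -/
def indBimMap {W W' : FDRep ℂ (stab H d)} (φ : W ⟶ W') :
    indBimSub H d W →ₗ[ℂ] indBimSub H d W' where
  toFun f := ⟨fun h g => repLin φ (f.1 h g),
    fun h g hg => by beta_reduce; rw [f.2.1 h g hg, map_zero],
    fun h s g => by beta_reduce; rw [f.2.2, repLin_comm]⟩
  map_add' a b := by
    refine Subtype.ext (funext fun h => funext fun g => ?_)
    exact map_add (repLin φ) _ _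
  map_smul' c a := by
    refine Subtype.ext (funext fun h => funext fun g => ?_)
    exact map_smul (repLin φ) _ _

theorem indBimMap_comp {W W' : FDRep ℂ (stab H d)} (φ : W ⟶ W') (k : G)
    (f : indBimSub H d W) :
    indBimMap φ (indBimComp W k f) = indBimComp W' k (indBimMap φ f) := by
  classical
  refine Subtype.ext (funext fun h => funext fun g => ?_)
  change repLin φ ((indBimComp W k f).1 h g) = (indBimComp W' k (indBimMap φ f)).1 h g
  rw [indBimComp_apply, indBimComp_apply]
  split_ifs
  · rfl
  · exact map_zero _

variable (H d) in
/-- The functor `Ind_d : Rep(Stab_H(dH)) ⥤ {}^G_H M_H`. -/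
def indBim : FDRep ℂ (stab H d) ⥤ Bim H where
  obj W := indBimObj W
  map {W W'} φ :=
    { lin := indBimMap φ
      comp_lin := fun k f => indBimMap_comp φ k f
      left_lin := fun _ _ => rfl
      right_lin := fun _ _ => rfl }
  map_id _ := rfl
  map_comp _ _ := rfl

/-! ### The functor `M ↦ M_{dH} / H` -/

variable (d) in
/-- The subspace `M_{dH}` of vectors all of whose homogeneous components have degree in `dH`. -/
def cosetPiece (M : Bim H) : Submodule ℂ M where
  carrier := {v | ∀ g, d⁻¹ * g ∉ H → M.comp g v = 0}
  zero_mem' := fun _ _ => map_zero _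
  add_mem' {a b} ha hb := fun g hg => by rw [map_add, ha g hg, hb g hg, add_zero]
  smul_mem' c a ha := fun g hg => by rw [map_smul, ha g hg, smul_zero]

variable (d) in
/-- The right action of `H` on `M_{dH}`. -/
def cosetRight (M : Bim H) : Representation ℂ (H)ᵐᵒᵖ (cosetPiece d M) where
  toFun b := (M.right b).restrict (fun v hv g hg => by
    have := M.comp_right b.unop g v
    rw [MulOpposite.op_unop] at this
    rw [this, hv _ (fun hm => hg (by
      have := H.mul_mem hm b.unop.2
      simpa [mul_assoc] using this)), map_zero])
  map_one' := LinearMap.ext fun v => Subtype.ext (LinearMap.congr_fun (map_one M.right) v.1)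
  map_mul' a b := LinearMap.ext fun v =>
    Subtype.ext (LinearMap.congr_fun (map_mul M.right a b) v.1)

variable (d) in
/-- The left action of `Stab_H(dH)` on `M_{dH}`. -/
def cosetLeft (M : Bim H) : Representation ℂ (stab H d) (cosetPiece d M) where
  toFun s := (M.left (stabIncl H d s)).restrict (fun v hv g hg => by
    rw [M.comp_left, hv _ (fun hm => hg (by
      have hs : d⁻¹ * (s : G) * d ∈ H := mem_conjSub.1 s.2.2
      have := H.mul_mem hs hm
      have e : d⁻¹ * (s : G) * d * (d⁻¹ * ((s : G)⁻¹ * g)) = d⁻¹ * g := by group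
      change d⁻¹ * (s : G) * d * (d⁻¹ * ((s : G)⁻¹ * g)) ∈ H at this
      rwa [e] at this)), map_zero])
  map_one' := LinearMap.ext fun v => Subtype.ext (by
    change M.left (stabIncl H d 1) v.1 = v.1
    rw [map_one, map_one]; rfl)
  map_mul' a b := LinearMap.ext fun v => Subtype.ext (by
    change M.left (stabIncl H d (a * b)) v.1 = _
    rw [map_mul, map_mul]; rfl)

variable (d) in
/-- The representation of `Stab_H(dH)` on `M_{dH} / H`. -/
def cosetQuot (M : Bim H) :
    Representation ℂ (stab H d) (Representation.Coinvariants (cosetRight d M)) where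
  toFun s := Representation.Coinvariants.map _ _ ⟨cosetLeft d M s, fun b => by
    refine LinearMap.ext fun v => Subtype.ext ?_
    exact M.left_right (stabIncl H d s) b v⟩
  map_one' := by
    refine Representation.Coinvariants.hom_ext (LinearMap.ext fun v => ?_)
    simp
  map_mul' a b := by
    refine Representation.Coinvariants.hom_ext (LinearMap.ext fun v => ?_)
    simp

instance (M : Bim H) : FiniteDimensional ℂ (Representation.Coinvariants (cosetRight d M)) :=
  Module.Finite.of_surjective _ (Representation.Coinvariants.mk_surjective _)

variable (d) in
/-- The map induced by a morphism on `M_{dH}`. -/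
def cosetMap {M N : Bim H} (f : M ⟶ N) : cosetPiece d M →ₗ[ℂ] cosetPiece d N :=
  f.lin.restrict (fun v hv g hg => by rw [← f.comp_lin, hv g hg, map_zero])

variable (H d) in
/-- The functor `M ↦ M_{dH} / H` from graded bimodules to representations of `Stab_H(dH)`. -/
def fiber : Bim H ⥤ FDRep ℂ (stab H d) where
  obj M := FDRep.of (cosetQuot d M)
  map {M N} f := repHom
    (Representation.Coinvariants.map _ _ ⟨cosetMap d f, fun b => by
      refine LinearMap.ext fun v => Subtype.ext ?_
      exact f.right_lin b v⟩)
    (fun s v => by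
      obtain ⟨v, rfl⟩ := Representation.Coinvariants.mk_surjective _ v
      refine congrArg (Representation.Coinvariants.mk _) (Subtype.ext ?_)
      exact f.left_lin (stabIncl H d s) v)
  map_id M := by
    ext v
    rfl
  map_comp f g := by
    ext v
    rfl

variable (H d) in
/-- The graded bimodules all of whose homogeneous elements have degree in the double coset
`HdH`. -/
def supportedOn : ObjectProperty (Bim H) :=
  fun M => ∀ g, g ∉ DoubleCoset.doubleCoset d (H : Set G) (H : Set G) → ∀ v, M.comp g v = 0

end IndBim

/-! ### Systems of representatives -/

/-- `R` is a system of representatives of the conjugacy classes of `G`. -/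
def IsConjReps (R : Set G) : Prop := ∀ y : G, ∃! g, g ∈ R ∧ IsConj g y

/-- `R` is a system of representatives of the double cosets `K \ G / L`. -/
def IsDoubleCosetReps (K L : Subgroup G) (R : Set G) : Prop :=
  ∀ y : G, ∃! x, x ∈ R ∧ y ∈ DoubleCoset.doubleCoset x (K : Set G) (L : Set G)

/-- `R` is a system of representatives of the cosets `H / S`, for a subgroup `S` of `H`. -/
def IsCosetReps (H S : Subgroup G) (R : Set G) : Prop :=
  R ⊆ H ∧ ∀ y ∈ H, ∃! h, h ∈ R ∧ h⁻¹ * y ∈ S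

/-- The summand `Ind_{x ▷ g}(Ind Res (x ▷ V))` of `Ind_g(V) ⊗ ℂH`; the induction is from
`H ∩ (x ▷ C_G(g))` to `Stab_H((x ▷ g)H)`. -/
def underlieSummand (H : Subgroup G) (g : G) (V : FDRep ℂ (cent g)) (x : G) : Bim H :=
  (indBim H (x * g * x⁻¹)).obj
    (indRep (inf_conj_cent_le_stab H x g) (resRep inf_le_right (twist x V)))

/-- The summand `Ind_{x ▷ g}(Ind Res (h ▷ W))` of the adjoint; with `S = Stab_H(dH)`, the
restriction is from `h ▷ S` to `(h ▷ S) ∩ (x ▷ C_G(g))`, and the induction from there to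
`x ▷ C_G(g) = C_G(x ▷ g)`. -/
def adjointSummand (H : Subgroup G) (d : G) (W : FDRep ℂ (stab H d)) (g x h : G) : YD G :=
  indYD (x * g * x⁻¹)
    (indRep (inf_conj_cent_le_cent (conjSub h (stab H d)) x g)
      (resRep inf_le_left (twist h W)))

/-- The index set of the sum: triples `(g, x, h)` of a conjugacy class representative `g`, a
representative `x` of a double coset in `H \ G / C_G(g)`, and a coset representative `h` with
`x ▷ g ∈ hdH`. -/
def AdjointIndex (H : Subgroup G) (d : G) (𝔠 : Set G) (𝔛 : G → Set G) (𝔥 : Set G) : Type :=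
  {p : G × G × G // p.1 ∈ 𝔠 ∧ p.2.1 ∈ 𝔛 p.1 ∧ p.2.2 ∈ 𝔥 ∧
    ∃ k ∈ H, p.2.1 * p.1 * p.2.1⁻¹ = p.2.2 * d * k}

instance (H : Subgroup G) (d : G) (𝔠 : Set G) (𝔛 : G → Set G) (𝔥 : Set G) :
    Finite (AdjointIndex H d 𝔠 𝔛 𝔥) :=
  inferInstanceAs (Finite {p : G × G × G // p.1 ∈ 𝔠 ∧ p.2.1 ∈ 𝔛 p.1 ∧ p.2.2 ∈ 𝔥 ∧
    ∃ k ∈ H, p.2.1 * p.1 * p.2.1⁻¹ = p.2.2 * d * k})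

end
end GrpBimod

open GrpBimod

namespace GrpBimod

set_option linter.unusedSectionVars false

noncomputable section

/-! ### Maps into induced representations -/

/-! The whole theorem is Frobenius reciprocity over finite groups, used in an explicit form. Write
`S` for `Stab_H(dH)`. A linear map `π : B → W` that is right `H`-invariant, `S`-equivariant and zero
in degrees outside `dH` is the same as a morphism `B → Ind_d(W)`, namely `b ↦ ((h, g) ↦ π(h⁻¹
b_g))`. Likewise a map `π : B → A` that vanishes in degrees other than `y` yields, by averaging, a
morphism from a Yetter-Drinfeld module `B` to `Ind_y(A)`. Direct sum decompositions then follow from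
a criterion on a family `π_p`: they must separate vectors, and each `a` in a target must come from
some `b` whose orbit under `π_p` is the orbit of `a` extended by zero, while the other `π_q` kill
the orbit of `b` (`toIndBim_injective`, `toIndBim_surjective`, `toIndYD_injective`,
`toIndYD_surjective`). No dimension is ever counted.

(0) The class of `v` in `M_{dH}/H` is recorded by `∑ₖ (vk)_d`, so `M_{dH}/H` is `M_d` as a vector
space. If the degrees of `M` lie in `HdH`, every homogeneous component is a translate of `M_d`, and
the criterion with a single summand gives `M ≅ Ind_d(M_{dH}/H)`.

(1) By naturality a half-braiding on `V` is determined by its values on the free bimodules `ℂH ⊗ ℂg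
⊗ ℂH`. Since `V ⊗_{ℂH} (ℂH ⊗ ℂg ⊗ ℂH)` is `V ⊗ ℂg ⊗ ℂH`, these values amount to operators `T_g` on
`V` with `c(x ⊗ v) = ∑ₖ T_g(v k⁻¹) ⊗ x k` for `x` of degree `g`
(`RightHalfBraiding.hom_tm_of_comp`). The tensor axiom becomes `T_g T_h = T_{gh}` together with
`T_g(T_h(v) l) = 0` for `l ≠ 1`, and invertibility gives `∑ₖ T_1(v k⁻¹) k = v`. Hence `T_1` is an
idempotent, its image `N` is a Yetter-Drinfeld module under the `T_g`, and `V` is the direct sum of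
the spaces `Nk`, that is `N ⊗ ℂH`.

(2) This is Mackey's argument: the projection belonging to `x` takes the part of `Ind_g(V)` of
degree `x ▷ g`, and the double cosets in `H\G/C` label the `H`-orbits on the conjugacy class of `g`.

(3) The bimodule `N ⊗ ℂH` is free as a right module on `N ⊗ 1`, where `hn ⊗ 1 = h(n ⊗ 1)h⁻¹`. So
morphisms between `N ⊗ ℂH` and `M`, in either direction, are graded `H`-maps between `N` and `M`
with the adjoint action. Coinduction from `H` to `G` is thus right adjoint to `N ↦ N ⊗ ℂH`, and it
is also left adjoint because induction and coinduction agree for finite groups. On `Ind_d(W)` the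
criterion applies to evaluation at `1`, `h` and `x ▷ g`; the triples `(g, x, h)` are the orbit
representatives that remain. -/

theorem rep_apply_apply {K V : Type} [Monoid K] [AddCommGroup V] [Module ℂ V]
    (ρ : Representation ℂ K V) (a b : K) (v : V) : ρ a (ρ b v) = ρ (a * b) v :=
  (LinearMap.congr_fun (map_mul ρ a b) v).symm

section IndInto

variable {K L M : Type} [Group K] [Group L] [Group M] [Fintype K] [Fintype L] [Fintype M]
  {A B : Type} [AddCommGroup A] [Module ℂ A] [AddCommGroup B] [Module ℂ B]

open Classical in
/-- For an injective `φ`, the extension of `ρ` from `K` to `L` by zero. -/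
def zeroExt (φ : K →* L) (ρ : Representation ℂ K A) (l : L) : A →ₗ[ℂ] A :=
  ∑ k, if φ k = l then ρ k else 0

theorem zeroExt_apply [DecidableEq L] (φ : K →* L) (ρ : Representation ℂ K A) (l : L) (a : A) :
    zeroExt φ ρ l a = ∑ k, if φ k = l then ρ k a else 0 := by
  rw [zeroExt, LinearMap.sum_apply]
  refine Finset.sum_congr rfl fun k _ => ?_
  split_ifs <;> rfl

theorem zeroExt_of_mem {φ : K →* L} (hφ : Function.Injective φ) (ρ : Representation ℂ K A)
    (k : K) (a : A) : zeroExt φ ρ (φ k) a = ρ k a := by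
  classical
  rw [zeroExt_apply, Finset.sum_eq_single k, if_pos rfl]
  · intro j _ hj
    rw [if_neg fun h => hj (hφ h)]
  · simp

theorem zeroExt_of_notMem {φ : K →* L} (ρ : Representation ℂ K A) {l : L} (hl : ∀ k, φ k ≠ l)
    (a : A) : zeroExt φ ρ l a = 0 := by
  classical
  rw [zeroExt_apply]
  exact Finset.sum_eq_zero fun k _ => if_neg (hl k)

theorem zeroExt_act (φ : K →* L) (ρ : Representation ℂ K A) (l : L) (k : K) (a : A) :
    zeroExt φ ρ l (ρ k a) = zeroExt φ ρ (l * φ k) a := by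
  classical
  rw [zeroExt_apply, zeroExt_apply]
  refine Fintype.sum_equiv (Equiv.mulRight k) _ _ fun j => ?_
  simp

theorem zeroExt_mul_left (φ : K →* L) (ρ : Representation ℂ K A) (k : K) (l : L) (a : A) :
    zeroExt φ ρ (φ k * l) a = ρ k (zeroExt φ ρ l a) := by
  classical
  rw [zeroExt_apply, zeroExt_apply, map_sum]
  refine Fintype.sum_equiv (Equiv.mulLeft k⁻¹) _ _ fun j => ?_
  have hc : φ (k⁻¹ * j) = l ↔ φ j = φ k * l := by
    rw [map_mul, map_inv, inv_mul_eq_iff_eq_mul]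
  simp only [Equiv.coe_mulLeft, hc]
  split_ifs
  · rw [← Module.End.mul_apply, ← map_mul, mul_inv_cancel_left]
  · exact (map_zero _).symm

/-- The map into an induced representation corresponding to a map `π` to the inducing
representation. -/
def indInto (φ : K →* L) (ρ : Representation ℂ K A) (σ : Representation ℂ L B) (π : B →ₗ[ℂ] A) :
    B →ₗ[ℂ] Representation.IndV φ ρ :=
  (Fintype.card K : ℂ)⁻¹ • ∑ l, Representation.IndV.mk φ ρ l ∘ₗ π ∘ₗ σ l

theorem indInto_apply (φ : K →* L) (ρ : Representation ℂ K A) (σ : Representation ℂ L B)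
    (π : B →ₗ[ℂ] A) (b : B) : indInto φ ρ σ π b =
      (Fintype.card K : ℂ)⁻¹ • ∑ l, Representation.IndV.mk φ ρ l (π (σ l b)) := by
  rw [indInto, LinearMap.smul_apply, LinearMap.sum_apply]
  rfl

/-- The average runs over all of `L`, so a translation only permutes its terms; no equivariance of
`π` enters here. -/
theorem indInto_act (φ : K →* L) (ρ : Representation ℂ K A) (σ : Representation ℂ L B)
    (π : B →ₗ[ℂ] A) (x : L) (b : B) :
    indInto φ ρ σ π (σ x b) = Representation.ind φ ρ x (indInto φ ρ σ π b) := by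
  rw [indInto_apply, indInto_apply, map_smul, map_sum]
  congr 1
  refine Fintype.sum_equiv (Equiv.mulRight x) _ _ fun l => ?_
  rw [Representation.ind_mk, Equiv.coe_mulRight, map_mul, mul_inv_cancel_right]
  rfl

/-- A retraction of the inclusion of the inducing representation. -/
def indEval (φ : K →* L) (ρ : Representation ℂ K A) : Representation.IndV φ ρ →ₗ[ℂ] A :=
  indLift φ ρ (fun l => zeroExt φ ρ l⁻¹) (fun k l a => by
    rw [zeroExt_act]
    simp)

/-- The inverse reflects the convention that `IndV.mk φ ρ l a` is the class of `l⁻¹ ⊗ a`. -/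
theorem indEval_mk (φ : K →* L) (ρ : Representation ℂ K A) (l : L) (a : A) :
    indEval φ ρ (Representation.IndV.mk φ ρ l a) = zeroExt φ ρ l⁻¹ a :=
  indLift_mk _ _ _ _ _ _

theorem card_inv_smul_sum {X : Type} [Fintype X] [Nonempty X] (a : A) :
    (Fintype.card X : ℂ)⁻¹ • ∑ _x : X, a = a := by
  rw [Finset.sum_const, Finset.card_univ, ← Nat.cast_smul_eq_nsmul ℂ, smul_smul,
    inv_mul_cancel₀ (Nat.cast_ne_zero.2 Fintype.card_ne_zero), one_smul]

/-- Each `k` in `K` picks out exactly one term, `l = φ(k)⁻¹`, and by equivariance that term equals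
`π b`; the factor `1/|K|` cancels the repetition. -/
theorem indEval_indInto {φ : K →* L} {ρ : Representation ℂ K A} {σ : Representation ℂ L B}
    {π : B →ₗ[ℂ] A} (hπ : ∀ k b, π (σ (φ k) b) = ρ k (π b)) (b : B) :
    indEval φ ρ (indInto φ ρ σ π b) = π b := by
  classical
  rw [indInto_apply, map_smul, map_sum]
  refine Eq.trans ?_ (card_inv_smul_sum (X := K) (π b))
  congr 1
  simp only [indEval_mk, zeroExt_apply]
  rw [Finset.sum_comm]
  refine Finset.sum_congr rfl fun k _ => ?_
  rw [Finset.sum_eq_single (φ k)⁻¹]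
  · rw [if_pos (by simp), ← map_inv, hπ, ← Module.End.mul_apply, ← map_mul]
    simp
  · intro l _ hl
    rw [if_neg fun h => hl (by rw [h, inv_inv])]
  · simp

/-- Transitivity of induction at the level of orbits. It lets the surjectivity criteria be verified
for an induced representation by looking only at the smaller group `K`. -/
theorem indInto_tower (φ : K →* L) (ψ : L →* M) (ρ : Representation ℂ K A)
    (τ : Representation ℂ M B) (π : B →ₗ[ℂ] A) (b : B) (a : A)
    (h : ∀ m, π (τ m b) = zeroExt (ψ.comp φ) ρ m a) (m : M) :
    indInto φ ρ (τ.comp ψ) π (τ m b) =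
      zeroExt ψ (Representation.ind φ ρ) m (Representation.IndV.mk φ ρ 1 a) := by
  classical
  rw [indInto_apply]
  have h' : ∀ l, π ((τ.comp ψ) l (τ m b)) = ∑ k, if ψ (φ k) = ψ l * m then ρ k a else 0 := by
    intro l
    rw [MonoidHom.comp_apply, ← Module.End.mul_apply, ← map_mul, h, zeroExt_apply]
    rfl
  simp only [h', map_sum]
  rw [Finset.sum_comm]
  refine Eq.trans ?_ (card_inv_smul_sum (X := K) _)
  congr 1
  refine Finset.sum_congr rfl fun k _ => ?_
  rw [zeroExt_apply]
  -- For fixed `k` the substitution `l ↦ l⁻¹ φ(k)` turns the class of `l⁻¹ ⊗ k a` into the translate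
  -- of `1 ⊗ a` by the new variable.
  refine Fintype.sum_equiv ((Equiv.inv L).trans (Equiv.mulRight (φ k))) _ _ fun l => ?_
  have hc : ψ (φ k) = ψ l * m ↔ ψ (l⁻¹ * φ k) = m := by
    rw [map_mul, map_inv, inv_mul_eq_iff_eq_mul]
  have hm : Representation.IndV.mk φ ρ l (ρ k a) =
      Representation.ind φ ρ (l⁻¹ * φ k) (Representation.IndV.mk φ ρ 1 a) := by
    rw [Representation.ind_mk, ← indV_mk_mul φ ρ k (1 * (l⁻¹ * φ k)⁻¹) a]
    congr 2
    group
  simp only [Equiv.trans_apply, Equiv.inv_apply, Equiv.coe_mulRight, hc]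
  split_ifs
  · exact hm
  · exact map_zero _

/-- The case of `indInto_tower` in which the upper homomorphism is the identity of `L`, evaluated at
`1`. -/
theorem indInto_of_zeroExt (φ : K →* L) (ρ : Representation ℂ K A) (σ : Representation ℂ L B)
    (π : B →ₗ[ℂ] A) (b : B) (a : A) (h : ∀ l, π (σ l b) = zeroExt φ ρ l a) :
    indInto φ ρ σ π b = Representation.IndV.mk φ ρ 1 a := by
  have := indInto_tower φ (MonoidHom.id L) ρ σ π b a h 1
  rw [map_one] at this
  refine this.trans ?_
  refine (zeroExt_of_mem (φ := MonoidHom.id L) Function.injective_id _ 1 _).trans ?_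
  rw [map_one]
  rfl

/-- An induced representation is generated, under addition and the action of `L`, by the elements `1
⊗ a`. -/
theorem indV_induction {φ : K →* L} {ρ : Representation ℂ K A}
    {P : Representation.IndV φ ρ → Prop} (h0 : P 0)
    (hmk : ∀ a, P (Representation.IndV.mk φ ρ 1 a))
    (hadd : ∀ v w, P v → P w → P (v + w))
    (hact : ∀ l v, P v → P (Representation.ind φ ρ l v)) (v : Representation.IndV φ ρ) : P v := by
  have hl : ∀ l a, P (Representation.IndV.mk φ ρ l a) := fun l a => by
    have := hact l⁻¹ _ (hmk a)
    rw [Representation.ind_mk] at this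
    simpa using this
  let S : Submodule ℂ (Representation.IndV φ ρ) :=
    Submodule.span ℂ (Set.range fun p : L × A => Representation.IndV.mk φ ρ p.1 p.2)
  have hS : v ∈ S := by
    have := indV_ext (f := S.mkQ) (g := 0) (fun l a =>
      (Submodule.Quotient.mk_eq_zero S).2 (Submodule.subset_span ⟨(l, a), rfl⟩)) v
    exact (Submodule.Quotient.mk_eq_zero S).1 this
  -- Scalars need only be applied to generators, where they are absorbed into `a`; this is why `P`
  -- is not required to respect them.
  refine Submodule.closure_induction (p := fun v _ => P v) h0 (fun v w _ _ => hadd v w) ?_ hS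
  rintro c _ ⟨⟨l, a⟩, rfl⟩
  rw [← map_smul]
  exact hl l _

end IndInto

variable {G : Type} [Group G] [Fintype G]

/-! ### Recognising direct sums of induced bimodules -/

instance subgroupFintype (K : Subgroup G) : Fintype K := Fintype.ofFinite K

/-- Sums over a subgroup become sums over `G` with a cut-off, which can be reindexed by bijections
of `G` that do not preserve the subgroup. -/
theorem sum_subgroup {A : Type} [AddCommMonoid A] (K : Subgroup G) [DecidablePred (· ∈ K)]
    (F : G → A) : ∑ k : K, F k = ∑ g, if g ∈ K then F g else 0 := by
  rw [← Finset.sum_filter]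
  exact (Finset.sum_subtype _ (fun x => by simp) F).symm

section ToIndBim

variable {H : Subgroup G} {d : G}

theorem stabIncl_coe (s : stab H d) : ((stabIncl H d s : H) : G) = s := rfl

theorem stabIncl_injective : Function.Injective (stabIncl H d) :=
  Subgroup.inclusion_injective _

theorem exists_stabIncl {h : H} (hh : d⁻¹ * (h : G) * d ∈ H) : ∃ s, stabIncl H d s = h :=
  ⟨⟨h, h.2, mem_conjSub.2 hh⟩, rfl⟩

theorem conj_stab_mem (s : stab H d) : d⁻¹ * (s : G) * d ∈ H := mem_conjSub.1 s.2.2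

/-- The morphism to `Ind_d(W)` corresponding to a linear map `π` to `W` that is
right `H`-invariant, `Stab_H(dH)`-equivariant and vanishes in degrees outside `dH`. -/
def toIndBim (B : Bim H) (W : FDRep ℂ (stab H d)) (π : B →ₗ[ℂ] W)
    (h0 : ∀ g, d⁻¹ * g ∉ H → ∀ b, π (B.comp g b) = 0)
    (hs : ∀ s b, π (B.left (stabIncl H d s) b) = W.ρ s (π b))
    (hr : ∀ k b, π (B.right k b) = π b) : B ⟶ (indBim H d).obj W where
  lin :=
    { toFun := fun b => ⟨fun h g => π (B.left h⁻¹ (B.comp g b)),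
        fun h g hg => by
          have := B.comp_left h⁻¹ ((h : G)⁻¹ * g) b
          simp only [InvMemClass.coe_inv, inv_inv, mul_inv_cancel_left] at this
          beta_reduce
          rw [← this]
          exact h0 _ (by rwa [← mul_assoc]) _,
        fun h s g => by
          beta_reduce
          rw [← hs, mul_inv_rev, map_mul, Module.End.mul_apply, map_inv (stabIncl H d)]⟩
      map_add' := fun a b => Subtype.ext (funext fun h => funext fun g => by
        simp only [map_add]; rfl)
      map_smul' := fun c b => Subtype.ext (funext fun h => funext fun g => by
        simp only [map_smul]; rfl) }
  comp_lin k b := by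
    classical
    refine Subtype.ext (funext fun h => funext fun g => ?_)
    refine Eq.trans ?_ (indBimComp_apply W k _ h g).symm
    change π (B.left h⁻¹ (B.comp g (B.comp k b))) = if g = k then π (B.left h⁻¹ (B.comp g b)) else 0
    rw [Bim.comp_comp]
    split_ifs with e
    · rw [e]
    · rw [map_zero, map_zero]
  left_lin a b := by
    refine Subtype.ext (funext fun h => funext fun g => ?_)
    change π (B.left h⁻¹ (B.comp g (B.left a b))) =
      π (B.left (a⁻¹ * h)⁻¹ (B.comp ((a : G)⁻¹ * g) b))
    rw [B.comp_left, ← Module.End.mul_apply, ← map_mul, mul_inv_rev, inv_inv]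
  right_lin k b := by
    refine Subtype.ext (funext fun h => funext fun g => ?_)
    change π (B.left h⁻¹ (B.comp g (B.right k b))) =
      π (B.left h⁻¹ (B.comp (g * (k.unop : G)⁻¹) b))
    have := B.comp_right k.unop g b
    rw [MulOpposite.op_unop] at this
    rw [this, B.left_right, hr]

/-- Invariance of `π` turns the `k`-th term into `π` of the component of `hb` of degree `h g k⁻¹`.
As `k` varies these degrees sweep out the coset `hgH`, and `π` sees only `dH`, so the sum is all of
`π(hb)` or nothing. -/
theorem sum_proj_right {B : Bim H} {A : Type} [AddCommGroup A] [Module ℂ A] {π : B →ₗ[ℂ] A}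
    (h0 : ∀ g, d⁻¹ * g ∉ H → ∀ b, π (B.comp g b) = 0)
    (hr : ∀ k b, π (B.right k b) = π b) (h : H) (g : G) (b : B)
    [Decidable (d⁻¹ * ((h : G) * g) ∈ H)] :
    ∑ k : H, π (B.left h (B.comp g (B.right (MulOpposite.op k) b))) =
      if d⁻¹ * ((h : G) * g) ∈ H then π (B.left h b) else 0 := by
  classical
  have e : ∀ k : H, π (B.left h (B.comp g (B.right (MulOpposite.op k) b))) =
      π (B.comp (h * g * (k : G)⁻¹) (B.left h b)) := by
    intro k
    rw [B.comp_right, B.left_right, hr, B.comp_left]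
    congr 3
    group
  simp only [e]
  rw [sum_subgroup H fun x => π (B.comp (h * g * x⁻¹) (B.left h b))]
  split_ifs with hg
  · conv_rhs => rw [← B.sum_comp (B.left h b), map_sum]
    refine Fintype.sum_equiv ((Equiv.inv G).trans (Equiv.mulLeft (h * g))) _ _ fun x => ?_
    simp only [Equiv.trans_apply, Equiv.inv_apply, Equiv.coe_mulLeft]
    split_ifs with hx
    · rfl
    · refine (h0 _ (fun hm => hx ?_) _).symm
      have := H.mul_mem (H.inv_mem hm) hg
      have e : (d⁻¹ * (h * g * x⁻¹))⁻¹ * (d⁻¹ * (h * g)) = x := by group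
      rwa [e] at this
  · refine Finset.sum_eq_zero fun x _ => ?_
    split_ifs with hx
    · refine h0 _ (fun hm => hg ?_) _
      have := H.mul_mem hm hx
      have e : d⁻¹ * (h * g * x⁻¹) * x = d⁻¹ * (h * g) := by group
      rwa [e] at this
    · rfl

variable {ι : Type} [Finite ι] {d : ι → G} {B : Bim H} {W : ∀ p, FDRep ℂ (stab H (d p))}
  {π : ∀ p, B →ₗ[ℂ] W p}

theorem toIndBim_injective
    (h0 : ∀ p g, (d p)⁻¹ * g ∉ H → ∀ b, π p (B.comp g b) = 0)
    (hs : ∀ p s b, π p (B.left (stabIncl H (d p) s) b) = (W p).ρ s (π p b))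
    (hr : ∀ p k b, π p (B.right k b) = π p b)
    (hsep : ∀ b, (∀ p h g, π p (B.left h (B.comp g b)) = 0) → b = 0) :
    Function.Injective fun b p => (toIndBim B (W p) (π p) (h0 p) (hs p) (hr p)).lin b := by
  intro b b' hb
  rw [← sub_eq_zero]
  refine hsep _ fun p h g => ?_
  have := congrFun (congrFun (congrArg Subtype.val (congrFun hb p)) h⁻¹) g
  change π p (B.left h⁻¹⁻¹ (B.comp g b)) = π p (B.left h⁻¹⁻¹ (B.comp g b')) at this
  rw [inv_inv] at this
  rw [map_sub, map_sub, map_sub, this, sub_self]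

/-- A function `f` is rebuilt from its values: choose `b` for the value at `(h, g)`, translate it by
`h`, spread it over its right translates and keep degree `g`. The division by `|S|` corrects for
summing over `H` instead of `H/S`. -/
theorem toIndBim_surjective
    (h0 : ∀ p g, (d p)⁻¹ * g ∉ H → ∀ b, π p (B.comp g b) = 0)
    (hs : ∀ p s b, π p (B.left (stabIncl H (d p) s) b) = (W p).ρ s (π p b))
    (hr : ∀ p k b, π p (B.right k b) = π p b)
    (hex : ∀ p a, ∃ b, (∀ h, π p (B.left h b) = zeroExt (stabIncl H (d p)) (W p).ρ h a) ∧
      ∀ q, q ≠ p → ∀ h, π q (B.left h b) = 0) :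
    Function.Surjective fun b p => (toIndBim B (W p) (π p) (h0 p) (hs p) (hr p)).lin b := by
  classical
  have := Fintype.ofFinite ι
  intro f
  choose β hβ hβ' using hex
  -- The contribution of the single value `f_p(h, g)` to the preimage, concentrated in degree `g`.
  obtain ⟨v, hv⟩ : ∃ v : ι → H → G → B, ∀ p h g, v p h g = B.comp g
    (∑ k : H, B.right (MulOpposite.op k) (B.left h (β p ((f p).1 h g)))) :=
    ⟨_, fun _ _ _ => rfl⟩
  refine ⟨∑ p, (Fintype.card (stab H (d p)) : ℂ)⁻¹ • ∑ h : H, ∑ g, v p h g, ?_⟩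
  funext q
  refine Subtype.ext (funext fun h => funext fun g => ?_)
  -- Only `g' = g` contributes, and there `sum_proj_right` evaluates the sum over right translates.
  have key : ∀ p (h' : H) g', π q (B.left h⁻¹ (B.comp g (v p h' g'))) =
      if g = g' then if (d q)⁻¹ * (((h⁻¹ : H) : G) * g) ∈ H then
        π q (B.left (h⁻¹ * h') (β p ((f p).1 h' g'))) else 0 else 0 := by
    intro p h' g'
    rw [hv, Bim.comp_comp]
    by_cases e : g = g'
    · rw [if_pos e, if_pos e, ← e, map_sum, map_sum, map_sum, sum_proj_right (h0 q) (hr q)]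
      rw [map_mul, Module.End.mul_apply]
    · rw [if_neg e, if_neg e, map_zero, map_zero]
  change π q (B.left h⁻¹ (B.comp g _)) = (f q).1 h g
  simp only [map_sum, map_smul, key, Finset.sum_ite_eq, Finset.mem_univ, if_true]
  by_cases hg : (d q)⁻¹ * (((h⁻¹ : H) : G) * g) ∈ H
  · simp only [if_pos hg]
    rw [Finset.sum_eq_single q]
    · refine Eq.trans ?_ (card_inv_smul_sum (X := stab H (d q)) _)
      congr 1
      simp only [hβ, zeroExt_apply]
      rw [Finset.sum_comm]
      refine Finset.sum_congr rfl fun s _ => ?_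
      -- The orbit of the chosen element is zero off `S`, so only `h' = hs` counts; there `f(hs, g)
      -- = s⁻¹ f(h, g)`, and each `s` returns `f(h, g)`.
      rw [Finset.sum_eq_single (h * stabIncl H (d q) s)]
      · rw [if_pos (by simp), (f q).2.2, ← Module.End.mul_apply, ← map_mul, mul_inv_cancel,
          map_one]
        rfl
      · intro h' _ hh
        exact if_neg fun e => hh (by rw [e, mul_inv_cancel_left])
      · simp
    · intro p _ hp
      simp only [hβ' p _ q hp.symm, Finset.sum_const_zero, smul_zero]
    · simp
  · simp only [if_neg hg, Finset.sum_const_zero, smul_zero]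
    refine ((f q).2.1 h g fun hm => hg ?_).symm
    rwa [InvMemClass.coe_inv, ← mul_assoc]

end ToIndBim

/-! ### Bijective morphisms and morphisms to direct sums -/

/-- A bijective morphism of bimodules is an isomorphism. -/
def Bim.isoOfBijective {H : Subgroup G} {M N : Bim H} (f : M ⟶ N)
    (hf : Function.Bijective f.lin) : M ≅ N :=
  Bim.isoOf f (LinearEquiv.ofBijective f.lin hf).symm.toLinearMap
    (LinearEquiv.ofBijective f.lin hf).symm_apply_apply
    (LinearEquiv.ofBijective f.lin hf).apply_symm_apply

/-- A family of morphisms as a morphism to the direct sum. -/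
def Bim.toDirectSum {H : Subgroup G} {ι : Type} [Finite ι] {M : Bim H} {N : ι → Bim H}
    (f : ∀ i, M ⟶ N i) : M ⟶ Bim.directSum N where
  lin := LinearMap.pi fun i => (f i).lin
  comp_lin _ _ := funext fun i => (f i).comp_lin _ _
  left_lin _ _ := funext fun i => (f i).left_lin _ _
  right_lin _ _ := funext fun i => (f i).right_lin _ _

/-- A bijective morphism of Yetter-Drinfeld modules is an isomorphism. -/
def YD.isoOfBijective {M N : YD G} (f : M ⟶ N) (hf : Function.Bijective f.lin) : M ≅ N where
  hom := f
  inv :=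
    { lin := (LinearEquiv.ofBijective f.lin hf).symm.toLinearMap
      comp_lin := fun g v => hf.1 (by
        have h := (LinearEquiv.ofBijective f.lin hf).apply_symm_apply
        rw [f.comp_lin]
        exact (h _).trans (congrArg _ (h v).symm))
      act_lin := fun x v => hf.1 (by
        have h := (LinearEquiv.ofBijective f.lin hf).apply_symm_apply
        rw [f.act_lin]
        exact (h _).trans (congrArg _ (h v).symm)) }
  hom_inv_id := YD.hom_ext (LinearEquiv.ofBijective f.lin hf).symm_apply_apply
  inv_hom_id := YD.hom_ext (LinearEquiv.ofBijective f.lin hf).apply_symm_apply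

/-- A family of morphisms as a morphism to the direct sum. -/
def YD.toDirectSum {ι : Type} [Finite ι] {M : YD G} {N : ι → YD G}
    (f : ∀ i, M ⟶ N i) : M ⟶ YD.directSum N where
  lin := LinearMap.pi fun i => (f i).lin
  comp_lin _ _ := funext fun i => (f i).comp_lin _ _
  act_lin _ _ := funext fun i => (f i).act_lin _ _

/-! ### Recognising direct sums of induced Yetter-Drinfeld modules -/

section ToIndYD

/-- The vector `l b_g` has degree `l g l⁻¹`, so `π` kills it unless `l⁻¹ y l = g`, which is
precisely the degree of the corresponding class in `Ind_y(A)`. -/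
theorem indInto_comp {y : G} (B : YD G) (A : FDRep ℂ (cent y)) (π : B →ₗ[ℂ] A)
    (h0 : ∀ g, g ≠ y → ∀ b, π (B.comp g b) = 0) (g : G) (b : B) :
    indInto (cent y).subtype A.ρ B.act π (B.comp g b) =
      indYDComp y A g (indInto (cent y).subtype A.ρ B.act π b) := by
  classical
  rw [indInto_apply, indInto_apply, map_smul, map_sum]
  congr 1
  refine Finset.sum_congr rfl fun l _ => ?_
  rw [indYDComp_mk, ← B.comp_act]
  split_ifs with e
  · congr 1
    have e' : l * g * l⁻¹ = y := by rw [← e]; group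
    conv_rhs => rw [← B.sum_comp (B.act l b), map_sum]
    rw [Finset.sum_eq_single y, e']
    · exact fun k _ hk => h0 k hk _
    · simp
  · rw [h0, map_zero]
    intro e'
    exact e (by rw [← e']; group)

/-- The morphism to `Ind_y(A)` corresponding to a linear map `π` to `A` vanishing in degrees other
than `y`. -/
def toIndYD {y : G} (B : YD G) (A : FDRep ℂ (cent y)) (π : B →ₗ[ℂ] A)
    (h0 : ∀ g, g ≠ y → ∀ b, π (B.comp g b) = 0) : B ⟶ indYD y A where
  lin := indInto (cent y).subtype A.ρ B.act π
  comp_lin g b := indInto_comp B A π h0 g b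
  act_lin x b := indInto_act _ _ _ _ _ _

variable {ι : Type} [Finite ι] {y : ι → G} {B : YD G} {A : ∀ p, FDRep ℂ (cent (y p))}
  {π : ∀ p, B →ₗ[ℂ] A p}

/-- Evaluation of the translate by `x` of the image of `b` recovers `π(xb)`, by `indEval_indInto`;
equality of images therefore forces the separating data to agree. -/
theorem toIndYD_injective (h0 : ∀ p g, g ≠ y p → ∀ b, π p (B.comp g b) = 0)
    (hs : ∀ p s b, π p (B.act ((cent (y p)).subtype s) b) = (A p).ρ s (π p b))
    (hsep : ∀ b, (∀ p x, π p (B.act x b) = 0) → b = 0) :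
    Function.Injective fun b p => (toIndYD B (A p) (π p) (h0 p)).lin b := by
  intro b b' hb
  rw [← sub_eq_zero]
  refine hsep _ fun p x => ?_
  have := congrArg (indEval (cent (y p)).subtype (A p).ρ)
    (congrArg (Representation.ind (cent (y p)).subtype (A p).ρ x) (congrFun hb p))
  change indEval _ _ (Representation.ind _ _ x (indInto _ _ _ _ b)) =
    indEval _ _ (Representation.ind _ _ x (indInto _ _ _ _ b')) at this
  rw [← indInto_act, ← indInto_act, indEval_indInto (hs p), indEval_indInto (hs p)] at this
  rw [map_sub, map_sub, this, sub_self]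

theorem toIndYD_surjective (h0 : ∀ p g, g ≠ y p → ∀ b, π p (B.comp g b) = 0)
    (hex : ∀ p a, ∃ b, (∀ x, π p (B.act x b) = zeroExt (cent (y p)).subtype (A p).ρ x a) ∧
      ∀ q, q ≠ p → ∀ x, π q (B.act x b) = 0) :
    Function.Surjective fun b p => (toIndYD B (A p) (π p) (h0 p)).lin b := by
  classical
  have := Fintype.ofFinite ι
  -- Preimages are found one summand at a time, with zero components in the other summands, so that
  -- they can be added up.
  have single : ∀ p (w : indYD (y p) (A p)), ∃ b,
      (toIndYD B (A p) (π p) (h0 p)).lin b = w ∧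
        ∀ q, q ≠ p → (toIndYD B (A q) (π q) (h0 q)).lin b = 0 := by
    intro p
    refine indV_induction ⟨0, map_zero _, fun _ _ => map_zero _⟩ (fun a => ?_) ?_ ?_
    · obtain ⟨b, hb, hb'⟩ := hex p a
      refine ⟨b, indInto_of_zeroExt _ _ _ _ _ _ hb, fun q hq => ?_⟩
      refine (indInto_apply _ _ _ _ _).trans ?_
      simp only [hb' q hq, map_zero, Finset.sum_const_zero, smul_zero]
      rfl
    · rintro v w ⟨b, rfl, hb⟩ ⟨b', rfl, hb'⟩
      exact ⟨b + b', map_add _ _ _, fun q hq => by rw [map_add, hb q hq, hb' q hq, add_zero]⟩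
    · rintro x v ⟨b, rfl, hb⟩
      exact ⟨B.act x b, (toIndYD B (A p) (π p) (h0 p)).act_lin x b, fun q hq => by
        rw [(toIndYD B (A q) (π q) (h0 q)).act_lin x b, hb q hq, map_zero]⟩
  intro f
  choose b hb hb' using fun p => single p (f p)
  refine ⟨∑ p, b p, funext fun q => ?_⟩
  beta_reduce
  rw [map_sum, Finset.sum_eq_single q, hb]
  · exact fun p _ hp => hb' p q hp.symm
  · simp

end ToIndYD

/-! ### The equivalence between `Rep(Stab_H(dH))` and the bimodules supported on `HdH` -/

section Fiber

variable {H : Subgroup G} (d : G)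

open Classical in
/-- The projection of a bimodule onto `M_{dH}`. -/
def cosetProj (M : Bim H) : M →ₗ[ℂ] cosetPiece d M :=
  LinearMap.codRestrict _ (∑ g, if d⁻¹ * g ∈ H then M.comp g else 0) (fun v g hg => by
    rw [LinearMap.sum_apply, map_sum]
    refine Finset.sum_eq_zero fun k _ => ?_
    split_ifs with hk
    · exact M.comp_ne g k (fun e => hg (e ▸ hk)) v
    · exact map_zero _)

theorem cosetProj_coe [DecidablePred (· ∈ H)] (M : Bim H) (v : M) :
    (cosetProj d M v : M) = ∑ g, if d⁻¹ * g ∈ H then M.comp g v else 0 := by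
  change (∑ g, _ : M →ₗ[ℂ] M) v = _
  rw [LinearMap.sum_apply]
  refine Finset.sum_congr rfl fun g _ => ?_
  by_cases hg : d⁻¹ * g ∈ H
  · rw [if_pos hg, if_pos hg]
  · rw [if_neg hg, if_neg hg]; rfl

theorem cosetProj_self {M : Bim H} (v : cosetPiece d M) : cosetProj d M v = v := by
  classical
  refine Subtype.ext ?_
  rw [cosetProj_coe]
  conv_rhs => rw [← M.sum_comp v]
  refine Finset.sum_congr rfl fun g _ => ?_
  split_ifs with hg
  · rfl
  · exact (v.2 g hg).symm

theorem comp_cosetProj {M : Bim H} {g : G} [Decidable (d⁻¹ * g ∈ H)] (v : M) :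
    M.comp g (cosetProj d M v) = if d⁻¹ * g ∈ H then M.comp g v else 0 := by
  classical
  split_ifs with hg
  · rw [cosetProj_coe, map_sum, Finset.sum_eq_single g, if_pos hg, M.comp_self]
    · intro k _ hk
      split_ifs
      · exact M.comp_ne g k hk.symm v
      · exact map_zero _
    · simp
  · exact (cosetProj d M v).2 g hg

theorem GrVect.ext_comp (M : GrVect G) {v w : M} (h : ∀ g, M.comp g v = M.comp g w) : v = w := by
  rw [← M.sum_comp v, ← M.sum_comp w]
  exact Finset.sum_congr rfl fun g _ => h g

variable {d} in
-- Left multiplication by `s` permutes `dH`, because `d⁻¹ s d` lies in `H`.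
theorem stab_mem_iff (s : stab H d) (g : G) : d⁻¹ * ((s : G)⁻¹ * g) ∈ H ↔ d⁻¹ * g ∈ H := by
  rw [← H.mul_mem_cancel_left (conj_stab_mem s)]
  have e : d⁻¹ * (s : G) * d * (d⁻¹ * ((s : G)⁻¹ * g)) = d⁻¹ * g := by group
  rw [e]

theorem cosetProj_left {M : Bim H} (s : stab H d) (v : M) :
    cosetProj d M (M.left (stabIncl H d s) v) = cosetLeft d M s (cosetProj d M v) := by
  classical
  refine Subtype.ext (GrVect.ext_comp _ fun g => ?_)
  change _ = M.comp g (M.left (stabIncl H d s) (cosetProj d M v))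
  rw [comp_cosetProj, M.comp_left, M.comp_left, comp_cosetProj, stabIncl_coe]
  simp only [stab_mem_iff]
  split_ifs
  · rfl
  · exact (map_zero _).symm

theorem cosetProj_right {M : Bim H} (k : (H)ᵐᵒᵖ) (v : M) :
    cosetProj d M (M.right k v) = cosetRight d M k (cosetProj d M v) := by
  classical
  refine Subtype.ext (GrVect.ext_comp _ fun g => ?_)
  change _ = M.comp g (M.right k (cosetProj d M v))
  rw [← MulOpposite.op_unop k, comp_cosetProj, M.comp_right, M.comp_right, comp_cosetProj]
  have e : d⁻¹ * (g * (k.unop : G)⁻¹) ∈ H ↔ d⁻¹ * g ∈ H := by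
    rw [← mul_assoc, H.mul_mem_cancel_right (H.inv_mem k.unop.2)]
  simp only [e]
  split_ifs
  · rfl
  · exact (map_zero _).symm

/-- The projection `M → M_{dH} / H`. -/
def fiberProj (M : Bim H) : M →ₗ[ℂ] (fiber H d).obj M :=
  Representation.Coinvariants.mk (cosetRight d M) ∘ₗ cosetProj d M

theorem fiberProj_comp (M : Bim H) (g : G) (hg : d⁻¹ * g ∉ H) (v : M) :
    fiberProj d M (M.comp g v) = 0 := by
  classical
  have : cosetProj d M (M.comp g v) = 0 := Subtype.ext <| by
    rw [cosetProj_coe]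
    refine Finset.sum_eq_zero fun k _ => ?_
    split_ifs with hk
    · exact M.comp_ne k g (fun e => hg (e ▸ hk)) v
    · rfl
  exact (congrArg (Representation.Coinvariants.mk (cosetRight d M)) this).trans
    (map_zero (Representation.Coinvariants.mk (cosetRight d M)))

theorem fiberProj_left (M : Bim H) (s : stab H d) (v : M) :
    fiberProj d M (M.left (stabIncl H d s) v) = ((fiber H d).obj M).ρ s (fiberProj d M v) :=
  congrArg (Representation.Coinvariants.mk (cosetRight d M)) (cosetProj_left d s v)

theorem fiberProj_right (M : Bim H) (k : (H)ᵐᵒᵖ) (v : M) :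
    fiberProj d M (M.right k v) = fiberProj d M v :=
  (congrArg (Representation.Coinvariants.mk (cosetRight d M)) (cosetProj_right d k v)).trans
    (Representation.Coinvariants.mk_self_apply _ _ _)

theorem fiberProj_coe {M : Bim H} (v : cosetPiece d M) :
    fiberProj d M v = Representation.Coinvariants.mk (cosetRight d M) v :=
  congrArg (Representation.Coinvariants.mk (cosetRight d M)) (cosetProj_self d v)

theorem fiberProj_surjective {M : Bim H} (a : (fiber H d).obj M) :
    ∃ v : cosetPiece d M, fiberProj d M v = a := by
  obtain ⟨v, rfl⟩ := Representation.Coinvariants.mk_surjective _ a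
  exact ⟨v, fiberProj_coe d v⟩

/-! ### Identification of `M_{dH}/H` with `M_d` -/

/-- The map `v ↦ ∑ₖ (v k)_d`, which identifies `M_{dH} / H` with `M_d`. -/
def degProj (M : Bim H) : M →ₗ[ℂ] M := ∑ k : H, M.comp d ∘ₗ M.right (MulOpposite.op k)

theorem degProj_apply (M : Bim H) (v : M) :
    degProj d M v = ∑ k : H, M.comp d (M.right (MulOpposite.op k) v) := by
  rw [degProj, LinearMap.sum_apply]
  rfl

theorem degProj_right (M : Bim H) (k : (H)ᵐᵒᵖ) (v : M) :
    degProj d M (M.right k v) = degProj d M v := by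
  rw [degProj_apply, degProj_apply]
  refine Fintype.sum_equiv (Equiv.mulLeft k.unop) _ _ fun j => ?_
  exact congrArg (M.comp d) (LinearMap.congr_fun (map_mul M.right (MulOpposite.op j) k) v).symm

/-- Right translation permutes the terms of `degProj`, so this map factors through the coinvariants.
-/
theorem degProj_of_fiberProj_eq_zero {M : Bim H} {v : M} (hv : v ∈ cosetPiece d M)
    (h : fiberProj d M v = 0) : degProj d M v = 0 := by
  have e := fiberProj_coe d ⟨v, hv⟩
  let D : Representation.Coinvariants (cosetRight d M) →ₗ[ℂ] M :=
    Representation.Coinvariants.lift _ (degProj d M ∘ₗ (cosetPiece d M).subtype) (fun k => by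
      refine LinearMap.ext fun v => ?_
      exact degProj_right d M k v)
  exact (congrArg D (e.symm.trans h)).trans (map_zero D)

/-- Modulo the right action `(vk)_d` and `v_{dk⁻¹}` coincide, and the degrees `dk⁻¹` run through
`dH`. Thus every class is represented in degree `d`. -/
theorem fiberProj_degProj (M : Bim H) (v : M) :
    fiberProj d M (degProj d M v) = fiberProj d M v := by
  classical
  have e : ∀ k : H, fiberProj d M (M.comp d (M.right (MulOpposite.op k) v)) =
      fiberProj d M (M.comp (d * (k : G)⁻¹) v) := fun k => by
    rw [M.comp_right, fiberProj_right]
  rw [degProj_apply, map_sum]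
  simp only [e]
  rw [sum_subgroup H fun k => fiberProj d M (M.comp (d * k⁻¹) v)]
  conv_rhs => rw [← M.sum_comp v, map_sum]
  refine Fintype.sum_equiv ((Equiv.inv G).trans (Equiv.mulLeft d)) _ _ fun x => ?_
  simp only [Equiv.trans_apply, Equiv.inv_apply, Equiv.coe_mulLeft]
  split_ifs with hx
  · rfl
  · refine (fiberProj_comp d M _ (fun hm => hx ?_) _).symm
    simpa using hm

/-- Of all right translates of a vector of degree `dk`, only the one by `k⁻¹` has degree `d`. In
particular `degProj` is injective on each component with degree in `dH`. -/
theorem degProj_comp {M : Bim H} (k : H) (v : M) : degProj d M (M.comp (d * k) v) =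
    M.right (MulOpposite.op k⁻¹) (M.comp (d * k) v) := by
  rw [degProj_apply, Finset.sum_eq_single k⁻¹]
  · rw [M.comp_right]
    simp [M.comp_self]
  · intro j _ hj
    rw [M.comp_right, M.comp_ne, map_zero]
    intro e
    refine hj (inv_injective (Subtype.ext ?_))
    simpa using e
  · simp

variable {d}

/-- The canonical morphism from `M` to the bimodule induced from `M_{dH} / H`. -/
def toIndFiber (M : Bim H) : M ⟶ (indBim H d).obj ((fiber H d).obj M) :=
  toIndBim M _ (fiberProj d M) (fiberProj_comp d M) (fiberProj_left d M) (fiberProj_right d M)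

/-- The two criteria are applied to a family with one member. The support hypothesis serves only
injectivity, where each homogeneous component must be movable into `dH`. -/
theorem toIndFiber_bijective {M : Bim H} (hM : supportedOn H d M) :
    Function.Bijective (toIndFiber (d := d) M).lin := by
  have h0 := fun _ : Unit => fiberProj_comp d M
  have hs := fun _ : Unit => fiberProj_left d M
  have hr := fun _ : Unit => fiberProj_right d M
  constructor
  · intro v w hvw
    refine toIndBim_injective h0 hs hr (fun b hb => ?_) (funext fun _ => hvw)
    refine GrVect.ext_comp _ fun g => ?_
    rw [map_zero]
    by_cases hg : g ∈ DoubleCoset.doubleCoset d (H : Set G) (H : Set G)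
    · obtain ⟨h, hh, k, hk, rfl⟩ := DoubleCoset.mem_doubleCoset.1 hg
      have hu := hb () ⟨h, hh⟩⁻¹ (h * d * k)
      have e : M.left ⟨h, hh⟩⁻¹ (M.comp (h * d * k) b) =
          M.comp (d * (⟨k, hk⟩ : H)) (M.left ⟨h, hh⟩⁻¹ b) := by
        rw [M.comp_left]
        simp [mul_assoc]
      -- After translation by `h⁻¹` the component has degree `dk` and zero class; on it `degProj` is
      -- right translation by `k⁻¹`, which is invertible.
      have hz : M.comp (d * (⟨k, hk⟩ : H)) (M.left ⟨h, hh⟩⁻¹ b) = 0 := by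
        rw [e] at hu
        have := degProj_of_fiberProj_eq_zero d (fun g hg => M.comp_ne _ _ (fun e => hg (by
          rw [e]; simpa using hk)) _) hu
        rw [degProj_comp] at this
        have := congrArg (M.right (MulOpposite.op ⟨k, hk⟩)) this
        rw [← Module.End.mul_apply, ← map_mul, map_zero, ← MulOpposite.op_mul, inv_mul_cancel,
          MulOpposite.op_one, map_one] at this
        exact this
      have := congrArg (M.left ⟨h, hh⟩) (e.trans hz)
      rw [← Module.End.mul_apply, ← map_mul, map_zero, mul_inv_cancel, map_one] at this
      exact this
    · exact hM g hg b
  · intro f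
    obtain ⟨b, hb⟩ := toIndBim_surjective h0 hs hr (fun _ a => by
      obtain ⟨v, rfl⟩ := fiberProj_surjective d a
      refine ⟨v, fun h => ?_, fun q hq => absurd (Subsingleton.elim _ _) hq⟩
      by_cases hh : d⁻¹ * (h : G) * d ∈ H
      · obtain ⟨s, rfl⟩ := exists_stabIncl hh
        rw [zeroExt_of_mem stabIncl_injective, fiberProj_left]
      · rw [zeroExt_of_notMem]
        · rw [← M.sum_comp (M.left h v), map_sum]
          -- For `v` in `M_{dH}` the degrees of `hv` lie in `hdH`, which is disjoint from `dH` when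
          -- `h` is not in the stabilizer.
          refine Finset.sum_eq_zero fun g _ => ?_
          by_cases hg : d⁻¹ * g ∈ H
          · rw [M.comp_left, v.2, map_zero, map_zero]
            intro hm
            apply hh
            have := H.mul_mem hg (H.inv_mem hm)
            have e : d⁻¹ * g * (d⁻¹ * ((h : G)⁻¹ * g))⁻¹ = d⁻¹ * (h : G) * d := by group
            rwa [e] at this
          · exact fiberProj_comp d M g hg _
        · rintro s rfl
          exact hh (conj_stab_mem s)) fun _ => f
    exact ⟨b, congrFun hb ()⟩

/-! ### The fibre of an induced bimodule -/

theorem supportedOn_indBim (W : FDRep ℂ (stab H d)) : supportedOn H d ((indBim H d).obj W) := by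
  classical
  intro g hg f
  refine Subtype.ext (funext fun h => funext fun k => ?_)
  refine (indBimComp_apply W g f h k).trans ?_
  split_ifs with e
  · subst e
    refine f.2.1 h k fun hm => hg (DoubleCoset.mem_doubleCoset.2 ⟨h, h.2, _, hm, ?_⟩)
    group
  · rfl

/-- The map `f ↦ ∑_g f(1, g)`. -/
def indBimEval (W : FDRep ℂ (stab H d)) : indBimSub H d W →ₗ[ℂ] W where
  toFun f := ∑ g, f.1 1 g
  map_add' a b := by rw [← Finset.sum_add_distrib]; rfl
  map_smul' c a := by rw [RingHom.id_apply, Finset.smul_sum]; rfl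

theorem indBimEval_right (W : FDRep ℂ (stab H d)) (k : (H)ᵐᵒᵖ) (f : indBimSub H d W) :
    indBimEval W (indBimRight W k f) = indBimEval W f :=
  Fintype.sum_equiv (Equiv.mulRight (k.unop : G)⁻¹) _ _ fun _ => rfl

theorem indBimEval_left (W : FDRep ℂ (stab H d)) (s : stab H d) (f : indBimSub H d W) :
    indBimEval W (indBimLeft W (stabIncl H d s) f) = W.ρ s (indBimEval W f) := by
  refine Eq.trans ?_ (map_sum (W.ρ s) _ _).symm
  refine Fintype.sum_equiv (Equiv.mulLeft (s : G)⁻¹) _ _ fun g => ?_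
  rw [indBimLeft_apply]
  have := f.2.2 1 s⁻¹ ((s : G)⁻¹ * g)
  rw [one_mul, inv_inv] at this
  rw [mul_one, ← map_inv]
  exact this

/-- The map `Ind_d(W)_{dH} / H → W`. -/
def fiberInd (W : FDRep ℂ (stab H d)) :
    Representation.Coinvariants (cosetRight d (indBimObj W)) →ₗ[ℂ] W :=
  Representation.Coinvariants.lift _
    (indBimEval W ∘ₗ (cosetPiece d (indBimObj W)).subtype)
    (fun k => LinearMap.ext fun f => indBimEval_right W k f.1)

theorem fiberInd_comm (W : FDRep ℂ (stab H d)) (s : stab H d)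
    (v : Representation.Coinvariants (cosetRight d (indBimObj W))) :
    fiberInd W (cosetQuot d (indBimObj W) s v) = W.ρ s (fiberInd W v) := by
  obtain ⟨v, rfl⟩ := Representation.Coinvariants.mk_surjective _ v
  exact indBimEval_left W s v.1

theorem indBimSub_sum_apply {X : Type} [Fintype X] (W : FDRep ℂ (stab H d))
    (F : X → indBimSub H d W) (h : H) (g : G) : (∑ x, F x).1 h g = ∑ x, (F x).1 h g := by
  rw [AddSubmonoidClass.coe_finsetSum, Finset.sum_apply, Finset.sum_apply]

/-- If `∑_g f(1, g) = 0` then `degProj` kills `f`, and by `fiberProj_degProj` the class of `f` is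
zero. -/
theorem fiberInd_injective (W : FDRep ℂ (stab H d)) : Function.Injective (fiberInd W) := by
  classical
  refine (injective_iff_map_eq_zero _).2 fun v hv => ?_
  obtain ⟨f, rfl⟩ := Representation.Coinvariants.mk_surjective _ v
  have hf : ∑ g, f.1.1 1 g = 0 := hv
  have hz : degProj d (indBimObj W) f.1 = 0 := by
    refine Subtype.ext (funext fun h => funext fun g => ?_)
    rw [degProj_apply]
    refine (indBimSub_sum_apply W _ h g).trans ?_
    have e : ∀ k : H, ((indBimObj W).comp d
        ((indBimObj W).right (MulOpposite.op k) f.1)).1 h g =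
        if g = d then f.1.1 h (g * (k : G)⁻¹) else 0 := fun k => indBimComp_apply W d _ h g
    simp only [e]
    split_ifs with hg
    · subst hg
      -- In degree `d` the value at `h` is the sum of `f(h, ·)` over `dH`. For `h` in the stabilizer
      -- it is `h⁻¹` applied to the vanishing sum at `1`; for other `h` the support condition makes
      -- each term zero.
      by_cases hh : g⁻¹ * (h : G) * g ∈ H
      · obtain ⟨s, rfl⟩ := exists_stabIncl hh
        have e' : ∀ k : H, f.1.1 (stabIncl H g s) (g * (k : G)⁻¹) =
            W.ρ s⁻¹ (f.1.1 1 (g * (k : G)⁻¹)) := fun k => by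
          rw [← f.1.2.2, one_mul]
        simp only [e']
        rw [← map_sum, sum_subgroup H fun x => f.1.1 1 (g * x⁻¹)]
        refine Eq.trans (congrArg _ (Eq.trans ?_ hf)) (map_zero _)
        refine Fintype.sum_equiv ((Equiv.inv G).trans (Equiv.mulLeft g)) _ _ fun x => ?_
        simp only [Equiv.trans_apply, Equiv.inv_apply, Equiv.coe_mulLeft]
        split_ifs with hx
        · rfl
        · exact (f.1.2.1 _ _ fun hm => hx (by simpa using hm)).symm
      · refine Finset.sum_eq_zero fun k _ => f.1.2.1 _ _ fun hm => hh ?_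
        have := H.inv_mem (H.mul_mem hm k.2)
        have e : (g⁻¹ * (h : G)⁻¹ * (g * (k : G)⁻¹) * k)⁻¹ = g⁻¹ * (h : G) * g := by group
        rwa [e] at this
    · exact Finset.sum_const_zero
  have := fiberProj_degProj d (indBimObj W) f.1
  rw [hz, map_zero, fiberProj_coe] at this
  exact this.symm

open Classical in
/-- The element of degree `d` of `Ind_d(W)` corresponding to `w`. -/
def indBimMk (W : FDRep ℂ (stab H d)) (w : W) : indBimSub H d W :=
  ⟨fun h g => if g = d then zeroExt (stabIncl H d) W.ρ h⁻¹ w else 0,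
    fun h g hg => by
      beta_reduce
      split_ifs with e
      · refine zeroExt_of_notMem _ (fun s e' => hg ?_) _
        have := conj_stab_mem s
        rw [← stabIncl_coe, e'] at this
        rwa [e]
      · rfl,
    fun h s g => by
      beta_reduce
      split_ifs
      · rw [mul_inv_rev, ← map_inv, zeroExt_mul_left]
      · exact (map_zero _).symm⟩

theorem fiberInd_surjective (W : FDRep ℂ (stab H d)) : Function.Surjective (fiberInd W) := by
  classical
  intro w
  -- The preimage is the copy of `w` in degree `d`.
  refine ⟨Representation.Coinvariants.mk _ ⟨indBimMk W w, fun g hg => ?_⟩, ?_⟩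
  · refine Subtype.ext (funext fun h => funext fun k => ?_)
    refine (indBimComp_apply W g _ h k).trans ?_
    split_ifs with e
    · subst e
      refine if_neg fun e => hg ?_
      rw [e, inv_mul_cancel]
      exact H.one_mem
    · rfl
  · change ∑ g, (indBimMk W w).1 1 g = w
    rw [Finset.sum_eq_single d]
    · refine (if_pos rfl).trans ?_
      have := zeroExt_of_mem (stabIncl_injective (H := H) (d := d)) W.ρ 1 w
      rwa [map_one, map_one, ← inv_one] at this
    · exact fun g _ hg => if_neg hg
    · simp

theorem fiberEquivalence_naturality {M N : Bim H} (f : M ⟶ N) :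
    f ≫ toIndFiber (d := d) N = toIndFiber M ≫ (indBim H d).map ((fiber H d).map f) := by
  refine Bim.hom_ext fun v => Subtype.ext (funext fun h => funext fun g => ?_)
  change fiberProj d N (N.left h⁻¹ (N.comp g (f.lin v))) =
    repLin ((fiber H d).map f) (fiberProj d M (M.left h⁻¹ (M.comp g v)))
  rw [← f.comp_lin, ← f.left_lin]
  refine congrArg (Representation.Coinvariants.mk _) (Subtype.ext (GrVect.ext_comp _ fun k => ?_))
  classical
  change _ = N.comp k (f.lin _)
  rw [comp_cosetProj, ← f.comp_lin, ← f.comp_lin]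
  change _ = f.lin (M.comp k (cosetProj d M (M.left h⁻¹ (M.comp g v))))
  rw [comp_cosetProj]
  split_ifs
  · rfl
  · exact (map_zero _).symm

/-- An intertwining bijection as an isomorphism of representations. -/
def repIso {K : Type} [Monoid K] {V W : FDRep ℂ K} (f : V →ₗ[ℂ] W)
    (hf : ∀ k v, f (V.ρ k v) = W.ρ k (f v)) (hb : Function.Bijective f) : V ≅ W :=
  Action.mkIso (LinearEquiv.toFGModuleCatIso (LinearEquiv.ofBijective f hb)) (fun k => by
    ext v
    exact hf k v)

variable (H d)

/-- `Ind_d` as an equivalence onto the bimodules supported on `HdH`. -/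
def fiberEquivalence : FDRep ℂ (stab H d) ≌ (supportedOn H d).FullSubcategory :=
  CategoryTheory.Equivalence.mk
    ((supportedOn H d).lift (indBim H d) supportedOn_indBim)
    ((supportedOn H d).ι ⋙ fiber H d)
    (NatIso.ofComponents (fun W => (repIso (V := (fiber H d).obj ((indBim H d).obj W))
      (fiberInd W) (fiberInd_comm W) ⟨fiberInd_injective W, fiberInd_surjective W⟩).symm)
      (fun {V W} φ => by
        rw [Iso.symm_hom, Iso.symm_hom, Iso.comp_inv_eq, Category.assoc, Iso.eq_inv_comp]
        ext v
        obtain ⟨v, rfl⟩ := Representation.Coinvariants.mk_surjective _ v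
        exact map_sum (repLin φ) _ _))
    (NatIso.ofComponents (fun M => ((supportedOn H d).isoMk
      (Bim.isoOfBijective (toIndFiber M.obj) (toIndFiber_bijective M.property))).symm)
      (fun {M N} f => by
        rw [Iso.symm_hom, Iso.symm_hom, Iso.comp_inv_eq, Category.assoc, Iso.eq_inv_comp]
        ext : 1
        exact (fiberEquivalence_naturality f.hom).symm))

end Fiber

/-! ### The half-braiding of `N ⊗ ℂH` -/

section HalfBraiding

variable {H : Subgroup G}

/-- The map `n ↦ n ⊗ b`. -/
def underlieIncl (N : YD G) (b : H) : N →ₗ[ℂ] underlieObj H N where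
  toFun n := underlieMk H N n b
  map_add' n n' := by
    classical
    refine funext fun k => ?_
    change (if k = b then n + n' else 0) = (if k = b then n else 0) + (if k = b then n' else 0)
    split_ifs <;> simp
  map_smul' c n := by
    classical
    refine funext fun k => ?_
    change (if k = b then c • n else 0) = c • (if k = b then n else 0)
    split_ifs <;> simp

/-- The coefficient of `· ⊗ k`. -/
def underlieAt (N : YD G) (k : H) : underlieObj H N →ₗ[ℂ] N :=
  (LinearMap.proj k : (H → N) →ₗ[ℂ] N)

theorem underlieObj_ext {N : YD G} {F F' : underlieObj H N}
    (h : ∀ k, underlieAt N k F = underlieAt N k F') : F = F' := funext h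

theorem underlieAt_incl (N : YD G) (b k : H) (n : N) [Decidable (k = b)] :
    underlieAt N k (underlieIncl N b n) = if k = b then n else 0 := by
  change underlieMk H N n b k = _
  unfold underlieMk
  split_ifs <;> rfl

theorem sum_underlieIncl (N : YD G) (F : underlieObj H N) :
    ∑ b : H, underlieIncl N b (underlieAt N b F) = F := by
  classical
  refine underlieObj_ext fun k => ?_
  simp only [map_sum, underlieAt_incl]
  simp

theorem underlie_ext {N : YD G} {P : Type} [AddCommGroup P] [Module ℂ P]
    {f g : underlieObj H N →ₗ[ℂ] P}
    (h : ∀ n b, f (underlieIncl N b n) = g (underlieIncl N b n)) : f = g := by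
  refine LinearMap.ext fun F => ?_
  rw [← sum_underlieIncl N F, map_sum, map_sum]
  exact Finset.sum_congr rfl fun b _ => h _ _

@[simp] theorem underlie_left (N : YD G) (a b : H) (n : N) :
    (underlieObj H N).left a (underlieIncl N b n) = underlieIncl N (a * b) (N.act a n) := by
  classical
  refine underlieObj_ext fun k => ?_
  change N.act a (underlieAt N (a⁻¹ * k) (underlieIncl N b n)) = _
  rw [underlieAt_incl, underlieAt_incl]
  simp only [inv_mul_eq_iff_eq_mul]
  split_ifs
  · rfl
  · exact map_zero _

@[simp] theorem underlie_right (N : YD G) (a : (H)ᵐᵒᵖ) (b : H) (n : N) :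
    (underlieObj H N).right a (underlieIncl N b n) = underlieIncl N (b * a.unop) n := by
  classical
  refine underlieObj_ext fun k => ?_
  change underlieAt N (k * a.unop⁻¹) (underlieIncl N b n) = _
  rw [underlieAt_incl, underlieAt_incl]
  simp only [mul_inv_eq_iff_eq_mul]

@[simp] theorem underlie_comp (N : YD G) (g : G) (b : H) (n : N) :
    (underlieObj H N).comp g (underlieIncl N b n) =
      underlieIncl N b (N.comp (g * (b : G)⁻¹) n) := by
  classical
  refine underlieObj_ext fun k => ?_
  change N.comp (g * (k : G)⁻¹) (underlieAt N k (underlieIncl N b n)) = _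
  rw [underlieAt_incl, underlieAt_incl]
  split_ifs with h
  · rw [h]
  · exact map_zero _

open Bim

/-- The bilinear map underlying the half-braiding of `N ⊗ ℂH`. -/
def braidLin (N : YD G) (X : Bim H) : X →ₗ[ℂ] underlieObj H N →ₗ[ℂ] tensor (underlieObj H N) X :=
  ∑ g : G, ∑ k : H, ((tm (underlieObj H N) X).compl₁₂
    (underlieIncl N 1 ∘ₗ N.act g ∘ₗ underlieAt N k)
    (X.right (MulOpposite.op k) ∘ₗ X.comp g)).flip

theorem braidLin_incl (N : YD G) (X : Bim H) (x : X) (n : N) (b : H) :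
    braidLin N X x (underlieIncl N b n) =
      ∑ g, tm (underlieObj H N) X (underlieIncl N 1 (N.act g n))
        (X.right (MulOpposite.op b) (X.comp g x)) := by
  classical
  simp only [braidLin, LinearMap.sum_apply]
  refine Finset.sum_congr rfl fun g _ => ?_
  rw [Finset.sum_eq_single b]
  · change tm (underlieObj H N) X (underlieIncl N 1 (N.act g (underlieAt N b (underlieIncl N b n))))
      (X.right (MulOpposite.op b) (X.comp g x)) = _
    rw [underlieAt_incl, if_pos rfl]
  · intro k _ hk
    change tm (underlieObj H N) X (underlieIncl N 1 (N.act g (underlieAt N k (underlieIncl N b n))))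
      (X.right (MulOpposite.op k) (X.comp g x)) = _
    rw [underlieAt_incl, if_neg hk]
    simp
  · simp

/-- Formulas for the half-braiding sum over all degrees; on a homogeneous vector this leaves one
term. -/
theorem sum_comp_comp {X : Bim H} {A : Type} [AddCommMonoid A] (F : G → X → A)
    (hF : ∀ g, F g 0 = 0) (a : G) (x : X) :
    ∑ g, F g (X.comp g (X.comp a x)) = F a (X.comp a x) := by
  rw [Finset.sum_eq_single a, X.comp_self]
  · intro g _ hg
    rw [X.comp_ne g a hg, hF]
  · simp

/-- The half-braiding morphism `X ⊗ (N ⊗ ℂH) → (N ⊗ ℂH) ⊗ X`. -/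
def braidHom (N : YD G) (X : Bim H) : tensor X (underlieObj H N) ⟶ tensor (underlieObj H N) X :=
  homOf (braidLin N X)
    (fun k x F => LinearMap.congr_fun (underlie_ext
      (f := braidLin N X (X.right (MulOpposite.op k) x))
      (g := (braidLin N X x).comp ((underlieObj H N).left k)) (fun n b => by
        rw [LinearMap.comp_apply, underlie_left, braidLin_incl, braidLin_incl]
        -- Balance over `ℂH`: `(xk)_g = x_{gk⁻¹} k`, while `g n = (gk⁻¹)(k n)`.
        refine Fintype.sum_equiv (Equiv.mulRight (k : G)⁻¹) _ _ fun g => ?_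
        rw [comp_right, rep_apply_apply, rep_apply_apply]
        simp)) F)
    (fun g x F => by
      have := LinearMap.congr_fun (underlie_ext
        (f := ∑ a : G, (braidLin N X (X.comp a x)).comp ((underlieObj H N).comp (a⁻¹ * g)))
        (g := ((tensor (underlieObj H N) X).comp g).comp (braidLin N X x)) (fun n b => by
          simp only [LinearMap.sum_apply, LinearMap.comp_apply, underlie_comp, braidLin_incl,
            map_sum, tensor_comp_tm]
          refine Finset.sum_congr rfl fun a _ => ?_
          rw [sum_comp_comp (fun k y => tm (underlieObj H N) X (underlieIncl N 1
            (N.act k (N.comp (a⁻¹ * g * (b : G)⁻¹) n))) (X.right (MulOpposite.op b) y))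
            (fun _ => by simp)]
          -- For `x` of degree `a` and `n` of degree `a⁻¹gb⁻¹`, the vector `an` has degree
          -- `gb⁻¹a⁻¹`, by the Yetter-Drinfeld condition.
          rw [Finset.sum_eq_single (g * (b : G)⁻¹ * a⁻¹)]
          · rw [comp_right, N.comp_act']
            congr 2
            · simp only [OneMemClass.coe_one, inv_one, mul_one]
              congr 3
              group
            · have : (g * (b : G)⁻¹ * a⁻¹)⁻¹ * g * (b : G)⁻¹ = a := by group
              rw [this, X.comp_self]
          · intro c _ hc
            rw [comp_right, X.comp_ne, map_zero, map_zero]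
            rintro rfl
            exact hc (by group)
          · simp)) F
      simpa using this)
    (fun h x F => LinearMap.congr_fun (underlie_ext
      (f := braidLin N X (X.left h x))
      (g := ((tensor (underlieObj H N) X).left h).comp (braidLin N X x)) (fun n b => by
        rw [LinearMap.comp_apply, braidLin_incl, braidLin_incl, map_sum]
        -- Here `(hx)_g = h x_{h⁻¹g}`; the factor `h` crosses the tensor sign, and `gn ⊗ h = h(h⁻¹gn
        -- ⊗ 1)`.
        refine Fintype.sum_equiv (Equiv.mulLeft (h : G)⁻¹) _ _ fun g => ?_
        rw [tensor_left_tm, underlie_left, comp_left, mul_one, rep_apply_apply,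
          ← X.left_right, ← tm_bal, underlie_right]
        simp)) F)
    (fun k x F => LinearMap.congr_fun (underlie_ext
      (f := (braidLin N X x).comp ((underlieObj H N).right k))
      (g := ((tensor (underlieObj H N) X).right k).comp (braidLin N X x)) (fun n b => by
        rw [LinearMap.comp_apply, LinearMap.comp_apply, underlie_right, braidLin_incl,
          braidLin_incl, map_sum]
        refine Finset.sum_congr rfl fun g _ => ?_
        rw [tensor_right_tm, rep_apply_apply]
        rfl)) F)

theorem braidHom_tm (N : YD G) (X : Bim H) (x : X) (n : N) (b : H) :
    (braidHom N X).lin (tm X (underlieObj H N) x (underlieIncl N b n)) =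
      ∑ g, tm (underlieObj H N) X (underlieIncl N 1 (N.act g n))
        (X.right (MulOpposite.op b) (X.comp g x)) := braidLin_incl N X x n b

/-- The bilinear map underlying the inverse of the half-braiding of `N ⊗ ℂH`. -/
def braidInvLin (N : YD G) (X : Bim H) :
    underlieObj H N →ₗ[ℂ] X →ₗ[ℂ] tensor X (underlieObj H N) :=
  ∑ g : G, ∑ k : H, ((tm X (underlieObj H N)).compl₁₂ (X.comp g ∘ₗ X.left k)
    (underlieIncl N 1 ∘ₗ N.act g⁻¹ ∘ₗ underlieAt N k)).flip

theorem braidInvLin_incl (N : YD G) (X : Bim H) (x : X) (n : N) (b : H) :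
    braidInvLin N X (underlieIncl N b n) x =
      ∑ g, tm X (underlieObj H N) (X.comp g (X.left b x))
        (underlieIncl N 1 (N.act g⁻¹ n)) := by
  classical
  simp only [braidInvLin, LinearMap.sum_apply]
  refine Finset.sum_congr rfl fun g _ => ?_
  rw [Finset.sum_eq_single b]
  · change tm X (underlieObj H N) (X.comp g (X.left b x))
      (underlieIncl N 1 (N.act g⁻¹ (underlieAt N b (underlieIncl N b n)))) = _
    rw [underlieAt_incl, if_pos rfl]
  · intro k _ hk
    change tm X (underlieObj H N) (X.comp g (X.left k x))
      (underlieIncl N 1 (N.act g⁻¹ (underlieAt N k (underlieIncl N b n)))) = _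
    rw [underlieAt_incl, if_neg hk]
    simp
  · simp

/-- The inverse of the half-braiding of `N ⊗ ℂH`. -/
def braidInv (N : YD G) (X : Bim H) :
    tensor (underlieObj H N) X →ₗ[ℂ] tensor X (underlieObj H N) :=
  tl (braidInvLin N X) (fun k F x => LinearMap.congr_fun (underlie_ext
    (f := ((braidInvLin N X).flip x).comp ((underlieObj H N).right (MulOpposite.op k)))
    (g := (braidInvLin N X).flip (X.left k x)) (fun n b => by
      rw [LinearMap.comp_apply, underlie_right, LinearMap.flip_apply, LinearMap.flip_apply,
        braidInvLin_incl, braidInvLin_incl, rep_apply_apply]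
      rfl)) F)

theorem braidInv_tm (N : YD G) (X : Bim H) (x : X) (n : N) (b : H) :
    braidInv N X (tm (underlieObj H N) X (underlieIncl N b n) x) =
      ∑ g, tm X (underlieObj H N) (X.comp g (X.left b x))
        (underlieIncl N 1 (N.act g⁻¹ n)) := braidInvLin_incl N X x n b

theorem tensor_underlie_ext {N : YD G} {X : Bim H} {P : Type} [AddCommGroup P] [Module ℂ P]
    {f g : tensor X (underlieObj H N) →ₗ[ℂ] P}
    (h : ∀ x n b, f (tm _ _ x (underlieIncl N b n)) = g (tm _ _ x (underlieIncl N b n))) :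
    f = g :=
  tensor_ext fun x F => LinearMap.congr_fun (underlie_ext
    (f := f.comp (tm X (underlieObj H N) x)) (g := g.comp (tm X (underlieObj H N) x))
    (fun n b => h x n b)) F

theorem underlie_tensor_ext {N : YD G} {X : Bim H} {P : Type} [AddCommGroup P] [Module ℂ P]
    {f g : tensor (underlieObj H N) X →ₗ[ℂ] P}
    (h : ∀ x n b, f (tm _ _ (underlieIncl N b n) x) = g (tm _ _ (underlieIncl N b n) x)) :
    f = g :=
  tensor_ext fun F x => LinearMap.congr_fun (underlie_ext
    (f := f.comp ((tm (underlieObj H N) X).flip x)) (g := g.comp ((tm (underlieObj H N) X).flip x))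
    (fun n b => h x n b)) F

theorem sum_tm_comp_left {X V : Bim H} (x : X) (v : V) : ∑ g, tm X V (X.comp g x) v = tm X V x v := by
  conv_rhs => rw [← X.sum_comp x]
  rw [map_sum, LinearMap.sum_apply]

theorem sum_tm_comp_right {X V : Bim H} (x : X) (v : V) :
    ∑ g, tm V X v (X.comp g x) = tm V X v x := by
  conv_rhs => rw [← X.sum_comp x]
  rw [map_sum]

theorem braidInv_braidHom (N : YD G) (X : Bim H) (v : tensor X (underlieObj H N)) :
    braidInv N X ((braidHom N X).lin v) = v :=
  LinearMap.congr_fun (tensor_underlie_ext (f := (braidInv N X).comp (braidHom N X).lin)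
    (g := LinearMap.id) (fun x n b => by
      rw [LinearMap.comp_apply, braidHom_tm, map_sum, LinearMap.id_apply, ← sum_tm_comp_left]
      refine Finset.sum_congr rfl fun g _ => ?_
      -- The vector `x_g b` has degree `gb`, so the inverse applies `(gb)⁻¹` to `gn`. This gives
      -- `b⁻¹n ⊗ 1`, and moving `b` across turns it into `n ⊗ b`.
      rw [braidInv_tm, Finset.sum_eq_single (g * b)]
      · rw [map_one, Module.End.one_apply, comp_right, mul_inv_cancel_right, X.comp_self, tm_bal,
          underlie_left, rep_apply_apply, rep_apply_apply]
        simp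
      · intro k _ hk
        rw [map_one, Module.End.one_apply, comp_right, X.comp_ne, map_zero, map_zero,
          LinearMap.zero_apply]
        intro e
        exact hk (by rw [← e]; group)
      · simp)) v

theorem braidHom_braidInv (N : YD G) (X : Bim H) (v : tensor (underlieObj H N) X) :
    (braidHom N X).lin (braidInv N X v) = v :=
  LinearMap.congr_fun (underlie_tensor_ext (f := (braidHom N X).lin.comp (braidInv N X))
    (g := LinearMap.id) (fun x n b => by
      rw [LinearMap.comp_apply, braidInv_tm, map_sum, LinearMap.id_apply]
      -- Since `n ⊗ b = (n ⊗ 1)b`, the factor `b` can be carried over to `x`, where it already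
      -- stands in the formula for the inverse.
      have e : underlieIncl N b n =
          (underlieObj H N).right (MulOpposite.op b) (underlieIncl N 1 n) := by simp
      rw [e, tm_bal, ← sum_tm_comp_right]
      refine Finset.sum_congr rfl fun g _ => ?_
      rw [braidHom_tm, sum_comp_comp (fun k y => tm (underlieObj H N) X (underlieIncl N 1
        (N.act k (N.act g⁻¹ n))) (X.right (MulOpposite.op 1) y)) (fun _ => by simp)]
      rw [rep_apply_apply]
      simp)) v

/-- The half-braiding of `N ⊗ ℂH`. -/
def underlieHalf (H : Subgroup G) (N : YD G) : RightHalfBraiding (underlieObj H N) where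
  c X := isoOf (braidHom N X) (braidInv N X) (braidInv_braidHom N X) (braidHom_braidInv N X)
  naturality {X Y} f := Hom.ext (tensor_underlie_ext fun x n b => by
    change (braidHom N Y).lin (tm Y (underlieObj H N) (f.lin x) (underlieIncl N b n)) =
      (tensorMap (𝟙 (underlieObj H N)) f).lin
        ((braidHom N X).lin (tm X (underlieObj H N) x (underlieIncl N b n)))
    rw [braidHom_tm, braidHom_tm, map_sum]
    refine Finset.sum_congr rfl fun g _ => ?_
    rw [tensorMap_tm, f.right_lin, f.comp_lin]
    rfl)
  monoidal X Y := Hom.ext (tensor_ext fun w F => LinearMap.congr_fun (underlie_ext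
    (f := (braidHom N (tensor X Y)).lin.comp (tm (tensor X Y) (underlieObj H N) w))
    (g := (assocHom X Y (underlieObj H N) ≫ tensorMap (𝟙 X) (braidHom N Y) ≫
        (assocIso X (underlieObj H N) Y).inv ≫ tensorMap (braidHom N X) (𝟙 Y) ≫
        assocHom (underlieObj H N) X Y).lin.comp (tm (tensor X Y) (underlieObj H N) w))
    (fun n b => LinearMap.congr_fun (tensor_ext
      (f := ((braidHom N (tensor X Y)).lin.comp
        ((tm (tensor X Y) (underlieObj H N)).flip (underlieIncl N b n))))
      (g := ((assocHom X Y (underlieObj H N) ≫ tensorMap (𝟙 X) (braidHom N Y) ≫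
        (assocIso X (underlieObj H N) Y).inv ≫ tensorMap (braidHom N X) (𝟙 Y) ≫
        assocHom (underlieObj H N) X Y).lin.comp
        ((tm (tensor X Y) (underlieObj H N)).flip (underlieIncl N b n))))
      (fun x y => by
        simp only [LinearMap.comp_apply, LinearMap.flip_apply, braidHom_tm, comp_lin', assocHom_tm,
          tensorMap_tm, map_sum, tensor_comp_tm, id_lin, LinearMap.id_apply, assocIso_inv_tm,
          LinearMap.sum_apply, tensor_right_tm]
        rw [Finset.sum_comm]
        conv_rhs => rw [Finset.sum_comm]
        refine Finset.sum_congr rfl fun a _ => ?_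
        -- Both sides sum over the degrees of `x` and `y`: with `a` the degree of `x` and `g` the
        -- total degree, `y` contributes `a⁻¹g`, and acting by `a⁻¹g` and then by `a` is acting by
        -- `g`.
        refine Fintype.sum_equiv (Equiv.mulLeft a⁻¹) _ _ fun g => ?_
        rw [rep_apply_apply]
        simp)) w)) F)

/-- The morphism induced by a morphism of Yetter-Drinfeld modules. -/
def underlieMap {N N' : YD G} (f : N ⟶ N') : underlieObj H N ⟶ underlieObj H N' :=
  (underlie H).map f

@[simp] theorem underlieMap_incl {N N' : YD G} (f : N ⟶ N') (n : N) (b : H) :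
    (underlieMap f).lin (underlieIncl N b n) = underlieIncl N' b (f.lin n) := by
  classical
  refine underlieObj_ext fun k => ?_
  change f.lin (underlieAt N k (underlieIncl N b n)) = _
  rw [underlieAt_incl, underlieAt_incl]
  split_ifs
  · rfl
  · exact map_zero _

variable (H) in
/-- The functor from Yetter-Drinfeld modules to the right center. -/
def toCenter : YD G ⥤ RightCenter (Bim H) where
  obj N := ⟨underlieObj H N, underlieHalf H N⟩
  map {N N'} f := ⟨underlieMap f, fun X => Hom.ext (tensor_underlie_ext fun x n b => by
    change (braidHom N' X).lin (tm X (underlieObj H N') x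
      ((underlieMap f).lin (underlieIncl N b n))) =
      (tensorMap (underlieMap f) (𝟙 X)).lin
        ((braidHom N X).lin (tm X (underlieObj H N) x (underlieIncl N b n)))
    rw [underlieMap_incl, braidHom_tm, braidHom_tm, map_sum]
    refine Finset.sum_congr rfl fun g _ => ?_
    rw [tensorMap_tm, underlieMap_incl, f.act_lin]
    rfl)⟩
  map_id _ := rfl
  map_comp _ _ := rfl

end HalfBraiding

/-! ### Free bimodules on one homogeneous generator -/

section Free

open Bim

variable {H : Subgroup G}

open Classical in
/-- The projection onto the component of degree `x` of the free bimodule. -/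
def freeComp (H : Subgroup G) (g x : G) : (H × H →₀ ℂ) →ₗ[ℂ] (H × H →₀ ℂ) :=
  Finsupp.linearCombination ℂ fun p : H × H =>
    if (p.1 : G) * g * p.2 = x then Finsupp.single p 1 else 0

theorem freeComp_single (g x : G) (p : H × H) [Decidable ((p.1 : G) * g * p.2 = x)] :
    freeComp H g x (Finsupp.single p 1) =
      if (p.1 : G) * g * p.2 = x then Finsupp.single p 1 else 0 := by
  rw [freeComp, Finsupp.linearCombination_single, one_smul]
  split_ifs <;> rfl

theorem finsupp_ext {X P : Type} [AddCommGroup P] [Module ℂ P] {f g : (X →₀ ℂ) →ₗ[ℂ] P}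
    (h : ∀ p, f (Finsupp.single p 1) = g (Finsupp.single p 1)) : f = g :=
  Finsupp.lhom_ext' fun p => LinearMap.ext_ring (h p)

/-- The free bimodule `ℂH ⊗ ℂg ⊗ ℂH` on a generator of degree `g`. -/
def freeBim (H : Subgroup G) (g : G) : Bim H where
  carrier := H × H →₀ ℂ
  comp := freeComp H g
  comp_self x v := LinearMap.congr_fun (finsupp_ext (f := freeComp H g x ∘ₗ freeComp H g x)
    (g := freeComp H g x) fun p => by
      classical
      rw [LinearMap.comp_apply, freeComp_single]
      split_ifs with h
      · rw [freeComp_single, if_pos h]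
      · exact map_zero _) v
  comp_ne x y hxy v := LinearMap.congr_fun (finsupp_ext (f := freeComp H g x ∘ₗ freeComp H g y)
    (g := 0) fun p => by
      classical
      rw [LinearMap.comp_apply, freeComp_single]
      split_ifs with h
      · rw [freeComp_single, if_neg (by rw [h]; exact hxy.symm)]
        rfl
      · exact map_zero _) v
  sum_comp v := by
    classical
    have := LinearMap.congr_fun (finsupp_ext (f := ∑ x, freeComp H g x) (g := LinearMap.id)
      fun p => by
        rw [LinearMap.sum_apply, Finset.sum_eq_single ((p.1 : G) * g * p.2)]
        · rw [freeComp_single, if_pos rfl]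
          rfl
        · intro x _ hx
          rw [freeComp_single, if_neg hx.symm]
        · simp) v
    rwa [LinearMap.sum_apply] at this
  left :=
    { toFun := fun a => Finsupp.lmapDomain ℂ ℂ fun p => (a * p.1, p.2)
      map_one' := finsupp_ext fun p => by simp
      map_mul' := fun a b => finsupp_ext fun p => by simp [mul_assoc] }
  right :=
    { toFun := fun b => Finsupp.lmapDomain ℂ ℂ fun p => (p.1, p.2 * b.unop)
      map_one' := finsupp_ext fun p => by simp
      map_mul' := fun a b => finsupp_ext fun p => by simp [mul_assoc] }
  left_right a b v := LinearMap.congr_fun (finsupp_ext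
    (f := (Finsupp.lmapDomain ℂ ℂ fun p : H × H => (a * p.1, p.2)) ∘ₗ
      (Finsupp.lmapDomain ℂ ℂ fun p : H × H => (p.1, p.2 * b.unop)))
    (g := (Finsupp.lmapDomain ℂ ℂ fun p : H × H => (p.1, p.2 * b.unop)) ∘ₗ
      (Finsupp.lmapDomain ℂ ℂ fun p : H × H => (a * p.1, p.2))) fun p => by simp) v
  comp_act a b x v := LinearMap.congr_fun (finsupp_ext
    (f := freeComp H g (a * x * b) ∘ₗ (Finsupp.lmapDomain ℂ ℂ fun p : H × H => (a * p.1, p.2)) ∘ₗ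
      (Finsupp.lmapDomain ℂ ℂ fun p : H × H => (p.1, p.2 * b)))
    (g := (Finsupp.lmapDomain ℂ ℂ fun p : H × H => (a * p.1, p.2)) ∘ₗ
      (Finsupp.lmapDomain ℂ ℂ fun p : H × H => (p.1, p.2 * b)) ∘ₗ freeComp H g x) fun p => by
      classical
      have h : ((a * p.1 : H) : G) * g * (p.2 * b : H) = a * x * b ↔ (p.1 : G) * g * p.2 = x := by
        push_cast
        rw [← mul_assoc, mul_left_inj, mul_assoc, mul_assoc, mul_right_inj, mul_assoc]
      simp only [LinearMap.comp_apply, Finsupp.lmapDomain_apply, Finsupp.mapDomain_single,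
        freeComp_single, h]
      split_ifs
      · simp
      · simp) v

/-- The basis element `a ⊗ g ⊗ b` of the free bimodule. -/
def freeMk (g : G) (a b : H) : freeBim H g := (Finsupp.single (a, b) 1 : H × H →₀ ℂ)

theorem free_ext {g : G} {P : Type} [AddCommGroup P] [Module ℂ P] {f f' : freeBim H g →ₗ[ℂ] P}
    (h : ∀ a b, f (freeMk g a b) = f' (freeMk g a b)) : f = f' :=
  finsupp_ext fun p => h p.1 p.2

@[simp] theorem free_left (g : G) (c a b : H) :
    (freeBim H g).left c (freeMk g a b) = freeMk g (c * a) b :=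
  Finsupp.mapDomain_single

@[simp] theorem free_right (g : G) (c : (H)ᵐᵒᵖ) (a b : H) :
    (freeBim H g).right c (freeMk g a b) = freeMk g a (b * c.unop) :=
  Finsupp.mapDomain_single

theorem free_comp (g x : G) (a b : H) [Decidable ((a : G) * g * b = x)] :
    (freeBim H g).comp x (freeMk g a b) = if (a : G) * g * b = x then freeMk g a b else 0 :=
  freeComp_single g x (a, b)

theorem free_comp_one (g : G) : (freeBim H g).comp g (freeMk g 1 1) = freeMk g 1 1 := by
  classical
  rw [free_comp, if_pos (by simp)]

/-- The linear map out of a free bimodule with given values on the basis. -/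
def freeLift (g : G) {P : Type} [AddCommGroup P] [Module ℂ P] (F : H → H → P) :
    freeBim H g →ₗ[ℂ] P :=
  (Finsupp.linearCombination ℂ fun p : H × H => F p.1 p.2 : (H × H →₀ ℂ) →ₗ[ℂ] P)

@[simp] theorem freeLift_mk (g : G) {P : Type} [AddCommGroup P] [Module ℂ P] (F : H → H → P)
    (a b : H) : freeLift g F (freeMk g a b) = F a b :=
  (Finsupp.linearCombination_single ℂ 1 (a, b)).trans (one_smul ℂ _)

/-- The morphism out of a free bimodule corresponding to a homogeneous element. -/
def freeHom {X : Bim H} {g : G} (x : X) (hx : X.comp g x = x) : freeBim H g ⟶ X where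
  lin := freeLift g fun a b => X.left a (X.right (MulOpposite.op b) x)
  comp_lin y v := LinearMap.congr_fun (free_ext
    (f := (freeLift g fun a b => X.left a (X.right (MulOpposite.op b) x)).comp
      ((freeBim H g).comp y))
    (f' := (X.comp y).comp (freeLift g fun a b => X.left a (X.right (MulOpposite.op b) x)))
    fun a b => by
      classical
      rw [LinearMap.comp_apply, LinearMap.comp_apply, free_comp, freeLift_mk, X.comp_left,
        X.comp_right, ← hx, comp_comp, hx]
      have h : (a : G) * g * b = y ↔ (a : G)⁻¹ * y * (b : G)⁻¹ = g := by
        constructor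
        · rintro rfl; group
        · rintro rfl; group
      simp only [h]
      split_ifs
      · simp
      · simp) v
  left_lin c v := LinearMap.congr_fun (free_ext
    (f := (freeLift g fun a b => X.left a (X.right (MulOpposite.op b) x)).comp
      ((freeBim H g).left c))
    (f' := (X.left c).comp (freeLift g fun a b => X.left a (X.right (MulOpposite.op b) x)))
    fun a b => by simp) v
  right_lin c v := LinearMap.congr_fun (free_ext
    (f := (freeLift g fun a b => X.left a (X.right (MulOpposite.op b) x)).comp
      ((freeBim H g).right c))
    (f' := (X.right c).comp (freeLift g fun a b => X.left a (X.right (MulOpposite.op b) x)))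
    fun a b => by
      rw [LinearMap.comp_apply, LinearMap.comp_apply, free_right, freeLift_mk, freeLift_mk,
        ← X.left_right, rep_apply_apply (X.right)]
      rfl) v

theorem freeHom_mk {X : Bim H} {g : G} (x : X) (hx : X.comp g x = x) (b : H) :
    (freeHom x hx).lin (freeMk g 1 b) = X.right (MulOpposite.op b) x := by
  refine (freeLift_mk g _ 1 b).trans ?_
  simp

open Classical in
/-- The coefficient of `· ⊗ (1 ⊗ g ⊗ 1)`, for the identification of `V ⊗_{ℂH} (ℂH ⊗ ℂg ⊗ ℂH)` with
`V ⊗ ℂg ⊗ ℂH`. -/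
def freeCoeff (V : Bim H) (g : G) : tensor V (freeBim H g) →ₗ[ℂ] V :=
  tl (freeLift g fun a b => if b = 1 then V.right (MulOpposite.op a) else 0).flip
    (fun k v p => LinearMap.congr_fun (free_ext
      (f := (freeLift g fun a b => if b = 1 then V.right (MulOpposite.op a) else 0).flip
        (V.right (MulOpposite.op k) v))
      (f' := ((freeLift g fun a b => if b = 1 then V.right (MulOpposite.op a) else 0).flip
        v).comp ((freeBim H g).left k)) fun a b => by
          simp only [LinearMap.comp_apply, LinearMap.flip_apply, free_left, freeLift_mk]
          split_ifs
          · rw [rep_apply_apply]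
            rfl
          · rfl) p)

theorem freeCoeff_tm (V : Bim H) (g : G) (v : V) (a b : H) [Decidable (b = 1)] :
    freeCoeff V g (tm V (freeBim H g) v (freeMk g a b)) =
      if b = 1 then V.right (MulOpposite.op a) v else 0 := by
  refine (tl_tm _ _ v (freeMk g a b)).trans ?_
  rw [LinearMap.flip_apply, freeLift_mk]
  split_ifs <;> rfl

theorem tensor_free_ext {V : Bim H} {g : G} {P : Type} [AddCommGroup P] [Module ℂ P]
    {f f' : tensor V (freeBim H g) →ₗ[ℂ] P}
    (h : ∀ v a b, f (tm _ _ v (freeMk g a b)) = f' (tm _ _ v (freeMk g a b))) : f = f' :=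
  tensor_ext fun v p => LinearMap.congr_fun (free_ext
    (f := f.comp (tm V (freeBim H g) v)) (f' := f'.comp (tm V (freeBim H g) v))
    (fun a b => h v a b)) p

/-- Every tensor can be written with `1` in the left slot of the free bimodule. Its coefficient at
`k` is found by translating by `k⁻¹`, which brings `k` to the position `1` read by `freeCoeff`. -/
theorem sum_freeCoeff (V : Bim H) (g : G) (w : tensor V (freeBim H g)) :
    ∑ k : H, tm V (freeBim H g)
      (freeCoeff V g ((tensor V (freeBim H g)).right (MulOpposite.op k⁻¹) w)) (freeMk g 1 k) = w := by
  classical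
  have := LinearMap.congr_fun (tensor_free_ext
    (f := ∑ k : H, ((tm V (freeBim H g)).flip (freeMk g 1 k)).comp
      ((freeCoeff V g).comp ((tensor V (freeBim H g)).right (MulOpposite.op k⁻¹))))
    (f' := LinearMap.id) fun v a b => by
      simp only [LinearMap.sum_apply, LinearMap.comp_apply, LinearMap.flip_apply, tensor_right_tm,
        free_right, freeCoeff_tm]
      rw [Finset.sum_eq_single b]
      · simp [tm_bal]
      · intro k _ hk
        rw [if_neg]
        · simp
        · intro e
          exact hk (mul_inv_eq_one.1 e).symm
      · simp) w
  simpa using this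

/-- Tensoring with the generator shifts degrees by `g` on the right. -/
theorem freeCoeff_comp (V : Bim H) (g x : G) (w : tensor V (freeBim H g)) :
    freeCoeff V g ((tensor V (freeBim H g)).comp (x * g) w) = V.comp x (freeCoeff V g w) := by
  classical
  refine LinearMap.congr_fun (tensor_free_ext
    (f := (freeCoeff V g).comp ((tensor V (freeBim H g)).comp (x * g)))
    (f' := (V.comp x).comp (freeCoeff V g)) fun v a b => ?_) w
  rw [LinearMap.comp_apply, LinearMap.comp_apply, tensor_comp_tm, map_sum, freeCoeff_tm,
    Finset.sum_eq_single (x * g * ((a : G) * g * b)⁻¹)]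
  · rw [free_comp, if_pos (by group), freeCoeff_tm]
    split_ifs with h
    · rw [V.comp_right, h]
      congr 2
      simp only [OneMemClass.coe_one]
      group
    · exact (map_zero _).symm
  · intro y _ hy
    rw [free_comp, if_neg, map_zero, map_zero]
    intro e
    exact hy (by rw [e]; group)
  · simp

theorem freeCoeff_left (V : Bim H) (g : G) (h : H) (w : tensor V (freeBim H g)) :
    freeCoeff V g ((tensor V (freeBim H g)).left h w) = V.left h (freeCoeff V g w) := by
  classical
  refine LinearMap.congr_fun (tensor_free_ext
    (f := (freeCoeff V g).comp ((tensor V (freeBim H g)).left h))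
    (f' := (V.left h).comp (freeCoeff V g)) fun v a b => ?_) w
  rw [LinearMap.comp_apply, LinearMap.comp_apply, tensor_left_tm, freeCoeff_tm, freeCoeff_tm]
  split_ifs
  · rw [V.left_right]
  · exact (map_zero _).symm

theorem freeCoeff_naturality {V W : Bim H} (f : V ⟶ W) (g : G) (w : tensor V (freeBim H g)) :
    freeCoeff W g ((tensorMap f (𝟙 (freeBim H g))).lin w) = f.lin (freeCoeff V g w) := by
  classical
  refine LinearMap.congr_fun (tensor_free_ext
    (f := (freeCoeff W g).comp (tensorMap f (𝟙 (freeBim H g))).lin)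
    (f' := f.lin.comp (freeCoeff V g)) fun v a b => ?_) w
  rw [LinearMap.comp_apply, LinearMap.comp_apply, tensorMap_tm, freeCoeff_tm, id_lin,
    LinearMap.id_apply, freeCoeff_tm]
  split_ifs
  · exact (f.right_lin _ _).symm
  · exact (map_zero _).symm

end Free

/-! ### The operators underlying a half-braiding -/

section Operators

open Bim

variable {H : Subgroup G} {V : Bim H}

namespace RightHalfBraiding

/-- The half-braiding as a morphism of bimodules. -/
def hom (c : RightHalfBraiding V) (X : Bim H) : tensor X V ⟶ tensor V X := (c.c X).hom

theorem hom_naturality (c : RightHalfBraiding V) {X Y : Bim H} (f : X ⟶ Y) (w : tensor X V) :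
    (c.hom Y).lin ((tensorMap f (𝟙 V)).lin w) = (tensorMap (𝟙 V) f).lin ((c.hom X).lin w) :=
  LinearMap.congr_fun (congrArg Hom.lin (c.naturality f)) w

theorem hom_tensor (c : RightHalfBraiding V) (X Y : Bim H) (w : tensor (tensor X Y) V) :
    (c.hom (tensor X Y)).lin w = (assocHom V X Y).lin ((tensorMap (c.hom X) (𝟙 Y)).lin
      ((assocIso X V Y).inv.lin ((tensorMap (𝟙 X) (c.hom Y)).lin ((assocHom X Y V).lin w)))) :=
  LinearMap.congr_fun (congrArg Hom.lin (c.monoidal X Y)) w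

theorem hom_injective (c : RightHalfBraiding V) (X : Bim H) :
    Function.Injective (c.hom X).lin := by
  refine Function.LeftInverse.injective (g := (c.c X).inv.lin) fun w => ?_
  exact LinearMap.congr_fun (congrArg Hom.lin (c.c X).hom_inv_id) w

/-- The operator `T_g` on `V` given by the coefficients of the half-braiding. -/
def op (c : RightHalfBraiding V) (g : G) : V →ₗ[ℂ] V :=
  freeCoeff V g ∘ₗ (c.hom (freeBim H g)).lin ∘ₗ tm (freeBim H g) V (freeMk g 1 1)

theorem op_apply (c : RightHalfBraiding V) (g : G) (v : V) :
    c.op g v = freeCoeff V g ((c.hom (freeBim H g)).lin (tm (freeBim H g) V (freeMk g 1 1) v)) :=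
  rfl

/-- A Yoneda argument: `x` is the image of the generator of a free bimodule, so naturality reduces
to that generator, and right linearity of the half-braiding expresses its `k`-th coefficient through
`T_g`. -/
theorem hom_tm_of_comp (c : RightHalfBraiding V) {X : Bim H} {g : G} {x : X}
    (hx : X.comp g x = x) (v : V) : (c.hom X).lin (tm X V x v) =
      ∑ k : H, tm V X (c.op g (V.right (MulOpposite.op k⁻¹) v))
        (X.right (MulOpposite.op k) x) := by
  have h1 : tm X V x v =
      (tensorMap (freeHom x hx) (𝟙 V)).lin (tm (freeBim H g) V (freeMk g 1 1) v) := by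
    rw [tensorMap_tm, freeHom_mk]
    simp
  rw [h1, hom_naturality, ← sum_freeCoeff V g ((c.hom (freeBim H g)).lin _), map_sum]
  refine Finset.sum_congr rfl fun k _ => ?_
  rw [tensorMap_tm, freeHom_mk, ← (c.hom (freeBim H g)).right_lin, tensor_right_tm, ← op_apply]
  rfl

theorem hom_tm (c : RightHalfBraiding V) {X : Bim H} (x : X) (v : V) :
    (c.hom X).lin (tm X V x v) =
      ∑ g, ∑ k : H, tm V X (c.op g (V.right (MulOpposite.op k⁻¹) v))
        (X.right (MulOpposite.op k) (X.comp g x)) := by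
  conv_lhs => rw [← sum_tm_comp_left, map_sum]
  exact Finset.sum_congr rfl fun g _ => c.hom_tm_of_comp (X.comp_self g x) v

/-- The half-braiding preserves total degree, here `gx`; once the generator stands on the right, `V`
is left with degree `gxg⁻¹`. This becomes the Yetter-Drinfeld condition. -/
theorem op_comp (c : RightHalfBraiding V) (g x : G) (v : V) :
    c.op g (V.comp x v) = V.comp (g * x * g⁻¹) (c.op g v) := by
  classical
  rw [op_apply, op_apply, ← freeCoeff_comp, ← (c.hom _).comp_lin, tensor_comp_tm,
    Finset.sum_eq_single g]
  · rw [free_comp_one]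
    congr 4
    group
  · intro y _ hy
    rw [← free_comp_one, (freeBim H g).comp_ne y g hy, map_zero, LinearMap.zero_apply]
  · simp

/-- The vector `h ⊗ 1 ⊗ 1` in the free bimodule on a generator of degree `1` has degree `h`. Its
half-braiding can be computed from `T_h`, or by left linearity from `T_1`. -/
theorem op_left (c : RightHalfBraiding V) (h : H) (v : V) :
    V.right (MulOpposite.op h) (c.op h v) = V.left h (c.op 1 v) := by
  classical
  rw [op_apply c 1, ← freeCoeff_left, ← (c.hom _).left_lin, tensor_left_tm, free_left]
  have hx : (freeBim H 1).comp (h : G) (freeMk 1 (h * 1) 1) = freeMk 1 (h * 1) 1 := by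
    rw [free_comp, if_pos (by simp)]
  rw [c.hom_tm_of_comp hx, map_sum, Finset.sum_eq_single 1]
  · rw [free_right, freeCoeff_tm, if_pos (by simp)]
    simp
  · intro k _ hk
    rw [free_right, freeCoeff_tm, if_neg (by simpa using hk)]
  · simp

/-- For the tensor product of the free bimodules of degrees `g` and `h`, the product of the
generators has degree `gh`, so its half-braiding is given by `T_{gh}`. The tensor axiom computes it
instead as a double sum over `j, k` in `H` of `T_g(T_h(v k⁻¹) j⁻¹)` times the generators translated
by `j` and `k`. The relation compares coefficients at `k = 1`, `j = l`. -/
theorem op_op_right (c : RightHalfBraiding V) (g h : G) (l : H) (v : V) [Decidable (l = 1)] :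
    c.op g (V.right (MulOpposite.op l⁻¹) (c.op h v)) = if l = 1 then c.op (g * h) v else 0 := by
  classical
  have hx : (tensor (freeBim H g) (freeBim H h)).comp (g * h)
      (tm (freeBim H g) (freeBim H h) (freeMk g 1 1) (freeMk h 1 1)) =
      tm (freeBim H g) (freeBim H h) (freeMk g 1 1) (freeMk h 1 1) := by
    rw [tensor_comp_tm, Finset.sum_eq_single g]
    · rw [free_comp_one, inv_mul_cancel_left, free_comp_one]
    · intro y _ hy
      rw [← free_comp_one, (freeBim H g).comp_ne y g hy, map_zero, LinearMap.zero_apply]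
    · simp
  have e1 := c.hom_tm_of_comp hx v
  rw [hom_tensor, assocHom_tm, tensorMap_tm, c.hom_tm_of_comp (free_comp_one h)] at e1
  simp only [id_lin, LinearMap.id_apply, map_sum, assocIso_inv_tm, tensorMap_tm,
    c.hom_tm_of_comp (free_comp_one g), LinearMap.sum_apply, assocHom_tm, free_right,
    tensor_right_tm] at e1
  -- Extraction of the coefficient: position `1` in the second free factor, then position `l` in the
  -- first.
  have e2 := congrArg (fun w => freeCoeff V g ((tensor V (freeBim H g)).right (MulOpposite.op l⁻¹)
    (freeCoeff (tensor V (freeBim H g)) h ((assocIso V (freeBim H g) (freeBim H h)).inv.lin w)))) e1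
  simp only [map_sum, assocIso_inv_tm, freeCoeff_tm, one_mul, MulOpposite.unop_op,
    Finset.sum_ite_eq', Finset.mem_univ, if_true, apply_ite, map_zero, inv_one,
    MulOpposite.op_one, map_one, Module.End.one_apply, tensor_right_tm, free_right,
    mul_inv_eq_one] at e2
  have e3 : (∑ x : H, ∑ y : H, if x = 1 then if y = l then c.op g (V.right (MulOpposite.op y⁻¹)
      (c.op h (V.right (MulOpposite.op x⁻¹) v))) else 0 else 0) =
      c.op g (V.right (MulOpposite.op l⁻¹) (c.op h v)) := by
    rw [Finset.sum_eq_single 1]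
    · simp
    · intro x _ hx
      simp [hx]
    · simp
  simp only [e3, inv_eq_one] at e2
  split_ifs at e2 ⊢ <;> exact e2

theorem op_op (c : RightHalfBraiding V) (g h : G) (v : V) : c.op g (c.op h v) = c.op (g * h) v := by
  classical
  have := c.op_op_right g h 1 v
  rw [if_pos rfl] at this
  simpa using this

theorem op_right_op (c : RightHalfBraiding V) (g h : G) (l : H) (v : V) [Decidable (l = 1)] :
    c.op g (V.right (MulOpposite.op l) (c.op h v)) = if l = 1 then c.op (g * h) v else 0 := by
  classical
  have := c.op_op_right g h l⁻¹ v
  rw [inv_inv] at this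
  rw [this]
  simp

/-- A half-braiding here carries no unit axiom, so the relation is deduced: the half-braiding with
`ℂH`, read as an endomorphism `p` of `V` through the unit isomorphisms, is injective because the
half-braiding is invertible, and idempotent by the relations among the `T_g`. Hence `p` is the
identity. -/
theorem sum_op (c : RightHalfBraiding V) (v : V) :
    ∑ k : H, V.right (MulOpposite.op k) (c.op 1 (V.right (MulOpposite.op k⁻¹) v)) = v := by
  classical
  have hu : (unit H).comp 1 (unitBasis 1) = unitBasis 1 := by
    rw [unit_comp_basis, if_pos (by simp)]
  let p : V →ₗ[ℂ] V := (rightUnitHom V).lin ∘ₗ (c.hom (unit H)).lin ∘ₗ tm (unit H) V (unitBasis 1)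
  have hp : ∀ v, p v =
      ∑ k : H, V.right (MulOpposite.op k) (c.op 1 (V.right (MulOpposite.op k⁻¹) v)) := by
    intro v
    change (rightUnitHom V).lin ((c.hom (unit H)).lin (tm (unit H) V (unitBasis 1) v)) = _
    rw [c.hom_tm_of_comp hu, map_sum]
    refine Finset.sum_congr rfl fun k _ => ?_
    simp
  have hinj : Function.Injective p := by
    intro v w hvw
    have h1 := (rightUnitIso V).hom_inv_id
    have h2 := c.hom_injective (unit H) ((Function.LeftInverse.injective
      (g := (rightUnitIso V).inv.lin) fun w =>
        LinearMap.congr_fun (congrArg Hom.lin h1) w) hvw)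
    have h3 := congrArg (leftUnitHom V).lin h2
    simpa using h3
  -- In the double sum the cross terms `T_1(T_1(·) j k⁻¹)` with `j ≠ k` vanish by `op_right_op`.
  have hpp : p (p v) = p v := by
    rw [hp (p v), hp v]
    refine Finset.sum_congr rfl fun k _ => ?_
    rw [map_sum, map_sum, Finset.sum_eq_single k]
    · rw [rep_apply_apply, ← MulOpposite.op_mul, mul_inv_cancel, MulOpposite.op_one, map_one,
        Module.End.one_apply, op_op, mul_one]
    · intro j _ hj
      rw [rep_apply_apply, ← MulOpposite.op_mul, op_right_op, if_neg]
      exact fun e => hj (mul_inv_eq_one.1 e)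
    · simp
  rw [← hp]
  exact hinj hpp

end RightHalfBraiding

theorem op_naturality {Z Z' : RightCenter (Bim H)} (f : Z ⟶ Z') (g : G) (v : Z.obj) :
    f.f.lin (Z.half.op g v) = Z'.half.op g (f.f.lin v) := by
  rw [RightHalfBraiding.op_apply, RightHalfBraiding.op_apply, ← freeCoeff_naturality]
  have := LinearMap.congr_fun (congrArg Hom.lin (f.comm (freeBim H g)))
    (tm (freeBim H g) Z.obj (freeMk g 1 1) v)
  exact congrArg (freeCoeff Z'.obj g) this.symm

/-- For `N ⊗ ℂH` the operator `T_1` is the projection onto `N ⊗ 1`, and on that subspace `T_g` is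
the action of `g`. This shows how `N` is recovered from its image in the center. -/
theorem underlieHalf_op (N : YD G) (g : G) (n : N) (b : H) [Decidable (b = 1)] :
    (underlieHalf H N).op g (underlieIncl N b n) =
      if b = 1 then underlieIncl N 1 (N.act g n) else 0 := by
  classical
  refine (congrArg (freeCoeff _ g) (braidHom_tm N (freeBim H g) (freeMk g 1 1) n b)).trans ?_
  rw [map_sum, Finset.sum_eq_single g]
  · rw [free_comp_one, free_right, freeCoeff_tm]
    simp
  · intro y _ hy
    rw [← free_comp_one, (freeBim H g).comp_ne y g hy, map_zero, map_zero, map_zero]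
  · simp

theorem underlieHalf_op' (N : YD G) (g : G) (F : underlieObj H N) :
    (underlieHalf H N).op g F = underlieIncl N 1 (N.act g (underlieAt N 1 F)) := by
  classical
  refine LinearMap.congr_fun (underlie_ext (f := (underlieHalf H N).op g)
    (g := underlieIncl N 1 ∘ₗ N.act g ∘ₗ underlieAt N 1) fun n b => ?_) F
  rw [underlieHalf_op, LinearMap.comp_apply, LinearMap.comp_apply, underlieAt_incl]
  by_cases h : b = 1
  · rw [if_pos h, if_pos h.symm]
  · rw [if_neg h, if_neg (Ne.symm h), map_zero, map_zero]

end Operators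

/-! ### Yetter-Drinfeld modules and the right center -/

section Equivalence

open Bim

variable {H : Subgroup G}

theorem underlieIncl_injective (N : YD G) (b : H) : Function.Injective (underlieIncl N b) := by
  classical
  refine Function.LeftInverse.injective (g := underlieAt N b) fun n => ?_
  rw [underlieAt_incl, if_pos rfl]

instance : (toCenter (G := G) H).Faithful where
  map_injective {N N'} f f' h := YD.hom_ext fun n => underlieIncl_injective (H := H) N' 1 (by
    have := congrArg (fun φ : (toCenter H).obj N ⟶ (toCenter H).obj N' =>
      φ.f.lin (underlieIncl N 1 n)) h
    change (underlieMap f).lin _ = (underlieMap f').lin _ at this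
    rwa [underlieMap_incl, underlieMap_incl] at this)

/-- A morphism `N → N'` from a morphism of the associated objects of the center. -/
def centerPreimage {N N' : YD G} (φ : (toCenter H).obj N ⟶ (toCenter H).obj N') : N ⟶ N' :=
  let f : underlieObj H N ⟶ underlieObj H N' := φ.f
  -- A morphism of the center commutes with the operators `T_x`, whose values lie in `N' ⊗ 1`.
  have hop : ∀ x n, f.lin (underlieIncl N 1 (N.act x n)) =
      underlieIncl N' 1 (N'.act x (underlieAt N' 1 (f.lin (underlieIncl N 1 n)))) := by
    classical
    intro x n
    have := op_naturality φ x (underlieIncl N 1 n)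
    refine Eq.trans (congrArg f.lin ?_) (this.trans (underlieHalf_op' N' x _))
    exact ((underlieHalf_op N x n (1 : H)).trans (if_pos rfl)).symm
  { lin := underlieAt N' 1 ∘ₗ f.lin ∘ₗ underlieIncl N 1
    comp_lin := fun g n => by
      have h1 := f.comp_lin g (underlieIncl N 1 n)
      rw [underlie_comp] at h1
      simp only [OneMemClass.coe_one, inv_one, mul_one] at h1
      refine (congrArg (underlieAt N' 1) h1).trans ?_
      change N'.comp (g * ((1 : H) : G)⁻¹) _ = _
      simp only [OneMemClass.coe_one, inv_one, mul_one]
      rfl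
    act_lin := fun x n => by
      classical
      change underlieAt N' 1 (f.lin (underlieIncl N 1 (N.act x n))) = _
      rw [hop, underlieAt_incl, if_pos rfl]
      rfl }

/-- Commuting with `T_1` forces the morphism to send `N ⊗ 1` into `N' ⊗ 1`; right linearity then
determines it on every `N ⊗ b`. -/
theorem toCenter_map_centerPreimage {N N' : YD G}
    (φ : (toCenter H).obj N ⟶ (toCenter H).obj N') :
    (toCenter H).map (centerPreimage φ) = φ := by
  refine RightCenter.Hom.ext (Hom.ext (underlie_ext (N := N) fun n b => ?_))
  let f : underlieObj H N ⟶ underlieObj H N' := φ.f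
  change (underlieMap (centerPreimage φ)).lin (underlieIncl N b n) = f.lin (underlieIncl N b n)
  have e : underlieIncl N b n =
      (underlieObj H N).right (MulOpposite.op b) (underlieIncl N 1 n) := by simp
  rw [e, Hom.right_lin, f.right_lin, underlieMap_incl]
  congr 1
  classical
  have := op_naturality φ 1 (underlieIncl N 1 n)
  have h1 : (underlieHalf H N).op 1 (underlieIncl N 1 n) = underlieIncl N 1 n := by
    rw [underlieHalf_op, if_pos rfl, map_one]
    rfl
  have h2 := (congrArg f.lin h1.symm).trans (this.trans (underlieHalf_op' N' 1 _))
  rw [map_one] at h2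
  exact h2.symm

instance : (toCenter (G := G) H).Full where
  map_surjective φ := ⟨centerPreimage φ, toCenter_map_centerPreimage φ⟩

/-! ### The Yetter-Drinfeld module recovered from a half-braiding -/

variable {V : Bim H} (c : RightHalfBraiding V)

/-- The Yetter-Drinfeld module of an object of the right center. -/
def fixedYD : YD G where
  carrier := LinearMap.range (c.op 1)
  comp g := (V.comp g).restrict (by
    rintro _ ⟨v, rfl⟩
    refine ⟨V.comp g v, ?_⟩
    rw [c.op_comp]
    simp)
  comp_self g v := Subtype.ext (V.comp_self g v)
  comp_ne g k h v := Subtype.ext (V.comp_ne g k h v)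
  sum_comp v := Subtype.ext (by
    rw [AddSubmonoidClass.coe_finsetSum]
    exact V.sum_comp v)
  act :=
    { toFun := fun x => (c.op x).restrict (by
        rintro _ ⟨v, rfl⟩
        exact ⟨c.op x v, by rw [c.op_op, c.op_op, one_mul, mul_one]⟩)
      map_one' := by
        ext ⟨_, v, rfl⟩
        change c.op 1 (c.op 1 v) = c.op 1 v
        rw [c.op_op, mul_one]
      map_mul' := fun x y => by
        ext v
        exact (c.op_op x y v).symm }
  comp_act x g v := Subtype.ext (c.op_comp x g v).symm

/-- The inclusion of the Yetter-Drinfeld module of an object of the right center. -/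
def fixedIncl : fixedYD c →ₗ[ℂ] V := (LinearMap.range (c.op 1)).subtype

theorem op_one_fixedIncl (n : fixedYD c) : c.op 1 (fixedIncl c n) = fixedIncl c n := by
  obtain ⟨_, v, rfl⟩ := n
  exact (c.op_op 1 1 v).trans (by rw [mul_one]; rfl)

theorem op_right_fixedIncl (g : G) (l : H) (n : fixedYD c) [Decidable (l = 1)] :
    c.op g (V.right (MulOpposite.op l) (fixedIncl c n)) =
      if l = 1 then fixedIncl c ((fixedYD c).act g n) else 0 := by
  rw [← op_one_fixedIncl, c.op_right_op, mul_one]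
  rfl

/-- The relation `hn = (T_h n)h` is `op_left` on vectors fixed by `T_1`; it makes `n ⊗ k ↦ nk` left
linear. -/
theorem left_fixedIncl (h : H) (n : fixedYD c) :
    V.left h (fixedIncl c n) = V.right (MulOpposite.op h) (fixedIncl c ((fixedYD c).act h n)) := by
  conv_lhs => rw [← op_one_fixedIncl]
  exact (c.op_left h (fixedIncl c n)).symm

/-- The map `n ⊗ k ↦ n k`. -/
def fixedLin : underlieObj H (fixedYD c) →ₗ[ℂ] V :=
  ∑ k : H, V.right (MulOpposite.op k) ∘ₗ fixedIncl c ∘ₗ underlieAt (fixedYD c) k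

theorem fixedLin_incl (n : fixedYD c) (b : H) :
    fixedLin c (underlieIncl (fixedYD c) b n) = V.right (MulOpposite.op b) (fixedIncl c n) := by
  classical
  rw [fixedLin, LinearMap.sum_apply, Finset.sum_eq_single b]
  · rw [LinearMap.comp_apply, LinearMap.comp_apply, underlieAt_incl, if_pos rfl]
  · intro k _ hk
    rw [LinearMap.comp_apply, LinearMap.comp_apply, underlieAt_incl, if_neg hk, map_zero, map_zero]
  · simp

/-- The morphism `n ⊗ k ↦ n k`. -/
def fixedHom : underlieObj H (fixedYD c) ⟶ V where
  lin := fixedLin c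
  comp_lin g v := LinearMap.congr_fun (underlie_ext
    (f := (fixedLin c).comp ((underlieObj H (fixedYD c)).comp g))
    (g := (V.comp g).comp (fixedLin c)) fun n b => by
      rw [LinearMap.comp_apply, LinearMap.comp_apply, underlie_comp, fixedLin_incl, fixedLin_incl,
        V.comp_right]
      rfl) v
  left_lin h v := LinearMap.congr_fun (underlie_ext
    (f := (fixedLin c).comp ((underlieObj H (fixedYD c)).left h))
    (g := (V.left h).comp (fixedLin c)) fun n b => by
      rw [LinearMap.comp_apply, LinearMap.comp_apply, underlie_left, fixedLin_incl, fixedLin_incl,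
        V.left_right, left_fixedIncl, rep_apply_apply]
      rfl) v
  right_lin k v := LinearMap.congr_fun (underlie_ext
    (f := (fixedLin c).comp ((underlieObj H (fixedYD c)).right k))
    (g := (V.right k).comp (fixedLin c)) fun n b => by
      rw [LinearMap.comp_apply, LinearMap.comp_apply, underlie_right, fixedLin_incl, fixedLin_incl,
        rep_apply_apply]
      rfl) v

/-- The inverse `v ↦ ∑ₖ T₁(v k⁻¹) ⊗ k` of `n ⊗ k ↦ n k`. -/
def fixedInv : V →ₗ[ℂ] underlieObj H (fixedYD c) :=
  ∑ k : H, underlieIncl (fixedYD c) k ∘ₗ (c.op 1).rangeRestrict ∘ₗ V.right (MulOpposite.op k⁻¹)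

theorem fixedInv_apply (v : V) : fixedInv c v = ∑ k : H, underlieIncl (fixedYD c) k
    ((c.op 1).rangeRestrict (V.right (MulOpposite.op k⁻¹) v)) := by
  rw [fixedInv, LinearMap.sum_apply]
  rfl

/-- This is the relation `∑ₖ T_1(v k⁻¹) k = v`: the translates of the image of `T_1` span `V`. -/
theorem fixedLin_fixedInv (v : V) : fixedLin c (fixedInv c v) = v := by
  rw [fixedInv_apply, map_sum]
  conv_rhs => rw [← c.sum_op v]
  exact Finset.sum_congr rfl fun k _ => fixedLin_incl c _ k

/-- The translates of the image of `T_1` are independent, since `T_1(n b k⁻¹)` is `n` for `k = b`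
and zero otherwise. -/
theorem fixedInv_fixedLin (F : underlieObj H (fixedYD c)) : fixedInv c (fixedLin c F) = F :=
  LinearMap.congr_fun (underlie_ext (f := (fixedInv c).comp (fixedLin c)) (g := LinearMap.id)
    fun n b => by
      classical
      rw [LinearMap.comp_apply, fixedLin_incl, fixedInv_apply, LinearMap.id_apply,
        Finset.sum_eq_single b]
      · congr 1
        refine Subtype.ext ?_
        change c.op 1 (V.right _ (V.right _ (fixedIncl c n))) = fixedIncl c n
        rw [rep_apply_apply, ← MulOpposite.op_mul, mul_inv_cancel, op_right_fixedIncl, if_pos rfl,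
          map_one]
        rfl
      · intro k _ hk
        have : (c.op 1).rangeRestrict (V.right (MulOpposite.op k⁻¹)
            (V.right (MulOpposite.op b) (fixedIncl c n))) = 0 := by
          refine Subtype.ext ?_
          change c.op 1 (V.right _ (V.right _ (fixedIncl c n))) = 0
          rw [rep_apply_apply, ← MulOpposite.op_mul, op_right_fixedIncl, if_neg]
          exact fun e => hk (mul_inv_eq_one.1 e).symm
        rw [this]
        exact map_zero _
      · simp) F

/-- An isomorphism in `C` compatible with half-braidings gives an isomorphism in the center. -/
def RightCenter.isoMk {C : Type*} [Category C] [MonoidalCategory C] {Z Z' : RightCenter C}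
    (f : Z ⟶ Z') (e : Z.obj ≅ Z'.obj) (he : e.hom = f.f) : Z ≅ Z' where
  hom := f
  inv := ⟨e.inv, fun X => by
    rw [← cancel_epi (X ◁ e.hom), ← Category.assoc, ← MonoidalCategory.whiskerLeft_comp,
      e.hom_inv_id, MonoidalCategory.whiskerLeft_id, Category.id_comp, ← Category.assoc, he,
      f.comm, Category.assoc, ← comp_whiskerRight, ← he, e.hom_inv_id, id_whiskerRight,
      Category.comp_id]⟩
  hom_inv_id := RightCenter.Hom.ext (by
    change f.f ≫ e.inv = 𝟙 _
    rw [← he, e.hom_inv_id])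
  inv_hom_id := RightCenter.Hom.ext (by
    change e.inv ≫ f.f = 𝟙 _
    rw [← he, e.inv_hom_id])

/-- The morphism `n ⊗ k ↦ n k` in the right center. -/
def fixedCenterHom (Z : RightCenter (Bim H)) : (toCenter H).obj (fixedYD Z.half) ⟶ Z :=
  ⟨fixedHom Z.half, fun X => Hom.ext (tensor_underlie_ext fun x n b => by
    classical
    change (Z.half.hom X).lin (tm X Z.obj x (fixedLin Z.half (underlieIncl _ b n))) =
      (tensorMap (fixedHom Z.half) (𝟙 X)).lin ((braidHom _ X).lin (tm X _ x (underlieIncl _ b n)))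
    rw [fixedLin_incl, Z.half.hom_tm, braidHom_tm, map_sum]
    refine Finset.sum_congr rfl fun g _ => ?_
    -- Of the terms `T_g(n b k⁻¹) ⊗ x_g k` only `k = b` survives, leaving `T_g n ⊗ x_g b`, as in the
    -- half-braiding of `N ⊗ ℂH`.
    rw [Finset.sum_eq_single b]
    · rw [tensorMap_tm, rep_apply_apply, ← MulOpposite.op_mul, mul_inv_cancel, op_right_fixedIncl,
        if_pos rfl]
      change _ = tm _ X (fixedLin Z.half (underlieIncl _ 1 _)) _
      rw [fixedLin_incl, MulOpposite.op_one, map_one]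
      rfl
    · intro k _ hk
      rw [rep_apply_apply, ← MulOpposite.op_mul, op_right_fixedIncl, if_neg, map_zero,
        LinearMap.zero_apply]
      exact fun e => hk (mul_inv_eq_one.1 e).symm
    · simp)⟩

instance : (toCenter (G := G) H).EssSurj where
  mem_essImage Z := ⟨fixedYD Z.half, ⟨RightCenter.isoMk (fixedCenterHom Z)
    (isoOf (fixedHom Z.half) (fixedInv Z.half) (fixedInv_fixedLin Z.half)
      (fixedLin_fixedInv Z.half)) rfl⟩⟩

instance : (toCenter (G := G) H).IsEquivalence where

end Equivalence

/-! ### The two-sided adjoint of `N ↦ N ⊗ ℂH` -/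

section Coind

variable {H : Subgroup G}

/-- The adjoint action `h · m = h m h⁻¹` of `H` on a bimodule. -/
def adRep (M : Bim H) : Representation ℂ H M where
  toFun h := M.left h ∘ₗ M.right (MulOpposite.op h⁻¹)
  map_one' := by ext; simp
  map_mul' a b := by
    ext v
    simp only [LinearMap.comp_apply, Module.End.mul_apply]
    rw [← M.left_right b, rep_apply_apply, rep_apply_apply, ← MulOpposite.op_mul, mul_inv_rev]

theorem adRep_apply (M : Bim H) (h : H) (v : M) :
    adRep M h v = M.left h (M.right (MulOpposite.op h⁻¹) v) := rfl

theorem comp_adRep (M : Bim H) (h : H) (g : G) (v : M) :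
    M.comp (h * g * (h : G)⁻¹) (adRep M h v) = adRep M h (M.comp g v) := by
  have := M.comp_act h h⁻¹ g v
  rwa [InvMemClass.coe_inv] at this

/-- The functions `f : G → M` with `f(h x) = h f(x) h⁻¹`. -/
def coindSub (M : Bim H) : Submodule ℂ (G → M) where
  carrier := {f | ∀ (h : H) x, f (h * x) = adRep M h (f x)}
  zero_mem' := fun _ _ => (map_zero _).symm
  add_mem' {a b} ha hb := fun h x => by
    rw [Pi.add_apply, Pi.add_apply, ha, hb, map_add]
  smul_mem' c a ha := fun h x => by
    rw [Pi.smul_apply, Pi.smul_apply, ha, map_smul]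

theorem coindSub_ext {M : Bim H} {f f' : coindSub M} (h : ∀ x, f.1 x = f'.1 x) : f = f' :=
  Subtype.ext (funext h)

theorem coindSub_sum_apply {X : Type} [Fintype X] {M : Bim H} (F : X → coindSub M) (x : G) :
    (∑ i, F i).1 x = ∑ i, (F i).1 x := by
  rw [AddSubmonoidClass.coe_finsetSum, Finset.sum_apply]

/-- The Yetter-Drinfeld module coinduced from a bimodule with the adjoint action. -/
def coindObj (M : Bim H) : YD G where
  carrier := coindSub M
  comp g :=
    { toFun := fun f => ⟨fun x => M.comp (x * g * x⁻¹) (f.1 x), fun h x => by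
        beta_reduce
        rw [f.2, ← comp_adRep]
        congr 2
        group⟩
      map_add' := fun a b => coindSub_ext fun x => map_add (M.comp _) _ _
      map_smul' := fun c a => coindSub_ext fun x => map_smul (M.comp _) _ _ }
  comp_self g f := coindSub_ext fun x => M.comp_self _ _
  comp_ne g k h f := coindSub_ext fun x => M.comp_ne _ _ (by simpa using h) _
  sum_comp f := coindSub_ext fun x => by
    refine (coindSub_sum_apply _ x).trans ?_
    conv_rhs => rw [← M.sum_comp (f.1 x)]
    exact Fintype.sum_equiv ((Equiv.mulLeft x).trans (Equiv.mulRight x⁻¹)) _ _ fun _ => rfl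
  act :=
    { toFun := fun y =>
        { toFun := fun f => ⟨fun x => f.1 (x * y), fun h x => by
            beta_reduce
            rw [mul_assoc, f.2]⟩
          map_add' := fun _ _ => rfl
          map_smul' := fun _ _ => rfl }
      map_one' := LinearMap.ext fun f => coindSub_ext fun x => congrArg f.1 (mul_one x)
      map_mul' := fun a b => LinearMap.ext fun f => coindSub_ext fun x =>
        congrArg f.1 (mul_assoc x a b).symm }
  comp_act y g f := coindSub_ext fun x => by
    change M.comp (x * (y * g * y⁻¹) * x⁻¹) (f.1 (x * y)) =
      M.comp (x * y * g * (x * y)⁻¹) (f.1 (x * y))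
    congr 2
    group

theorem adRep_naturality {M M' : Bim H} (φ : M ⟶ M') (h : H) (v : M) :
    φ.lin (adRep M h v) = adRep M' h (φ.lin v) := by
  rw [adRep_apply, φ.left_lin, φ.right_lin, adRep_apply]

/-- Coinduction on morphisms. -/
def coindMap {M M' : Bim H} (φ : M ⟶ M') : coindObj M ⟶ coindObj M' where
  lin :=
    { toFun := fun f => (⟨fun x => φ.lin (f.1 x), fun h x => by
        beta_reduce
        rw [f.2, adRep_naturality]⟩ : coindSub M')
      map_add' := fun a b => coindSub_ext fun x => map_add φ.lin _ _
      map_smul' := fun c a => coindSub_ext fun x => map_smul φ.lin _ _ }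
  comp_lin _ _ := coindSub_ext fun _ => φ.comp_lin _ _
  act_lin _ _ := rfl

variable (H) in
/-- The coinduction functor from bimodules to Yetter-Drinfeld modules. -/
def coind : Bim H ⥤ YD G where
  obj := coindObj
  map := coindMap
  map_id _ := rfl
  map_comp _ _ := rfl

/-- The embedding `n ↦ n ⊗ 1` is equivariant for the adjoint action. This is why the adjoint action,
rather than the left one, is coinduced. -/
theorem underlieIncl_act (N : YD G) (h : H) (n : N) :
    underlieIncl N 1 (N.act h n) = adRep (underlieObj H N) h (underlieIncl N 1 n) := by
  rw [adRep_apply]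
  simp

/-- The morphism `N → coind M` corresponding to `N ⊗ ℂH → M`. -/
def toCoind {N : YD G} {M : Bim H} (φ : underlieObj H N ⟶ M) : N ⟶ coindObj M where
  lin :=
    { toFun := fun n => (⟨fun x => φ.lin (underlieIncl N 1 (N.act x n)), fun h x => by
        beta_reduce
        rw [← rep_apply_apply, underlieIncl_act, adRep_naturality]⟩ : coindSub M)
      map_add' := fun a b => coindSub_ext fun x => by simp only [map_add]; rfl
      map_smul' := fun c a => coindSub_ext fun x => by simp only [map_smul]; rfl }
  comp_lin g n := coindSub_ext fun x => by
    change φ.lin (underlieIncl N 1 (N.act x (N.comp g n))) =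
      M.comp (x * g * x⁻¹) (φ.lin (underlieIncl N 1 (N.act x n)))
    rw [← N.comp_act, ← φ.comp_lin, underlie_comp]
    simp
  act_lin y n := coindSub_ext fun x => by
    change φ.lin (underlieIncl N 1 (N.act x (N.act y n))) =
      φ.lin (underlieIncl N 1 (N.act (x * y) n))
    rw [rep_apply_apply]

/-- Evaluation at `1`. -/
def coindEval (M : Bim H) : coindObj M →ₗ[ℂ] M :=
  (LinearMap.proj 1 : (G → M) →ₗ[ℂ] M) ∘ₗ (coindSub M).subtype

theorem coindEval_act (M : Bim H) (x : G) (f : coindObj M) :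
    coindEval M ((coindObj M).act x f) = f.1 x := congrArg f.1 (one_mul x)

theorem coindEval_act_coe (M : Bim H) (h : H) (f : coindObj M) :
    coindEval M ((coindObj M).act h f) = adRep M h (coindEval M f) := by
  rw [coindEval_act]
  refine (congrArg f.1 (mul_one (h : G)).symm).trans (f.2 h 1)

theorem coindEval_comp (M : Bim H) (g : G) (f : coindObj M) :
    coindEval M ((coindObj M).comp g f) = M.comp g (coindEval M f) := by
  change M.comp (1 * g * 1⁻¹) _ = _
  rw [one_mul, inv_one, mul_one]
  rfl

/-- The linear map underlying `ofCoind`. -/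
def ofCoindLin {N : YD G} {M : Bim H} (ψ : N ⟶ coindObj M) : underlieObj H N →ₗ[ℂ] M :=
  ∑ k : H, M.right (MulOpposite.op k) ∘ₗ coindEval M ∘ₗ ψ.lin ∘ₗ underlieAt N k

theorem ofCoindLin_incl {N : YD G} {M : Bim H} (ψ : N ⟶ coindObj M) (n : N) (b : H) :
    ofCoindLin ψ (underlieIncl N b n) = M.right (MulOpposite.op b) (coindEval M (ψ.lin n)) := by
  classical
  rw [ofCoindLin, LinearMap.sum_apply, Finset.sum_eq_single b]
  · simp only [LinearMap.comp_apply, underlieAt_incl, if_pos]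
  · intro k _ hk
    simp only [LinearMap.comp_apply, underlieAt_incl, if_neg hk, map_zero]
  · simp

/-- The morphism `N ⊗ ℂH → M` corresponding to `N → coind M`. -/
def ofCoind {N : YD G} {M : Bim H} (ψ : N ⟶ coindObj M) : underlieObj H N ⟶ M where
  lin := ofCoindLin ψ
  comp_lin g v := LinearMap.congr_fun (underlie_ext
    (f := (ofCoindLin ψ).comp ((underlieObj H N).comp g))
    (g := (M.comp g).comp (ofCoindLin ψ)) fun n b => by
      rw [LinearMap.comp_apply, LinearMap.comp_apply, underlie_comp, ofCoindLin_incl,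
        ofCoindLin_incl, M.comp_right, ψ.comp_lin, coindEval_comp]) v
  left_lin h v := LinearMap.congr_fun (underlie_ext
    (f := (ofCoindLin ψ).comp ((underlieObj H N).left h))
    (g := (M.left h).comp (ofCoindLin ψ)) fun n b => by
      rw [LinearMap.comp_apply, LinearMap.comp_apply, underlie_left, ofCoindLin_incl,
        ofCoindLin_incl, ψ.act_lin, coindEval_act_coe, adRep_apply, ← M.left_right,
        rep_apply_apply, ← MulOpposite.op_mul, inv_mul_cancel_left]) v
  right_lin k v := LinearMap.congr_fun (underlie_ext
    (f := (ofCoindLin ψ).comp ((underlieObj H N).right k))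
    (g := (M.right k).comp (ofCoindLin ψ)) fun n b => by
      rw [LinearMap.comp_apply, LinearMap.comp_apply, underlie_right, ofCoindLin_incl,
        ofCoindLin_incl, rep_apply_apply]
      rfl) v

theorem ofCoind_toCoind {N : YD G} {M : Bim H} (φ : underlieObj H N ⟶ M) :
    ofCoind (toCoind φ) = φ :=
  Bim.Hom.ext (underlie_ext fun n b => by
    refine (ofCoindLin_incl _ n b).trans ?_
    change M.right (MulOpposite.op b) (φ.lin (underlieIncl N 1 (N.act 1 n))) = _
    rw [map_one, Module.End.one_apply, ← φ.right_lin, underlie_right, one_mul]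
    rfl)

theorem toCoind_ofCoind {N : YD G} {M : Bim H} (ψ : N ⟶ coindObj M) :
    toCoind (ofCoind ψ) = ψ :=
  YD.hom_ext fun n => coindSub_ext fun x => by
    refine (ofCoindLin_incl ψ (N.act x n) 1).trans ?_
    rw [MulOpposite.op_one, map_one, Module.End.one_apply, ψ.act_lin]
    exact coindEval_act M x _

variable (H) in
/-- Coinduction is right adjoint to `N ↦ N ⊗ ℂH`. -/
def underlieCoindAdjunction : underlie H ⊣ coind (G := G) H :=
  Adjunction.mkOfHomEquiv
    { homEquiv := fun _ _ => ⟨toCoind, ofCoind, ofCoind_toCoind, toCoind_ofCoind⟩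
      homEquiv_naturality_left_symm := fun {N _ _} f ψ =>
        Bim.Hom.ext (underlie_ext (N := N) fun n b => by
          refine (ofCoindLin_incl _ n b).trans ?_
          refine ((congrArg (ofCoindLin ψ) (underlieMap_incl f n b)).trans ?_).symm
          exact ofCoindLin_incl ψ (f.lin n) b)
      homEquiv_naturality_right := fun _ _ => rfl }

/-! ### Coinduction as a left adjoint -/

open Classical in
/-- The function supported on `H` with value `m` at `1`. -/
def coindIncl (M : Bim H) : M →ₗ[ℂ] coindObj M where
  toFun m := (⟨fun x => zeroExt H.subtype (adRep M) x m, fun h x =>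
    zeroExt_mul_left H.subtype (adRep M) h x m⟩ : coindSub M)
  map_add' _ _ := coindSub_ext fun _ => map_add _ _ _
  map_smul' _ _ := coindSub_ext fun _ => map_smul _ _ _

theorem coindIncl_coe (M : Bim H) (m : M) (h : H) : (coindIncl M m).1 h = adRep M h m :=
  zeroExt_of_mem H.subtype_injective (adRep M) h m

theorem coindIncl_of_notMem (M : Bim H) (m : M) {x : G} (hx : x ∉ H) : (coindIncl M m).1 x = 0 :=
  zeroExt_of_notMem (φ := H.subtype) (adRep M) (fun k e => hx (by rw [← e]; exact k.2)) m

theorem coindIncl_adRep (M : Bim H) (h : H) (m : M) :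
    coindIncl M (adRep M h m) = (coindObj M).act h (coindIncl M m) :=
  coindSub_ext fun x => zeroExt_act H.subtype (adRep M) x h m

theorem coindIncl_comp (M : Bim H) (g : G) (m : M) :
    coindIncl M (M.comp g m) = (coindObj M).comp g (coindIncl M m) := by
  refine coindSub_ext fun x => ?_
  change _ = M.comp (x * g * x⁻¹) ((coindIncl M m).1 x)
  by_cases hx : x ∈ H
  · have h1 := coindIncl_coe M (M.comp g m) ⟨x, hx⟩
    have h2 := coindIncl_coe M m ⟨x, hx⟩
    exact h1.trans ((congrArg (M.comp (x * g * x⁻¹)) h2).trans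
      (comp_adRep M ⟨x, hx⟩ g m)).symm
  · rw [coindIncl_of_notMem M m hx, coindIncl_of_notMem M _ hx, map_zero]

/-- At `y` only the `|H|` elements `x` of `Hy` contribute, each giving `f(y)`. So coinduction is
generated by functions supported on `H`, which is how it coincides with induction. -/
theorem sum_coindIncl (M : Bim H) (f : coindObj M) :
    (Fintype.card H : ℂ)⁻¹ • ∑ x, (coindObj M).act x⁻¹ (coindIncl M (f.1 x)) = f := by
  classical
  have e : ∑ x, (coindObj M).act x⁻¹ (coindIncl M (f.1 x)) = ∑ _h : H, f := by
    refine coindSub_ext fun y => ?_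
    refine (coindSub_sum_apply _ y).trans (Eq.trans ?_ (coindSub_sum_apply _ y).symm)
    have h1 : ∀ x, (coindIncl M (f.1 x)).1 (y * x⁻¹) = if y * x⁻¹ ∈ H then f.1 y else 0 := by
      intro x
      split_ifs with hx
      · refine (coindIncl_coe M (f.1 x) ⟨_, hx⟩).trans ((f.2 ⟨_, hx⟩ x).symm.trans ?_)
        exact congrArg f.1 (inv_mul_cancel_right y x)
      · exact coindIncl_of_notMem M _ hx
    change ∑ x, (coindIncl M (f.1 x)).1 (y * x⁻¹) = _
    simp only [h1]
    rw [sum_subgroup H fun _ => f.1 y]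
    exact Fintype.sum_equiv ((Equiv.inv G).trans (Equiv.mulLeft y)) _ _ fun _ => rfl
  rw [e]
  exact card_inv_smul_sum f

/-- The morphism `M → N ⊗ ℂH` corresponding to `coind M → N`. -/
def toUnderlie {N : YD G} {M : Bim H} (φ : coindObj M ⟶ N) : M ⟶ underlieObj H N where
  lin := LinearMap.pi fun k : H =>
    φ.lin ∘ₗ coindIncl M ∘ₗ M.right (MulOpposite.op k⁻¹)
  comp_lin g m := underlieObj_ext fun k => by
    change φ.lin (coindIncl M (M.right (MulOpposite.op k⁻¹) (M.comp g m))) =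
      N.comp (g * (k : G)⁻¹) (φ.lin (coindIncl M (M.right (MulOpposite.op k⁻¹) m)))
    rw [← φ.comp_lin, ← coindIncl_comp, M.comp_right]
    simp
  left_lin h m := underlieObj_ext fun k => by
    change φ.lin (coindIncl M (M.right (MulOpposite.op k⁻¹) (M.left h m))) =
      N.act h (φ.lin (coindIncl M (M.right (MulOpposite.op (h⁻¹ * k)⁻¹) m)))
    rw [← φ.act_lin, ← coindIncl_adRep, adRep_apply, rep_apply_apply, M.left_right]
    simp
  right_lin b m := underlieObj_ext fun k => by
    change φ.lin (coindIncl M (M.right (MulOpposite.op k⁻¹) (M.right b m))) =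
      φ.lin (coindIncl M (M.right (MulOpposite.op (k * b.unop⁻¹)⁻¹) m))
    rw [rep_apply_apply]
    simp

theorem underlieAt_toUnderlie {N : YD G} {M : Bim H} (φ : coindObj M ⟶ N) (m : M) (k : H) :
    underlieAt N k ((toUnderlie φ).lin m) =
      φ.lin (coindIncl M (M.right (MulOpposite.op k⁻¹) m)) := rfl

/-- The linear map underlying `ofUnderlie`. -/
def ofUnderlieLin {N : YD G} {M : Bim H} (ψ : M ⟶ underlieObj H N) : coindObj M →ₗ[ℂ] N :=
  (Fintype.card H : ℂ)⁻¹ • ∑ x, N.act x⁻¹ ∘ₗ underlieAt N 1 ∘ₗ ψ.lin ∘ₗ coindEval M ∘ₗ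
    (coindObj M).act x

theorem ofUnderlieLin_apply {N : YD G} {M : Bim H} (ψ : M ⟶ underlieObj H N) (f : coindObj M) :
    ofUnderlieLin ψ f =
      (Fintype.card H : ℂ)⁻¹ • ∑ x, N.act x⁻¹ (underlieAt N 1 (ψ.lin (f.1 x))) := by
  rw [ofUnderlieLin, LinearMap.smul_apply, LinearMap.sum_apply]
  refine congrArg _ (Finset.sum_congr rfl fun x _ => ?_)
  simp only [LinearMap.comp_apply, coindEval_act]

theorem underlieAt_comp (N : YD G) (g : G) (F : underlieObj H N) :
    underlieAt N 1 ((underlieObj H N).comp g F) = N.comp g (underlieAt N 1 F) := by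
  change N.comp (g * ((1 : H) : G)⁻¹) _ = _
  simp only [OneMemClass.coe_one, inv_one, mul_one]
  rfl

/-- The coefficient at `1` is equivariant from the adjoint action to the action on `N`; it is
through this coefficient that a morphism `M → N ⊗ ℂH` corresponds to an `H`-map `M → N`. -/
theorem underlieAt_adRep (N : YD G) (h : H) (F : underlieObj H N) :
    underlieAt N 1 (adRep (underlieObj H N) h F) = N.act h (underlieAt N 1 F) := by
  change N.act h (underlieAt N (h⁻¹ * 1 * h⁻¹⁻¹) F) = _
  simp

/-- The morphism `coind M → N` corresponding to `M → N ⊗ ℂH`. -/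
def ofUnderlie {N : YD G} {M : Bim H} (ψ : M ⟶ underlieObj H N) : coindObj M ⟶ N where
  lin := ofUnderlieLin ψ
  comp_lin g f := by
    rw [ofUnderlieLin_apply, ofUnderlieLin_apply, map_smul, map_sum]
    refine congrArg _ (Finset.sum_congr rfl fun x _ => ?_)
    change N.act x⁻¹ (underlieAt N 1 (ψ.lin (M.comp (x * g * x⁻¹) (f.1 x)))) = _
    rw [ψ.comp_lin, underlieAt_comp, ← N.comp_act]
    congr 2
    group
  act_lin y f := by
    rw [ofUnderlieLin_apply, ofUnderlieLin_apply, map_smul, map_sum]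
    congr 1
    refine Fintype.sum_equiv (Equiv.mulRight y) _ _ fun x => ?_
    change N.act x⁻¹ (underlieAt N 1 (ψ.lin (f.1 (x * y)))) = _
    rw [rep_apply_apply]
    simp

theorem ofUnderlie_toUnderlie {N : YD G} {M : Bim H} (φ : coindObj M ⟶ N) :
    ofUnderlie (toUnderlie φ) = φ :=
  YD.hom_ext fun f => by
    refine (ofUnderlieLin_apply _ f).trans ?_
    conv_rhs => rw [← sum_coindIncl M f, map_smul, map_sum]
    refine congrArg _ (Finset.sum_congr rfl fun x _ => ?_)
    rw [underlieAt_toUnderlie, φ.act_lin]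
    simp

theorem toUnderlie_ofUnderlie {N : YD G} {M : Bim H} (ψ : M ⟶ underlieObj H N) :
    toUnderlie (ofUnderlie ψ) = ψ :=
  Bim.hom_ext fun m => underlieObj_ext fun k => by
    classical
    refine (underlieAt_toUnderlie (ofUnderlie ψ) m k).trans ((ofUnderlieLin_apply ψ _).trans ?_)
    -- The function is supported on `H`, so the average over `G` collapses to `|H|` terms, all equal
    -- by equivariance of the coefficient at `1`.
    have e : ∀ x, N.act x⁻¹ (underlieAt N 1 (ψ.lin
        ((coindIncl M (M.right (MulOpposite.op k⁻¹) m)).1 x))) =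
        if x ∈ H then underlieAt N k (ψ.lin m) else 0 := by
      intro x
      split_ifs with hx
      · rw [show (coindIncl M (M.right (MulOpposite.op k⁻¹) m)).1 x = _ from
          coindIncl_coe M _ ⟨x, hx⟩, adRep_naturality, underlieAt_adRep, rep_apply_apply,
          inv_mul_cancel, map_one, Module.End.one_apply, ψ.right_lin]
        change underlieAt N (1 * k⁻¹⁻¹) _ = _
        rw [one_mul, inv_inv]
        rfl
      · rw [coindIncl_of_notMem M _ hx, map_zero, map_zero, map_zero]
    simp only [e]
    rw [← sum_subgroup H fun _ => underlieAt N k (ψ.lin m)]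
    exact card_inv_smul_sum _

theorem ofUnderlie_naturality {N : YD G} {M M' : Bim H} (f : M ⟶ M')
    (ψ : M' ⟶ underlieObj H N) : ofUnderlie (f ≫ ψ) = coindMap f ≫ ofUnderlie ψ :=
  YD.hom_ext fun v => by
    change ofUnderlieLin (f ≫ ψ) v = ofUnderlieLin ψ ((coindMap f).lin v)
    rw [ofUnderlieLin_apply, ofUnderlieLin_apply]
    rfl

variable (H) in
/-- Coinduction is left adjoint to `N ↦ N ⊗ ℂH`. -/
def coindUnderlieAdjunction : coind (G := G) H ⊣ underlie H :=
  Adjunction.mkOfHomEquiv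
    { homEquiv := fun _ _ =>
        ⟨toUnderlie, ofUnderlie, ofUnderlie_toUnderlie, toUnderlie_ofUnderlie⟩
      homEquiv_naturality_left_symm := ofUnderlie_naturality
      homEquiv_naturality_right := fun _ _ => rfl }

end Coind

/-! ### The bimodules underlying induced Yetter-Drinfeld modules -/

section IndEval

variable {K L : Type} [Group K] [Group L] [Fintype K] [Fintype L]
  {A : Type} [AddCommGroup A] [Module ℂ A]

theorem indEval_act (φ : K →* L) (ρ : Representation ℂ K A) (k : K)
    (v : Representation.IndV φ ρ) :
    indEval φ ρ (Representation.ind φ ρ (φ k) v) = ρ k (indEval φ ρ v) :=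
  indV_ext (f := (indEval φ ρ).comp (Representation.ind φ ρ (φ k)))
    (g := (ρ k).comp (indEval φ ρ)) (fun l a => by
      change indEval φ ρ (Representation.ind φ ρ (φ k) (Representation.IndV.mk φ ρ l a)) =
        ρ k (indEval φ ρ (Representation.IndV.mk φ ρ l a))
      rw [Representation.ind_mk, indEval_mk, indEval_mk, ← zeroExt_mul_left, mul_inv_rev,
        inv_inv]) v

theorem indEval_act_mk_one (φ : K →* L) (ρ : Representation ℂ K A) (l : L) (a : A) :
    indEval φ ρ (Representation.ind φ ρ l (Representation.IndV.mk φ ρ 1 a)) =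
      zeroExt φ ρ l a := by
  rw [Representation.ind_mk, indEval_mk, one_mul, inv_inv]

/-- The retraction `indEval` corresponds under Frobenius reciprocity to the identity of the induced
representation; by equivariance it suffices to look at `1 ⊗ a`. -/
theorem indInto_indEval (φ : K →* L) (ρ : Representation ℂ K A) (v : Representation.IndV φ ρ) :
    indInto φ ρ (Representation.ind φ ρ) (indEval φ ρ) v = v := by
  refine indV_induction (P := fun v => indInto φ ρ (Representation.ind φ ρ) (indEval φ ρ) v = v)
    (map_zero _) (fun a => indInto_of_zeroExt _ _ _ _ _ _ fun l => indEval_act_mk_one φ ρ l a)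
    (fun v w hv hw => by rw [map_add, hv, hw]) (fun l v hv => by rw [indInto_act, hv]) v

/-- By `indInto_indEval` a vector is an average built from the evaluations of its translates. -/
theorem eq_zero_of_indEval (φ : K →* L) (ρ : Representation ℂ K A) (v : Representation.IndV φ ρ)
    (h : ∀ l, indEval φ ρ (Representation.ind φ ρ l v) = 0) : v = 0 := by
  rw [← indInto_indEval φ ρ v, indInto_apply]
  simp only [h, map_zero, Finset.sum_const_zero, smul_zero]

theorem indInto_eq_zero {B : Type} [AddCommGroup B] [Module ℂ B] (φ : K →* L)
    (ρ : Representation ℂ K A) (σ : Representation ℂ L B) (π : B →ₗ[ℂ] A) {b : B}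
    (h : ∀ l, π (σ l b) = 0) : indInto φ ρ σ π b = 0 := by
  simp only [indInto_apply, h, map_zero, Finset.sum_const_zero, smul_zero]

end IndEval

/-! ### The Mackey decomposition of `Ind_g(V) ⊗ ℂH` -/

section Underlie

variable {H : Subgroup G} (g : G) (V : FDRep ℂ (cent g))

/-- The retraction of `Ind_g(V)` onto its component `V` of degree `g`. -/
def indYDEval : indYD g V →ₗ[ℂ] V := indEval (cent g).subtype V.ρ

theorem indYDEval_act (c : G) (hc : c ∈ cent g) (n : indYD g V) :
    indYDEval g V ((indYD g V).act c n) = V.ρ ⟨c, hc⟩ (indYDEval g V n) :=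
  indEval_act (cent g).subtype V.ρ ⟨c, hc⟩ n

/-- The element of `Ind_g(V)` of degree `g` given by an element of `V`. -/
def indYDMk : V →ₗ[ℂ] indYD g V := Representation.IndV.mk (cent g).subtype V.ρ 1

theorem indYDEval_act_mk (z : G) (v : V) :
    indYDEval g V ((indYD g V).act z (indYDMk g V v)) = zeroExt (cent g).subtype V.ρ z v :=
  indEval_act_mk_one (cent g).subtype V.ρ z v

theorem indYDEval_comp (k : G) [Decidable (k = g)] (n : indYD g V) :
    indYDEval g V ((indYD g V).comp k n) = if k = g then indYDEval g V n else 0 := by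
  classical
  have key : ∀ k, k ≠ g → ∀ n, indYDEval g V ((indYD g V).comp k n) = 0 := by
    intro k hk n
    refine indV_ext (f := (indEval (cent g).subtype V.ρ).comp (indYDComp g V k)) (g := 0)
      (fun l a => ?_) n
    rw [LinearMap.comp_apply, indYDComp_mk]
    split_ifs with h
    · rw [indEval_mk, zeroExt_of_notMem]
      · rfl
      · rintro c hc
        refine hk ?_
        have hc' : l = (c : G)⁻¹ := by
          rw [← inv_inv l, ← hc]
          rfl
        rw [← h, hc', inv_inv]
        have := mem_cent.1 c.2
        rw [this]
        group
    · exact map_zero _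
  split_ifs with h
  · conv_rhs => rw [← (indYD g V).sum_comp n, map_sum]
    rw [Finset.sum_eq_single k]
    · exact fun j _ hj => key j (h ▸ hj) n
    · simp
  · exact key k h n

theorem indYDEval_act_comp (z k : G) [Decidable (z * k * z⁻¹ = g)] (n : indYD g V) :
    indYDEval g V ((indYD g V).act z ((indYD g V).comp k n)) =
      if z * k * z⁻¹ = g then indYDEval g V ((indYD g V).act z n) else 0 := by
  rw [← (indYD g V).comp_act, indYDEval_comp]

theorem indYD_eq_zero {n : indYD g V} (h : ∀ z, indYDEval g V ((indYD g V).act z n) = 0) : n = 0 :=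
  eq_zero_of_indEval (cent g).subtype V.ρ n h

/-- The map `∑ₖ nₖ ⊗ k ↦ ∑ₖ nₖ`. -/
def sumAt (N : YD G) : underlieObj H N →ₗ[ℂ] N := ∑ k : H, underlieAt N k

theorem sumAt_incl (N : YD G) (b : H) (n : N) : sumAt N (underlieIncl N b n) = n := by
  classical
  simp [sumAt, underlieAt_incl]

theorem sumAt_left (N : YD G) (h : H) (F : underlieObj H N) :
    sumAt N ((underlieObj H N).left h F) = N.act h (sumAt N F) :=
  LinearMap.congr_fun (underlie_ext (f := (sumAt N).comp ((underlieObj H N).left h))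
    (g := (N.act h).comp (sumAt N)) fun n b => by simp [sumAt_incl]) F

theorem sumAt_right (N : YD G) (k : (H)ᵐᵒᵖ) (F : underlieObj H N) :
    sumAt N ((underlieObj H N).right k F) = sumAt N F :=
  LinearMap.congr_fun (underlie_ext (f := (sumAt N).comp ((underlieObj H N).right k))
    (g := sumAt N) fun n b => by simp [sumAt_incl]) F

theorem sumAt_comp (N : YD G) (x : G) (F : underlieObj H N) :
    sumAt N ((underlieObj H N).comp x F) =
      ∑ k : H, N.comp (x * (k : G)⁻¹) (underlieAt N k F) := by
  rw [sumAt, LinearMap.sum_apply]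
  rfl

/-- The action of `H` on a Yetter-Drinfeld module. -/
def resAct (H : Subgroup G) (N : YD G) : Representation ℂ H N := N.act.comp H.subtype

/-- The representation of `Stab_H((x ▷ g)H)` inducing the summand of `Ind_g(V) ⊗ ℂH`
corresponding to `x`. -/
def underlieRep (H : Subgroup G) (x : G) : FDRep ℂ (stab H (x * g * x⁻¹)) :=
  indRep (inf_conj_cent_le_stab H x g) (resRep inf_le_right (twist x V))

/-- The projection of `Ind_g(V)` to `underlieRep`. -/
def underlieTau (H : Subgroup G) (x : G) : indYD g V →ₗ[ℂ] underlieRep g V H x :=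
  indInto (Subgroup.inclusion (inf_conj_cent_le_stab H x g))
    (FDRep.ρ (resRep inf_le_right (twist x V)))
    ((resAct H (indYD g V)).comp (stabIncl H (x * g * x⁻¹)))
    (indYDEval g V ∘ₗ (indYD g V).act x⁻¹)

theorem underlieTau_act (x : G) (s : stab H (x * g * x⁻¹)) (n : indYD g V) :
    underlieTau g V H x ((indYD g V).act s n) =
      (underlieRep g V H x).ρ s (underlieTau g V H x n) :=
  indInto_act _ _ _ _ s n

/-- The inducing map `n ↦ ev(x⁻¹ n)` is equivariant for `k` in `H ∩ (x ▷ C)`, because `x⁻¹k =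
(x⁻¹kx)x⁻¹` with `x⁻¹kx` in `C`. -/
theorem indEval_underlieTau (x : G) (n : indYD g V) :
    indEval (Subgroup.inclusion (inf_conj_cent_le_stab H x g))
      (FDRep.ρ (resRep inf_le_right (twist x V))) (underlieTau g V H x n) =
      indYDEval g V ((indYD g V).act x⁻¹ n) :=
  indEval_indInto (fun k n => by
    change indYDEval g V ((indYD g V).act x⁻¹ ((indYD g V).act k n)) = _
    have hk := mem_conjSub.1 k.2.2
    refine Eq.trans ?_ (indYDEval_act g V _ hk _)
    rw [rep_apply_apply, rep_apply_apply]
    congr 2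
    group) n

theorem underlieTau_eq_zero (x : G) {n : indYD g V}
    (h : ∀ s : stab H (x * g * x⁻¹),
      indYDEval g V ((indYD g V).act x⁻¹ ((indYD g V).act s n)) = 0) :
    underlieTau g V H x n = 0 :=
  indInto_eq_zero _ _ _ _ h

/-- The projection of `Ind_g(V) ⊗ ℂH` to `underlieRep`. -/
def underlieProj (H : Subgroup G) (x : G) :
    underlieObj H (indYD g V) →ₗ[ℂ] underlieRep g V H x :=
  underlieTau g V H x ∘ₗ sumAt (indYD g V)

/-- A nonzero contribution needs `k = s⁻¹(x ▷ g)s b` with `s` in the stabilizer and `b` in `H`. Such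
a `k` lies in `(x ▷ g)H`, as the stabilizer preserves this coset. -/
theorem underlieProj_comp (x k : G) (hk : (x * g * x⁻¹)⁻¹ * k ∉ H)
    (F : underlieObj H (indYD g V)) :
    underlieProj g V H x ((underlieObj H (indYD g V)).comp k F) = 0 := by
  refine LinearMap.congr_fun (underlie_ext
    (f := (underlieProj g V H x).comp ((underlieObj H (indYD g V)).comp k)) (g := 0)
    fun n b => ?_) F
  rw [LinearMap.comp_apply, underlie_comp, underlieProj, LinearMap.comp_apply, sumAt_incl]
  refine underlieTau_eq_zero g V x fun s => ?_
  classical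
  rw [rep_apply_apply, indYDEval_act_comp, if_neg]
  intro e
  apply hk
  have hs := H.mul_mem (H.mul_mem (H.inv_mem (conj_stab_mem s)) s.2.1) b.2
  have e' : (s : G)⁻¹ * (x * g * x⁻¹) * s * b = k := by
    calc (s : G)⁻¹ * (x * g * x⁻¹) * s * b = (s : G)⁻¹ * x * g * x⁻¹ * s * b := by group
      _ = (s : G)⁻¹ * x * (x⁻¹ * s * (k * (b : G)⁻¹) * (x⁻¹ * s)⁻¹) * x⁻¹ * s * b :=
        congrArg (fun t => (s : G)⁻¹ * x * t * x⁻¹ * s * b) e.symm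
      _ = k := by group
  rw [← e']
  convert hs using 1
  group

theorem underlieProj_left (x : G) (s : stab H (x * g * x⁻¹)) (F : underlieObj H (indYD g V)) :
    underlieProj g V H x ((underlieObj H (indYD g V)).left (stabIncl H _ s) F) =
      (underlieRep g V H x).ρ s (underlieProj g V H x F) := by
  rw [underlieProj, LinearMap.comp_apply, sumAt_left]
  exact underlieTau_act g V x s _

theorem underlieProj_right (x : G) (k : (H)ᵐᵒᵖ) (F : underlieObj H (indYD g V)) :
    underlieProj g V H x ((underlieObj H (indYD g V)).right k F) = underlieProj g V H x F := by
  rw [underlieProj, LinearMap.comp_apply, sumAt_right]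
  rfl

variable {𝔛 : Set G}

/-- To see that the coefficient of `F` at `k` vanishes it is enough to evaluate all its translates
by `z`. Writing `z⁻¹ = hxc` reduces this to the projection belonging to `x`, the factor `c` acting
invertibly on `V`. -/
theorem underlieProj_separates (h𝔛 : IsDoubleCosetReps H (cent g) 𝔛)
    (F : underlieObj H (indYD g V))
    (hF : ∀ (x : 𝔛) h k, underlieProj g V H x
      ((underlieObj H (indYD g V)).left h ((underlieObj H (indYD g V)).comp k F)) = 0) :
    F = 0 := by
  classical
  refine underlieObj_ext fun k => ?_
  rw [map_zero]
  refine indYD_eq_zero g V fun z => ?_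
  obtain ⟨x, ⟨hx, hz⟩, -⟩ := h𝔛 z⁻¹
  obtain ⟨h, hh, c, hc, hz⟩ := DoubleCoset.mem_doubleCoset.1 hz
  -- The degree is `(hx ▷ g)k`: under the projection after translation by `h⁻¹`, it isolates the
  -- coefficient of `F` at `k`.
  have key := (indEval_underlieTau g V x _).symm.trans ((congrArg (indEval
    (Subgroup.inclusion (inf_conj_cent_le_stab H x g))
    (FDRep.ρ (resRep inf_le_right (twist x V))))
    (hF ⟨x, hx⟩ ⟨h, hh⟩⁻¹ (h * x * g * x⁻¹ * h⁻¹ * k))).trans (map_zero _))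
  rw [sumAt_left, sumAt_comp, map_sum, map_sum, map_sum, Finset.sum_eq_single k] at key
  · have e : z = c⁻¹ * x⁻¹ * h⁻¹ := by
      rw [← inv_inv z, hz]
      group
    rw [rep_apply_apply, indYDEval_act_comp, if_pos (by simp; group)] at key
    rw [e, mul_assoc, ← rep_apply_apply, indYDEval_act g V _ ((cent g).inv_mem hc)]
    refine (congrArg _ ?_).trans (map_zero _)
    exact key
  · intro j _ hj
    rw [rep_apply_apply, indYDEval_act_comp, if_neg]
    intro e
    apply hj
    refine Subtype.ext ?_
    have e' : (x⁻¹ * h⁻¹) * (h * x * g * x⁻¹ * h⁻¹ * k * (j : G)⁻¹) * (x⁻¹ * h⁻¹)⁻¹ = g := e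
    have e2 : (k : G) * (j : G)⁻¹ = 1 := by
      calc (k : G) * (j : G)⁻¹ = h * x * g⁻¹ * ((x⁻¹ * h⁻¹) * (h * x * g * x⁻¹ * h⁻¹ * k *
            (j : G)⁻¹) * (x⁻¹ * h⁻¹)⁻¹) * x⁻¹ * h⁻¹ := by group
        _ = 1 := by rw [e']; group
    exact (mul_inv_eq_one.1 e2).symm
  · simp

theorem underlieProj_exists (h𝔛 : IsDoubleCosetReps H (cent g) 𝔛) (x : 𝔛)
    (a : underlieRep g V H x) : ∃ F : underlieObj H (indYD g V),
      (∀ h, underlieProj g V H x ((underlieObj H (indYD g V)).left h F) =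
        zeroExt (stabIncl H (x * g * (x : G)⁻¹)) (underlieRep g V H x).ρ h a) ∧
      ∀ y : 𝔛, y ≠ x → ∀ h, underlieProj g V H y
        ((underlieObj H (indYD g V)).left h F) = 0 := by
  revert a
  refine indV_induction ⟨0, fun h => by rw [map_zero, map_zero]; exact (map_zero _).symm,
    fun y _ h => by rw [map_zero, map_zero]⟩ (fun v => ?_) ?_ ?_
  · change V at v
    -- The witness is `xv ⊗ 1`, with `v` placed in degree `g`, so that `xv` has degree `x ▷ g`.
    refine ⟨underlieIncl _ 1 ((indYD g V).act x (indYDMk g V v)), fun h => ?_, fun y hy h => ?_⟩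
    · rw [underlieProj, LinearMap.comp_apply, sumAt_left, sumAt_incl]
      refine indInto_tower (Subgroup.inclusion (inf_conj_cent_le_stab H x g))
        (stabIncl H (x * g * (x : G)⁻¹)) (FDRep.ρ (resRep inf_le_right (twist (x : G) V)))
        (resAct H (indYD g V)) (indYDEval g V ∘ₗ (indYD g V).act (x : G)⁻¹) _ v (fun h => ?_) h
      change indYDEval g V ((indYD g V).act (x : G)⁻¹ ((indYD g V).act h
        ((indYD g V).act x (indYDMk g V v)))) = _
      rw [rep_apply_apply, rep_apply_apply, indYDEval_act_mk]
      -- Evaluation at `x⁻¹hx` is nonzero only on `C`, and for `h` in `H` this says that `h` lies in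
      -- `H ∩ (x ▷ C)`.
      by_cases hh : (x : G)⁻¹ * (h : G) * x ∈ cent g
      · have h1 := zeroExt_of_mem (cent g).subtype_injective V.ρ ⟨_, hh⟩ v
        have h2 := zeroExt_of_mem (φ := (stabIncl H (x * g * (x : G)⁻¹)).comp
          (Subgroup.inclusion (inf_conj_cent_le_stab H x g)))
          (stabIncl_injective.comp
            (Subgroup.inclusion_injective (inf_conj_cent_le_stab H x g)))
          (FDRep.ρ (resRep inf_le_right (twist (x : G) V)))
          ⟨h, h.2, mem_conjSub.2 hh⟩ v
        exact h1.trans h2.symm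
      · rw [zeroExt_of_notMem (φ := (cent g).subtype)]
        · refine (zeroExt_of_notMem _ (fun k hk => hh ?_) _).symm
          rw [← hk]
          exact mem_conjSub.1 k.2.2
        · intro k hk
          rw [← hk] at hh
          exact hh k.2
    · rw [underlieProj, LinearMap.comp_apply, sumAt_left, sumAt_incl]
      refine underlieTau_eq_zero g V y fun s => ?_
      rw [rep_apply_apply, rep_apply_apply, rep_apply_apply, indYDEval_act_mk]
      -- A nonzero value would give `y⁻¹ s h x` in `C`, hence `HyC = HxC` and `y = x`.
      refine zeroExt_of_notMem (φ := (cent g).subtype) _ (fun k hk => hy ?_) v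
      obtain ⟨w, -, hw⟩ := h𝔛 y
      have h1 := hw y ⟨y.2, DoubleCoset.mem_doubleCoset.2 ⟨1, H.one_mem, 1, (cent g).one_mem,
        by simp⟩⟩
      have h2 := hw x ⟨x.2, DoubleCoset.mem_doubleCoset.2 ⟨s * h, H.mul_mem s.2.1 h.2, (k : G)⁻¹,
        (cent g).inv_mem k.2, by
          have : (k : G) = (y : G)⁻¹ * (s * (h * x)) := hk.trans (by group)
          rw [this]
          group⟩⟩
      exact Subtype.ext (h1.trans h2.symm)
  · rintro v w ⟨F, hF, hF'⟩ ⟨F', h1, h2⟩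
    refine ⟨F + F', fun h => ?_, fun y hy h => ?_⟩
    · rw [map_add, map_add, hF, h1]
      exact (map_add _ _ _).symm
    · rw [map_add, map_add, hF' y hy, h2 y hy, add_zero]
  · rintro s v ⟨F, hF, hF'⟩
    refine ⟨(underlieObj H (indYD g V)).left (stabIncl H _ s) F, fun h => ?_, fun y hy h => ?_⟩
    · rw [rep_apply_apply, hF]
      exact (zeroExt_act (stabIncl H (x * g * (x : G)⁻¹)) (underlieRep g V H x).ρ h s v).symm
    · rw [rep_apply_apply, hF' y hy]

/-- The decomposition of `Ind_g(V) ⊗ ℂH`. -/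
theorem nonempty_underlie_indYD_iso (h𝔛 : IsDoubleCosetReps H (cent g) 𝔛) :
    Nonempty ((underlie H).obj (indYD g V) ≅
      Bim.directSum fun x : 𝔛 => underlieSummand H g V x) :=
  ⟨Bim.isoOfBijective (Bim.toDirectSum fun x : 𝔛 => toIndBim _ (underlieRep g V H x)
      (underlieProj g V H x) (underlieProj_comp g V x) (underlieProj_left g V x)
      (underlieProj_right g V x))
    ⟨toIndBim_injective (B := underlieObj H (indYD g V))
        (fun x : 𝔛 => underlieProj_comp g V x) (fun x => underlieProj_left g V x)
        (fun x => underlieProj_right g V x) (underlieProj_separates g V h𝔛),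
      toIndBim_surjective (B := underlieObj H (indYD g V))
        (fun x : 𝔛 => underlieProj_comp g V x) (fun x => underlieProj_left g V x)
        (fun x => underlieProj_right g V x) (underlieProj_exists g V h𝔛)⟩⟩

end Underlie

/-! ### The Yetter-Drinfeld modules coinduced from induced bimodules -/

section CoindInd

variable {H : Subgroup G} {d : G} (W : FDRep ℂ (stab H d))

/-- Evaluation of `f : G → (H → G → W)` at `1`, `h` and `y`. -/
def coindAt (h : H) (y : G) : coindObj (indBimObj W) →ₗ[ℂ] W :=
  LinearMap.proj y ∘ₗ LinearMap.proj h ∘ₗ (indBimSub H d W).subtype ∘ₗ coindEval (indBimObj W)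

theorem coindAt_act (h : H) (y z : G) (f : coindSub (indBimObj W)) :
    coindAt W h y ((coindObj (indBimObj W)).act z f) = (show indBimSub H d W from f.1 z).1 h y :=
  congrArg (fun m : indBimSub H d W => m.1 h y) (coindEval_act (indBimObj W) z f)

theorem coindAt_comp (h : H) {y g : G} (hg : g ≠ y) (f : coindObj (indBimObj W)) :
    coindAt W h y ((coindObj (indBimObj W)).comp g f) = 0 := by
  classical
  refine (congrArg (fun m : indBimSub H d W => m.1 h y)
    (coindEval_comp (indBimObj W) g f)).trans ?_
  exact (indBimComp_apply W g _ h y).trans (if_neg hg.symm)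

theorem coindAt_act_coe (h a : H) (y : G) (f : coindObj (indBimObj W)) :
    coindAt W h y ((coindObj (indBimObj W)).act a f) =
      coindAt W (a⁻¹ * h) ((a : G)⁻¹ * y * a) f := by
  refine (congrArg (fun m : indBimSub H d W => m.1 h y)
    (coindEval_act_coe (indBimObj W) a f)).trans ?_
  change (show indBimSub H d W from coindEval (indBimObj W) f).1 (a⁻¹ * h)
    ((a : G)⁻¹ * y * ((a⁻¹ : H) : G)⁻¹) = _
  rw [InvMemClass.coe_inv, inv_inv]
  rfl

theorem coindAt_mul (h : H) (s : stab H d) (y : G) (f : coindObj (indBimObj W)) :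
    coindAt W (h * stabIncl H d s) y f = W.ρ s⁻¹ (coindAt W h y f) :=
  (show indBimSub H d W from coindEval (indBimObj W) f).2.2 h s y

theorem coindAt_eq_zero {h : H} {y : G} (hy : d⁻¹ * (h : G)⁻¹ * y ∉ H)
    (f : coindObj (indBimObj W)) : coindAt W h y f = 0 :=
  (show indBimSub H d W from coindEval (indBimObj W) f).2.1 h y hy

/-- The representation of `C_G(x ▷ g)` inducing the summand of the coinduced module
corresponding to `(g, x, h)`. -/
def adjointRep (g x : G) (h : H) : FDRep ℂ (cent (x * g * x⁻¹)) :=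
  indRep (inf_conj_cent_le_cent (conjSub (h : G) (stab H d)) x g)
    (resRep inf_le_left (twist (h : G) W))

/-- The projection of the coinduced module to `adjointRep`. -/
def adjointProj (g x : G) (h : H) : coindObj (indBimObj W) →ₗ[ℂ] adjointRep W g x h :=
  indInto (Subgroup.inclusion (inf_conj_cent_le_cent (conjSub (h : G) (stab H d)) x g))
    (FDRep.ρ (resRep inf_le_left (twist (h : G) W)))
    ((coindObj (indBimObj W)).act.comp (cent (x * g * x⁻¹)).subtype)
    (coindAt W h (x * g * x⁻¹))

theorem adjointProj_eq_zero {g x : G} {h : H} {f : coindObj (indBimObj W)}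
    (hf : ∀ l : cent (x * g * x⁻¹),
      coindAt W h (x * g * x⁻¹) ((coindObj (indBimObj W)).act l f) = 0) :
    adjointProj W g x h f = 0 :=
  indInto_eq_zero _ _ _ _ hf

theorem adjointProj_comp (g x : G) (h : H) (k : G) (hk : k ≠ x * g * x⁻¹)
    (f : coindObj (indBimObj W)) :
    adjointProj W g x h ((coindObj (indBimObj W)).comp k f) = 0 := by
  refine adjointProj_eq_zero W fun l => ?_
  rw [← (coindObj (indBimObj W)).comp_act, coindAt_comp]
  intro e
  apply hk
  calc k = (l : G)⁻¹ * (l * k * (l : G)⁻¹) * l := by group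
    _ = (l : G)⁻¹ * (x * g * x⁻¹ * l) := by rw [e, mul_assoc]
    _ = x * g * x⁻¹ := by rw [← mem_cent.1 l.2, inv_mul_cancel_left]

theorem adjointProj_act (g x : G) (h : H) (s : cent (x * g * x⁻¹))
    (f : coindObj (indBimObj W)) :
    adjointProj W g x h ((coindObj (indBimObj W)).act ((cent (x * g * x⁻¹)).subtype s) f) =
      (adjointRep W g x h).ρ s (adjointProj W g x h f) :=
  indInto_act _ _ _ _ s f

/-- For `k` in `(h ▷ S) ∩ (x ▷ C_G(g))`, conjugation by `k` fixes `x ▷ g`, while `k⁻¹h = hs⁻¹` with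
`s = h⁻¹kh` in `S`. Evaluation at `(h, x ▷ g)` is therefore equivariant. -/
theorem indEval_adjointProj (g x : G) (h : H) (f : coindObj (indBimObj W)) :
    indEval (Subgroup.inclusion (inf_conj_cent_le_cent (conjSub (h : G) (stab H d)) x g))
      (FDRep.ρ (resRep inf_le_left (twist (h : G) W))) (adjointProj W g x h f) =
      coindAt W h (x * g * x⁻¹) f :=
  indEval_indInto (fun k f => by
    have hs : (h : G)⁻¹ * k * h ∈ stab H d := mem_conjSub.1 k.2.1
    have hk : (k : G) ∈ H := by
      have := H.mul_mem (H.mul_mem h.2 hs.1) (H.inv_mem h.2)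
      convert this using 1
      group
    have hc := mem_cent.1 (inf_conj_cent_le_cent _ x g k.2)
    refine (coindAt_act_coe W h ⟨k, hk⟩ _ f).trans ?_
    have e1 : (⟨k, hk⟩⁻¹ * h : H) = h * stabIncl H d ⟨_, hs⟩⁻¹ := by
      refine Subtype.ext ?_
      change (k : G)⁻¹ * h = h * ((h : G)⁻¹ * k * h)⁻¹
      group
    have e2 : (k : G)⁻¹ * (x * g * x⁻¹) * k = x * g * x⁻¹ := by
      rw [mul_assoc, ← hc, inv_mul_cancel_left]
    refine (congrArg₂ (fun a b => coindAt W a b f) e1 e2).trans ?_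
    refine (coindAt_mul W h _ _ f).trans ?_
    rw [inv_inv]
    rfl) f

variable {𝔠 : Set G} {𝔛 : G → Set G} {𝔥 : Set G}

/-- Every evaluation point `(h', g')` can be moved to a point `(h, x ▷ g)` from the index set: `g'`
is conjugate to some `g` by `axc` with `a` in `H` and `c` in the centralizer, and then `a⁻¹h'` is
`h` up to `S`. Points violating the support condition contribute nothing. -/
theorem adjointProj_separates (h𝔠 : IsConjReps 𝔠)
    (h𝔛 : ∀ g ∈ 𝔠, IsDoubleCosetReps H (cent g) (𝔛 g)) (h𝔥 : IsCosetReps H (stab H d) 𝔥)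
    (f : coindObj (indBimObj W))
    (hf : ∀ (p : AdjointIndex H d 𝔠 𝔛 𝔥) z,
      adjointProj W p.1.1 p.1.2.1 ⟨p.1.2.2, h𝔥.1 p.2.2.2.1⟩
        ((coindObj (indBimObj W)).act z f) = 0) : f = 0 := by
  refine coindSub_ext fun z => Subtype.ext (funext fun h' => funext fun g' => ?_)
  refine (coindAt_act W h' g' z f).symm.trans ?_
  change coindAt W h' g' _ = 0
  by_cases hg' : d⁻¹ * (h' : G)⁻¹ * g' ∈ H
  swap
  · exact coindAt_eq_zero W hg' _
  obtain ⟨g, ⟨hg, hc⟩, -⟩ := h𝔠 g'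
  obtain ⟨w, rfl⟩ := isConj_iff.1 hc
  obtain ⟨x, ⟨hx, hw⟩, -⟩ := h𝔛 g hg w
  obtain ⟨a, ha, c, hc', rfl⟩ := DoubleCoset.mem_doubleCoset.1 hw
  have ha : a ∈ H := ha
  obtain ⟨h, ⟨hh, hs⟩, -⟩ := h𝔥.2 (a⁻¹ * h') (H.mul_mem (H.inv_mem ha) h'.2)
  have e : a * x * c * g * (a * x * c)⁻¹ = a * (x * g * x⁻¹) * a⁻¹ := by
    calc a * x * c * g * (a * x * c)⁻¹ = a * x * (c * g) * c⁻¹ * x⁻¹ * a⁻¹ := by group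
      _ = _ := by rw [mem_cent.1 hc']; group
  have hp : x * g * x⁻¹ = h * d * (d⁻¹ * h⁻¹ * (x * g * x⁻¹)) := by group
  -- The support condition at `(h', g')` translates into `x ▷ g ∈ hdH`, so `(g, x, h)` is an
  -- admissible index.
  have hm : d⁻¹ * h⁻¹ * (x * g * x⁻¹) ∈ H := by
    rw [e] at hg'
    have := H.mul_mem (H.mul_mem (conj_stab_mem ⟨_, hs⟩) hg') ha
    convert this using 1
    group
  have key := (indEval_adjointProj W g x ⟨h, h𝔥.1 hh⟩ _).symm.trans ((congrArg (indEval
    (Subgroup.inclusion (inf_conj_cent_le_cent (conjSub (h : G) (stab H d)) x g))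
    (FDRep.ρ (resRep inf_le_left (twist (h : G) W))))
    (hf ⟨(g, x, h), hg, hx, hh, _, hm, hp⟩ (a⁻¹ * z))).trans (map_zero _))
  rw [← rep_apply_apply] at key
  have key' := (coindAt_act_coe W ⟨h, h𝔥.1 hh⟩ ⟨a⁻¹, H.inv_mem ha⟩ _ _).symm.trans key
  -- The value at `(h', g')` is the value at `(h, x ▷ g)` of the translate by `a⁻¹`, up to the
  -- action of an element of `S`.
  have e1 : h' = (⟨a⁻¹, H.inv_mem ha⟩⁻¹ * ⟨h, h𝔥.1 hh⟩ : H) * stabIncl H d ⟨_, hs⟩ := by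
    refine Subtype.ext ?_
    change (h' : G) = a⁻¹⁻¹ * h * (h⁻¹ * (a⁻¹ * h'))
    group
  have e2 : a * x * c * g * (a * x * c)⁻¹ = a⁻¹⁻¹ * (x * g * x⁻¹) * a⁻¹ := by
    rw [e, inv_inv]
  refine (congrArg₂ (fun a b => coindAt W a b ((coindObj (indBimObj W)).act z f)) e1 e2).trans ?_
  refine (coindAt_mul W _ _ _ _).trans ?_
  exact (congrArg _ key').trans (map_zero _)

/-- The element of the coinduced module supported on `H` whose value at `1` is `h w k`, with
`w ∈ W` in degree `d`. -/
def coindMk (h k : H) (w : W) : coindObj (indBimObj W) :=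
  coindIncl (indBimObj W) (indBimLeft W h (indBimRight W (MulOpposite.op k) (indBimMk W w)))

theorem coindAt_mk_of_notMem (h k h' : H) (w : W) (y : G) {z : G} (hz : z ∉ H) :
    coindAt W h' y ((coindObj (indBimObj W)).act z (coindMk W h k w)) = 0 :=
  (coindAt_act W h' y z _).trans
    (congrArg (fun m : indBimSub H d W => m.1 h' y) (coindIncl_of_notMem (indBimObj W) _ hz))

theorem coindAt_mk (h k h' : H) (w : W) (y : G) (z : H)
    [Decidable ((z : G)⁻¹ * y * z = h * d * k)] :
    coindAt W h' y ((coindObj (indBimObj W)).act z (coindMk W h k w)) =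
      if (z : G)⁻¹ * y * z = h * d * k then
        zeroExt (stabIncl H d) W.ρ (h'⁻¹ * z * h) w else 0 := by
  classical
  refine (coindAt_act_coe W h' z y _).trans ?_
  have e0 : coindEval (indBimObj W) (coindMk W h k w) =
      indBimLeft W h (indBimRight W (MulOpposite.op k) (indBimMk W w)) := by
    have := coindIncl_coe (indBimObj W)
      (indBimLeft W h (indBimRight W (MulOpposite.op k) (indBimMk W w))) 1
    rw [map_one] at this
    exact this
  refine (congrArg (fun m : indBimSub H d W => m.1 (z⁻¹ * h') ((z : G)⁻¹ * y * z)) e0).trans ?_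
  change (if (h : G)⁻¹ * ((z : G)⁻¹ * y * z) * (k : G)⁻¹ = d then
    zeroExt (stabIncl H d) W.ρ (h⁻¹ * (z⁻¹ * h'))⁻¹ w else 0) = _
  have e1 : (h⁻¹ * (z⁻¹ * h'))⁻¹ = h'⁻¹ * z * h := by group
  rw [e1]
  refine if_congr ?_ rfl rfl
  rw [mul_inv_eq_iff_eq_mul, inv_mul_eq_iff_eq_mul, mul_assoc (h : G)]

/-- The value at `z` is nonzero only if `z` lies in `H`, commutes with `x ▷ g = hdk`, and has
`h⁻¹zh` in `S`. Together these conditions say that `z` is in `(h ▷ S) ∩ (x ▷ C_G(g))`. -/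
theorem coindAt_mk_self (g x : G) (h k : H) (hk : x * g * x⁻¹ = h * d * k) (w : W) (z : G) :
    coindAt W h (x * g * x⁻¹) ((coindObj (indBimObj W)).act z (coindMk W h k w)) =
      zeroExt ((cent (x * g * x⁻¹)).subtype.comp
        (Subgroup.inclusion (inf_conj_cent_le_cent (conjSub (h : G) (stab H d)) x g)))
        (FDRep.ρ (resRep inf_le_left (twist (h : G) W))) z w := by
  classical
  by_cases hz : z ∈ H
  · refine (coindAt_mk W h k h w _ ⟨z, hz⟩).trans ?_
    change (if z⁻¹ * (x * g * x⁻¹) * z = h * d * k then _ else _) = _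
    rw [← hk]
    by_cases hK : z ∈ conjSub (h : G) (stab H d) ⊓ conjSub x (cent g)
    · have hc := mem_cent.1 (inf_conj_cent_le_cent _ x g hK)
      rw [if_pos (by rw [mul_assoc, ← hc, inv_mul_cancel_left])]
      have h1 := zeroExt_of_mem (stabIncl_injective (H := H) (d := d)) W.ρ
        ⟨_, mem_conjSub.1 hK.1⟩ w
      have h2 := zeroExt_of_mem (φ := (cent (x * g * x⁻¹)).subtype.comp
        (Subgroup.inclusion (inf_conj_cent_le_cent (conjSub (h : G) (stab H d)) x g)))
        ((cent (x * g * x⁻¹)).subtype_injective.comp (Subgroup.inclusion_injective _))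
        (FDRep.ρ (resRep inf_le_left (twist (h : G) W))) ⟨z, hK⟩ w
      exact h1.trans h2.symm
    · refine Eq.trans ?_ (zeroExt_of_notMem _ (fun k' hk' => hK ?_) w).symm
      · split_ifs with e
        · refine zeroExt_of_notMem (φ := stabIncl H d) _ (fun s hs => hK ⟨?_, ?_⟩) w
          · refine mem_conjSub.2 ?_
            have := congrArg (Subtype.val) hs
            rw [← show (s : G) = (h : G)⁻¹ * z * h from this]
            exact s.2
          · change z ∈ conjSub x (cent g)
            rw [conj_cent, mem_cent]
            conv_lhs => rw [← e]
            group
        · rfl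
      · rw [← hk']
        exact k'.2
  · refine (coindAt_mk_of_notMem W h k h w _ hz).trans
      (zeroExt_of_notMem _ (fun k' hk' => hz ?_) w).symm
    rw [← hk']
    have := H.mul_mem (H.mul_mem h.2 (mem_conjSub.1 k'.2.1).1) (H.inv_mem h.2)
    convert this using 1
    change (k' : G) = _
    group

/-- An index is determined by the `H`-conjugacy class of `x ▷ g`: the class in `G` fixes `g`, the
class under `H` fixes the double coset of `x`, and then `x ▷ g ∈ hdH` fixes the coset `hS`. -/
theorem adjointIndex_ext (h𝔠 : IsConjReps 𝔠)
    (h𝔛 : ∀ g ∈ 𝔠, IsDoubleCosetReps H (cent g) (𝔛 g)) (h𝔥 : IsCosetReps H (stab H d) 𝔥)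
    {p q : AdjointIndex H d 𝔠 𝔛 𝔥} {z : G} (hz : z ∈ H)
    (e : z⁻¹ * (q.1.2.1 * q.1.1 * q.1.2.1⁻¹) * z = p.1.2.1 * p.1.1 * p.1.2.1⁻¹) : q = p := by
  obtain ⟨⟨g, x, h⟩, hg, hx, hh, k, hk, hp⟩ := p
  obtain ⟨⟨g', x', h'⟩, hg', hx', hh', k', hk', hp'⟩ := q
  dsimp only at *
  obtain ⟨c, -, hc⟩ := h𝔠 g
  obtain rfl : g' = g := by
    refine (hc g' ⟨hg', isConj_iff.2 ⟨x⁻¹ * z⁻¹ * x', ?_⟩⟩).trans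
      (hc g ⟨hg, IsConj.refl g⟩).symm
    calc x⁻¹ * z⁻¹ * x' * g' * (x⁻¹ * z⁻¹ * x')⁻¹ =
        x⁻¹ * (z⁻¹ * (x' * g' * x'⁻¹) * z) * x := by group
      _ = g := by rw [e]; group
  obtain ⟨c, -, hc⟩ := h𝔛 g' hg x'
  obtain rfl : x' = x := by
    refine (hc x' ⟨hx', DoubleCoset.mem_doubleCoset.2 ⟨1, H.one_mem, 1, (cent g').one_mem,
      by simp⟩⟩).trans (hc x ⟨hx, DoubleCoset.mem_doubleCoset.2
        ⟨z, hz, x⁻¹ * z⁻¹ * x', ?_, by group⟩⟩).symm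
    refine mem_cent.2 ?_
    calc x⁻¹ * z⁻¹ * x' * g' = x⁻¹ * (z⁻¹ * (x' * g' * x'⁻¹) * z) * z⁻¹ * x' := by group
      _ = g' * (x⁻¹ * z⁻¹ * x') := by rw [e]; group
  obtain ⟨c, -, hc⟩ := h𝔥.2 h (h𝔥.1 hh)
  obtain rfl : h' = h := by
    refine (hc h' ⟨hh', H.mul_mem (H.inv_mem (h𝔥.1 hh')) (h𝔥.1 hh), mem_conjSub.2 ?_⟩).trans
      (hc h ⟨hh, by rw [inv_mul_cancel]; exact one_mem _⟩).symm
    -- From `h'dk' = hdk` one gets `d⁻¹h'⁻¹hd = k'k⁻¹ ∈ H`, so `h'⁻¹h` stabilizes `dH`.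
    have := H.mul_mem hk' (H.inv_mem hk)
    convert this using 1
    have e' : h' * d * k' = h * d * k := hp'.symm.trans hp
    calc d⁻¹ * (h'⁻¹ * h) * d = d⁻¹ * h'⁻¹ * (h * d * k) * k⁻¹ := by group
      _ = k' * k⁻¹ := by rw [← e']; group
  rfl

-- By generation it suffices to treat `1 ⊗ w`. The witness is supported on `H` with value `hwk` at
-- `1`, where `x ▷ g = hdk`, so this value has degree `x ▷ g`.
set_option maxHeartbeats 1000000 in
theorem adjointProj_exists (h𝔠 : IsConjReps 𝔠)
    (h𝔛 : ∀ g ∈ 𝔠, IsDoubleCosetReps H (cent g) (𝔛 g)) (h𝔥 : IsCosetReps H (stab H d) 𝔥)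
    (p : AdjointIndex H d 𝔠 𝔛 𝔥)
    (a : adjointRep W p.1.1 p.1.2.1 ⟨p.1.2.2, h𝔥.1 p.2.2.2.1⟩) :
    ∃ f : coindObj (indBimObj W),
      (∀ z, adjointProj W p.1.1 p.1.2.1 ⟨p.1.2.2, h𝔥.1 p.2.2.2.1⟩
        ((coindObj (indBimObj W)).act z f) =
          zeroExt (cent (p.1.2.1 * p.1.1 * p.1.2.1⁻¹)).subtype
            (adjointRep W p.1.1 p.1.2.1 ⟨p.1.2.2, h𝔥.1 p.2.2.2.1⟩).ρ z a) ∧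
      ∀ q : AdjointIndex H d 𝔠 𝔛 𝔥, q ≠ p → ∀ z,
        adjointProj W q.1.1 q.1.2.1 ⟨q.1.2.2, h𝔥.1 q.2.2.2.1⟩
          ((coindObj (indBimObj W)).act z f) = 0 := by
  classical
  revert a
  refine indV_induction ⟨0, fun z => by rw [map_zero, map_zero]; exact (map_zero _).symm,
    fun q _ z => by rw [map_zero, map_zero]⟩ (fun w => ?_) ?_ ?_
  · change W at w
    obtain ⟨k, hk, hp⟩ := p.2.2.2.2
    refine ⟨coindMk W ⟨p.1.2.2, h𝔥.1 p.2.2.2.1⟩ ⟨k, hk⟩ w, fun z => ?_, fun q hq z => ?_⟩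
    · exact indInto_tower
        (Subgroup.inclusion (inf_conj_cent_le_cent (conjSub p.1.2.2 (stab H d)) p.1.2.1 p.1.1))
        (cent (p.1.2.1 * p.1.1 * p.1.2.1⁻¹)).subtype
        (FDRep.ρ (resRep inf_le_left (twist p.1.2.2 W))) (coindObj (indBimObj W)).act
        (coindAt W ⟨p.1.2.2, h𝔥.1 p.2.2.2.1⟩ (p.1.2.1 * p.1.1 * p.1.2.1⁻¹)) _ w
        (coindAt_mk_self W p.1.1 p.1.2.1 ⟨p.1.2.2, h𝔥.1 p.2.2.2.1⟩ ⟨k, hk⟩ hp w) z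
    · refine adjointProj_eq_zero W fun l => ?_
      rw [rep_apply_apply]
      by_cases hz : (l : G) * z ∈ H
      · refine (coindAt_mk W _ _ _ w _ ⟨_, hz⟩).trans (if_neg fun e => hq ?_)
        exact adjointIndex_ext h𝔠 h𝔛 h𝔥 hz (e.trans hp.symm)
      · exact coindAt_mk_of_notMem W _ _ _ w _ hz
  · rintro v w ⟨f, hf, hf'⟩ ⟨f', h1, h2⟩
    refine ⟨f + f', fun z => ?_, fun q hq z => ?_⟩
    · rw [map_add, map_add, hf, h1]
      exact (map_add _ _ _).symm
    · rw [map_add, map_add, hf' q hq, h2 q hq, add_zero]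
  · rintro s v ⟨f, hf, hf'⟩
    refine ⟨(coindObj (indBimObj W)).act s f, fun z => ?_, fun q hq z => ?_⟩
    · rw [rep_apply_apply, hf]
      exact (zeroExt_act (cent (p.1.2.1 * p.1.1 * p.1.2.1⁻¹)).subtype
        (adjointRep W p.1.1 p.1.2.1 ⟨p.1.2.2, h𝔥.1 p.2.2.2.1⟩).ρ z s v).symm
    · rw [rep_apply_apply, hf' q hq]

/-- The decomposition of the Yetter-Drinfeld module coinduced from `Ind_d(W)`. -/
theorem nonempty_coind_indBim_iso (h𝔠 : IsConjReps 𝔠)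
    (h𝔛 : ∀ g ∈ 𝔠, IsDoubleCosetReps H (cent g) (𝔛 g)) (h𝔥 : IsCosetReps H (stab H d) 𝔥) :
    Nonempty ((coind H).obj ((indBim H d).obj W) ≅
      YD.directSum fun p : AdjointIndex H d 𝔠 𝔛 𝔥 =>
        adjointSummand H d W p.1.1 p.1.2.1 p.1.2.2) :=
  ⟨YD.isoOfBijective (YD.toDirectSum fun p : AdjointIndex H d 𝔠 𝔛 𝔥 =>
      toIndYD _ (adjointRep W p.1.1 p.1.2.1 ⟨p.1.2.2, h𝔥.1 p.2.2.2.1⟩)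
        (adjointProj W p.1.1 p.1.2.1 ⟨p.1.2.2, h𝔥.1 p.2.2.2.1⟩)
        (adjointProj_comp W p.1.1 p.1.2.1 ⟨p.1.2.2, h𝔥.1 p.2.2.2.1⟩))
    ⟨toIndYD_injective (B := coindObj (indBimObj W))
        (fun p : AdjointIndex H d 𝔠 𝔛 𝔥 =>
          adjointProj_comp W p.1.1 p.1.2.1 ⟨p.1.2.2, h𝔥.1 p.2.2.2.1⟩)
        (fun p => adjointProj_act W p.1.1 p.1.2.1 ⟨p.1.2.2, h𝔥.1 p.2.2.2.1⟩)
        (adjointProj_separates W h𝔠 h𝔛 h𝔥),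
      toIndYD_surjective (B := coindObj (indBimObj W))
        (fun p : AdjointIndex H d 𝔠 𝔛 𝔥 =>
          adjointProj_comp W p.1.1 p.1.2.1 ⟨p.1.2.2, h𝔥.1 p.2.2.2.1⟩)
        (adjointProj_exists W h𝔠 h𝔛 h𝔥)⟩⟩

end CoindInd

end
end GrpBimod

/-! ### Assembly of the four statements -/

theorem mainTheorem2 {G : Type} [Group G] [Fintype G] (H : Subgroup G) :
    -- `Ind_d` is inverse to the equivalence `M ↦ M_{dH} / H`
    (∀ d : G, ∃ e : FDRep ℂ (stab H d) ≌ (supportedOn H d).FullSubcategory,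
      Nonempty (e.functor ⋙ (supportedOn H d).ι ≅ indBim H d) ∧
      Nonempty (e.inverse ≅ (supportedOn H d).ι ⋙ fiber H d)) ∧
    -- the center is the category of Yetter-Drinfeld modules, with underlying functor `N ⊗ ℂH`
    ∃ (E : YD G ≌ RightCenter (Bim H))
      (η : E.functor ⋙ RightCenter.forget (Bim H) ≅ underlie H),
      (∀ (N : YD G) (M : Bim H) (g : G) (m : M) (n : N) (k : H), M.comp g m = m →
        (M ◁ η.inv.app N ≫ ((E.functor.obj N).half.c M).hom ≫ η.hom.app N ▷ M).lin
            (Bim.tm M (underlieObj H N) m (underlieMk H N n k)) =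
          Bim.tm (underlieObj H N) M (underlieMk H N (N.act g n) 1)
            (M.right (MulOpposite.op k) m)) ∧
      -- the underlying functor on the objects `Ind_g(V)`
      (∀ (g : G) (V : FDRep ℂ (cent g)) (𝔛 : Set G), IsDoubleCosetReps H (cent g) 𝔛 →
        Nonempty ((underlie H).obj (indYD g V) ≅
          Bim.directSum fun x : 𝔛 => underlieSummand H g V x)) ∧
      -- its two-sided adjoint on the objects `Ind_d(W)`
      ∃ K : Bim H ⥤ RightCenter (Bim H),
        Nonempty (K ⊣ RightCenter.forget (Bim H)) ∧
        Nonempty (RightCenter.forget (Bim H) ⊣ K) ∧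
        ∀ (d : G) (W : FDRep ℂ (stab H d)) (𝔠 : Set G) (𝔛 : G → Set G) (𝔥 : Set G),
          IsConjReps 𝔠 → (∀ g ∈ 𝔠, IsDoubleCosetReps H (cent g) (𝔛 g)) →
          IsCosetReps H (stab H d) 𝔥 →
          Nonempty (K.obj ((indBim H d).obj W) ≅
            E.functor.obj (YD.directSum fun p : AdjointIndex H d 𝔠 𝔛 𝔥 =>
              adjointSummand H d W p.1.1 p.1.2.1 p.1.2.2)) := by
  refine ⟨fun d => ⟨fiberEquivalence H d, ⟨Iso.refl _⟩, ⟨Iso.refl _⟩⟩,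
    (toCenter H).asEquivalence, Iso.refl (underlie H), fun N M g m n k hm => ?_,
    fun g V 𝔛 h𝔛 => nonempty_underlie_indYD_iso g V h𝔛,
    coind H ⋙ toCenter H, ⟨?_⟩, ⟨?_⟩, fun d W 𝔠 𝔛 𝔥 h𝔠 h𝔛 h𝔥 => ?_⟩
  · change (M ◁ 𝟙 (underlieObj H N) ≫ braidHom N M ≫ 𝟙 (underlieObj H N) ▷ M).lin
      (Bim.tm M (underlieObj H N) m (underlieIncl N k n)) = _
    rw [MonoidalCategory.whiskerLeft_id, MonoidalCategory.id_whiskerRight, Category.id_comp]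
    refine (braidHom_tm N M m n k).trans ?_
    -- As `m` is homogeneous of degree `g`, the sum over degrees has one term.
    rw [Finset.sum_eq_single g]
    · rw [hm]
      rfl
    · intro k' _ hk'
      rw [← hm, M.comp_ne _ _ hk', map_zero, map_zero]
    · simp
  -- Composition with the equivalence gives an adjunction whose right adjoint is its inverse
  -- followed by `underlie H`; the counit of the equivalence identifies this with the forgetful
  -- functor.
  · exact ((coindUnderlieAdjunction H).comp (toCenter H).asEquivalence.toAdjunction).ofNatIsoRight
      (Functor.isoWhiskerLeft (toCenter H).asEquivalence.inverse
        (Iso.refl (toCenter H ⋙ RightCenter.forget (Bim H))) ≪≫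
        (Functor.associator _ _ _).symm ≪≫
        Functor.isoWhiskerRight (toCenter H).asEquivalence.counitIso _ ≪≫
        Functor.leftUnitor _)
  -- The same identification of the forgetful functor, now with the reversed equivalence and
  -- coinduction as right adjoint.
  · exact ((toCenter H).asEquivalence.symm.toAdjunction.comp
      (underlieCoindAdjunction H)).ofNatIsoLeft
      (Functor.isoWhiskerLeft (toCenter H).asEquivalence.inverse
        (Iso.refl (toCenter H ⋙ RightCenter.forget (Bim H))) ≪≫
        (Functor.associator _ _ _).symm ≪≫
        Functor.isoWhiskerRight (toCenter H).asEquivalence.counitIso _ ≪≫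
        Functor.leftUnitor _)
  · obtain ⟨i⟩ := nonempty_coind_indBim_iso W h𝔠 h𝔛 h𝔥
    exact ⟨(toCenter H).mapIso i⟩
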